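/- Let $n\in\{2,3\}$, $R>0$ and $B_R=\{x\in\mathbb{R}^n:|x|<R\}$. There is a constant $C>0$, depending only on $n$ and $R$, with the following property. Let $k>0$, let $V\in L^\infty(B_R)$ be complex-valued (extended by zero to $\mathbb{R}^n$) with $$k^2\,\|V\|_{L^\infty(B_R)}<C,$$ and let $u^i$ be a unit-modulus plane wave of wave number $k$, i.e. $u^i(x)=c\,e^{ik\,x\cdot d}$ with $c\in\mathbb{C}$, $|c|=1$, $d\in\mathbb{R}^n$, $|d|=1$. Let $u\in H^1_{loc}(\mathbb{R}^n)$ be a total field created by $V$ and $u^i$, i.e. $(\Delta+k^2(1+V))u=0$ in $\mathbb{R}^n$ in the sense of distributions, and $u^s:=u-u^i$ satisfies the Sommerfeld radiation condition $$\lim_{|x|\to\infty}|x|^{\frac{n-1}{2}}\big(\partial_r-ik\big)u^s(x)=0\quad\text{uniformly in the direction } x/|x|.$$ Then $u$ has a continuous representative in $B_R$, and this representative does not vanish at any point of $B_R$. -/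

import Mathlib

open MeasureTheory Metric Laplacian
open scoped ContDiff

noncomputable section

namespace HelmholtzScattering

/-- Complex-valued test functions on `ℝⁿ`: smooth with compact support. -/
def IsTest {n : ℕ} (φ : EuclideanSpace ℝ (Fin n) → ℂ) : Prop :=
  ContDiff ℝ ∞ φ ∧ HasCompactSupport φ

/-- `u ∈ L²_loc(ℝⁿ)`: `u` is square integrable on every ball. -/
def MemL2Loc {n : ℕ} (u : EuclideanSpace ℝ (Fin n) → ℂ) : Prop :=
  ∀ r : ℝ, MemLp u 2 (volume.restrict (ball 0 r))

/-- `g` is the weak gradient of `u` on `ℝⁿ`: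
`∫ u ∂ᵢφ = - ∫ gᵢ φ` for every coordinate `i` and every test function `φ`. -/
def HasWeakGradient {n : ℕ} (u : EuclideanSpace ℝ (Fin n) → ℂ)
    (g : Fin n → EuclideanSpace ℝ (Fin n) → ℂ) : Prop :=
  ∀ i : Fin n, ∀ φ : EuclideanSpace ℝ (Fin n) → ℂ, IsTest φ →
    ∫ x, u x * fderiv ℝ φ x (EuclideanSpace.single i 1) = - ∫ x, g i x * φ x

/-- `u ∈ H¹_loc(ℝⁿ)` with weak gradient `g`. -/
def IsH1LocWith {n : ℕ} (u : EuclideanSpace ℝ (Fin n) → ℂ)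
    (g : Fin n → EuclideanSpace ℝ (Fin n) → ℂ) : Prop :=
  MemL2Loc u ∧ (∀ i, MemL2Loc (g i)) ∧ HasWeakGradient u g

/-- `u ∈ H¹_loc(ℝⁿ)`. -/
def MemH1Loc {n : ℕ} (u : EuclideanSpace ℝ (Fin n) → ℂ) : Prop :=
  ∃ g, IsH1LocWith u g

/-- `(Δ + k²(1 + V)) u = 0` in `ℝⁿ` in the sense of distributions. -/
def SolvesHelmholtz {n : ℕ} (k : ℝ) (V u : EuclideanSpace ℝ (Fin n) → ℂ) : Prop :=
  ∀ φ : EuclideanSpace ℝ (Fin n) → ℂ, IsTest φ →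
    ∫ x, u x * (Δ φ x + (k : ℂ) ^ 2 * (1 + V x) * φ x) = 0

/-- The Sommerfeld radiation condition
`|x|^((n-1)/2) (∂ᵣ - i k) w → 0` as `|x| → ∞`, uniformly in the direction `x / |x|`, for a
function `w ∈ H¹_loc(ℝⁿ)`. The radial derivative is `∂ᵣ w = ∑ᵢ (xᵢ / |x|) gᵢ` with `g` the weak
gradient of `w`, and the uniform limit is taken in the essential supremum. -/
def IsRadiating {n : ℕ} (k : ℝ) (w : EuclideanSpace ℝ (Fin n) → ℂ) : Prop :=
  ∃ g, IsH1LocWith w g ∧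
    ∀ ε : ℝ, 0 < ε → ∃ r₀ : ℝ, 0 < r₀ ∧
      ∀ᵐ x : EuclideanSpace ℝ (Fin n), r₀ ≤ ‖x‖ →
        ‖x‖ ^ (((n : ℝ) - 1) / 2) *
          ‖(∑ i, ((x i / ‖x‖ : ℝ) : ℂ) * g i x) - Complex.I * (k : ℂ) * w x‖ ≤ ε

/-- `u` is a total field created by the refractive index `V` and the incident wave `ui`
at wave number `k`. -/
structure IsTotalField {n : ℕ} (k : ℝ) (V ui u : EuclideanSpace ℝ (Fin n) → ℂ) : Prop where
  memH1Loc : MemH1Loc u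
  helmholtz : SolvesHelmholtz k V u
  radiating : IsRadiating k (fun x => u x - ui x)

/-- `ui` is a plane wave of unit modulus and wave number `k`: `ui(x) = c e^{i k x·d}` with
`c ∈ ℂ`, `|c| = 1`, and a real unit direction `d`. -/
def IsUnitPlaneWave {n : ℕ} (k : ℝ) (ui : EuclideanSpace ℝ (Fin n) → ℂ) : Prop :=
  ∃ (c : ℂ) (d : EuclideanSpace ℝ (Fin n)), ‖c‖ = 1 ∧ ‖d‖ = 1 ∧
    ∀ x, ui x = c * Complex.exp (Complex.I * (k : ℂ) * ((inner ℝ x d : ℝ) : ℂ))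

end HelmholtzScattering

end

/-!
# A small potential does not make the total field vanish

Let `w = u - uⁱ` be the scattered field and `f = k² V u` its source, so that `(Δ + k²) w = -f`
weakly, with `f ∈ L²` supported in `B_R`. Let `Φ(x) = G(|x|)` be the outgoing fundamental solution.

**Lippmann–Schwinger equation.** In `B_R` one has `u = uⁱ + Φ * f`. To see this with only `H¹_loc`
regularity, take a test function `ψ` and its potential `W = Φ * ψ`, which is smooth, solves
`(Δ + k²) W = -ψ`, decays like `|x|^{-(n-1)/2}` and radiates. Testing the equation of `w` with `W`
times a radial cut-off at scale `ρ` gives `∫ w ψ = ∫ f W`, up to a flux term through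
`ρ ≤ |x| ≤ 2ρ` in which only the radial defects `(∂ᵣ - ik) w` and `(∂ᵣ - ik) W` survive
(`WeakSolution.green`). The flux term vanishes as `ρ → ∞` because the averaged energy of `w` on
spheres is bounded (`WeakSolution.exists_flux_bound`), which is the imaginary part of the energy
identity for `w`. Fubini's theorem turns the weak identity into `w = Φ * f` almost everywhere in
`B_R` (`OutgoingProfile.ae_eq_localPotential`). The right-hand side is continuous, as the
convolution of two `L²` functions, and this is the continuous representative `v`.

**The fundamental solution.** All that is used of `G` is collected in `OutgoingProfile`. In dimension
three `G` is `e^{ikr} / (4πr)`. In dimension two it is a multiple of the Hankel function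
`H₀⁽¹⁾(kr)`, here defined by the Laplace-type integral
`e^{it} ∫₀^∞ e^{-tσ} (σ² - 2iσ)^{-1/2} dσ`, for which the decay, the radiation condition and the
logarithmic singularity can be read off.

**Non-vanishing.** On `B_R` the kernel is a constant `c` plus a part dominated by an integrable
singularity, uniformly in `k`, and `|c| ≤ C k^{-1/2}` (`exists_outgoingProfile`); `c` is needed in
dimension two, where `Φ` grows logarithmically as `k → 0`. With `M = max |v|` and `m = ∫ f`, it
follows that `v = uⁱ + c m + O(q M)` with `q = k² ‖V‖_∞` and `|m| = O(q M)`. If `k` is bounded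
below, then `c` is bounded, so `v` is within a small multiple of `M` of the unimodular `uⁱ` and
cannot vanish. If `k` is small, then `uⁱ` is within `kR` of the constant `uⁱ(0)`, and a zero of `v`
would force `a = uⁱ(0) + c m` and hence `M` to be `O(k)`. Then `|c m| = O(√k)`, which contradicts
`1 = |uⁱ(0)| ≤ |a| + |c m|`.
-/


namespace HelmholtzScattering

open Filter Topology Set

variable {n : ℕ}

/-! ### Coordinate derivatives and integration by parts -/

/-- Euclidean space `ℝⁿ`. -/
abbrev Space (n : ℕ) : Type := EuclideanSpace ℝ (Fin n)

/-- The partial derivative `∂ᵢφ`. -/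
noncomputable def pd {n : ℕ} (i : Fin n) (φ : Space n → ℂ) (x : Space n) : ℂ :=
  fderiv ℝ φ x (EuclideanSpace.single i 1)

lemma laplacian_eq_sum_pd {φ : Space n → ℂ} (hφ : ContDiff ℝ 2 φ) (x : Space n) :
    Δ φ x = ∑ i, pd i (pd i φ) x := by
  rw [InnerProductSpace.laplacian_eq_iteratedFDeriv_orthonormalBasis φ
    (EuclideanSpace.basisFun (Fin n) ℝ)]
  refine Finset.sum_congr rfl fun i _ => ?_
  have h1 : DifferentiableAt ℝ (fderiv ℝ φ) x :=
    ((hφ.fderiv_right (m := 1) (by norm_num)).differentiable (by norm_num)) x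
  unfold pd
  rw [iteratedFDeriv_two_apply, fderiv_clm_apply h1 (differentiableAt_const _)]
  simp

lemma contDiff_pd {φ : Space n → ℂ} (hφ : ContDiff ℝ ∞ φ) (i : Fin n) :
    ContDiff ℝ ∞ (pd i φ) :=
  (hφ.fderiv_right (m := ∞) (by simp)).clm_apply contDiff_const

lemma IsTest.pd {φ : Space n → ℂ} (hφ : IsTest φ) (i : Fin n) : IsTest (pd i φ) :=
  ⟨contDiff_pd hφ.1 i, hφ.2.fderiv_apply ℝ _⟩

lemma IsTest.continuous {φ : Space n → ℂ} (hφ : IsTest φ) : Continuous φ := hφ.1.continuous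

lemma IsTest.integrable {φ : Space n → ℂ} (hφ : IsTest φ) : Integrable φ :=
  hφ.continuous.integrable_of_hasCompactSupport hφ.2

lemma IsTest.differentiable {φ : Space n → ℂ} (hφ : IsTest φ) : Differentiable ℝ φ :=
  hφ.1.differentiable (by simp)

lemma IsTest.hasLineDerivAt {φ : Space n → ℂ} (hφ : IsTest φ) (i : Fin n) (x : Space n) :
    HasLineDerivAt ℝ φ (HelmholtzScattering.pd i φ x) x (EuclideanSpace.single i 1) :=
  (hφ.differentiable x).hasFDerivAt.hasLineDerivAt _

lemma IsTest.mul_right {χ φ : Space n → ℂ} (hφ : IsTest φ) (hχ : ContDiff ℝ ∞ χ) :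
    IsTest (fun x => φ x * χ x) :=
  ⟨hφ.1.mul hχ, hφ.2.mul_right⟩

lemma IsTest.exists_bound {φ : Space n → ℂ} (hφ : IsTest φ) : ∃ C, ∀ x, ‖φ x‖ ≤ C :=
  hφ.continuous.bounded_above_of_compact_support hφ.2

lemma exists_radius_of_hasCompactSupport {φ : Space n → ℂ} (hφ : HasCompactSupport φ) :
    ∃ r : ℝ, 0 < r ∧ ∀ x, r ≤ ‖x‖ → φ x = 0 := by
  obtain ⟨r, hr, h⟩ := hφ.exists_pos_le_norm
  exact ⟨r, hr, h⟩

lemma IsTest.exists_radius {φ : Space n → ℂ} (hφ : IsTest φ) :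
    ∃ r : ℝ, 0 < r ∧ ∀ x, r ≤ ‖x‖ → φ x = 0 :=
  exists_radius_of_hasCompactSupport hφ.2

/-- The reflected translate `y ↦ φ(x - y)` of a test function is a test function. -/
lemma IsTest.comp_sub {φ : Space n → ℂ} (hφ : IsTest φ) (x : Space n) :
    IsTest (fun y => φ (x - y)) := by
  refine ⟨hφ.1.comp (contDiff_const.sub contDiff_id), ?_⟩
  exact hφ.2.comp_homeomorph (Homeomorph.subLeft x)

lemma pd_comp_sub {φ : Space n → ℂ} (hφ : Differentiable ℝ φ) (i : Fin n) (x y : Space n) :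
    pd i (fun y => φ (x - y)) y = - pd i φ (x - y) := by
  have h : HasFDerivAt (fun y => φ (x - y))
      ((fderiv ℝ φ (x - y)).comp (-(ContinuousLinearMap.id ℝ (Space n)))) y := by
    refine HasFDerivAt.comp y (hφ (x - y)).hasFDerivAt ?_
    simpa using (hasFDerivAt_id y).const_sub x
  unfold pd
  rw [h.fderiv]
  simp

lemma pd_mul {φ ψ : Space n → ℂ} (hφ : Differentiable ℝ φ) (hψ : Differentiable ℝ ψ)
    (i : Fin n) (x : Space n) :
    pd i (fun x => φ x * ψ x) x = pd i φ x * ψ x + φ x * pd i ψ x := by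
  unfold pd
  rw [fderiv_fun_mul (hφ x) (hψ x)]
  simp
  ring

lemma pd_conj {φ : Space n → ℂ} (hφ : Differentiable ℝ φ) (i : Fin n) (x : Space n) :
    pd i (fun x => (starRingEnd ℂ) (φ x)) x = (starRingEnd ℂ) (pd i φ x) := by
  have h := (Complex.conjCLE.toContinuousLinearMap.hasFDerivAt (x := φ x)).comp x
    (hφ x).hasFDerivAt
  unfold pd
  rw [show (fun x => (starRingEnd ℂ) (φ x)) = (Complex.conjCLE : ℂ →L[ℝ] ℂ) ∘ φ from rfl, h.fderiv]
  simp

lemma IsTest.conj {φ : Space n → ℂ} (hφ : IsTest φ) :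
    IsTest (fun x => (starRingEnd ℂ) (φ x)) :=
  ⟨Complex.conjCLE.contDiff.comp hφ.1, hφ.2.comp_left (g := (starRingEnd ℂ)) (by simp)⟩

/-- Integration by parts in one coordinate direction against a test function. -/
lemma integral_mul_pd_eq_neg {f f' ψ : Space n → ℂ} (hf : Continuous f) (hf' : Continuous f')
    {i : Fin n} (hd : ∀ x, HasLineDerivAt ℝ f (f' x) x (EuclideanSpace.single i 1))
    (hψ : IsTest ψ) :
    ∫ x, f x * pd i ψ x = - ∫ x, f' x * ψ x := by
  refine integral_bilinear_hasLineDerivAt_right_eq_neg_left_of_integrable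
    (B := ContinuousLinearMap.mul ℝ ℂ) (v := EuclideanSpace.single i 1) ?_ ?_ ?_
    (fun x _ => hd x) (fun x _ => hψ.hasLineDerivAt i x)
  · exact (hf'.mul hψ.continuous).integrable_of_hasCompactSupport hψ.2.mul_left
  · exact (hf.mul (hψ.pd i).continuous).integrable_of_hasCompactSupport (hψ.pd i).2.mul_left
  · exact (hf.mul hψ.continuous).integrable_of_hasCompactSupport hψ.2.mul_left

/-! ### Radial functions and radial cut-offs -/

lemma hasFDerivAt_radial {F : Type*} [NormedAddCommGroup F] [NormedSpace ℝ F]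
    {G : ℝ → F} {G' : F} {x : Space n} (hx : x ≠ 0) (hG : HasDerivAt G G' ‖x‖) :
    HasFDerivAt (fun y : Space n => G ‖y‖)
      (((‖x‖⁻¹ : ℝ) • innerSL ℝ x).smulRight G') x := by
  have h1 : HasFDerivAt (fun y : Space n => ‖y‖) ((‖x‖⁻¹ : ℝ) • innerSL ℝ x) x := by
    have h2 := (hasStrictFDerivAt_norm_sq x).hasFDerivAt.sqrt (by positivity)
    refine (h2.congr_of_eventuallyEq (Eventually.of_forall fun y => ?_)).congr_fderiv ?_
    · simp [Real.sqrt_sq]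
    · ext v
      simp [Real.sqrt_sq]
      field_simp
  have := hG.hasFDerivAt.comp x h1
  refine this.congr_fderiv ?_
  ext v
  simp [smul_smul]

lemma hasLineDerivAt_radial {F : Type*} [NormedAddCommGroup F] [NormedSpace ℝ F]
    {G : ℝ → F} {G' : F} {x : Space n} (hx : x ≠ 0) (hG : HasDerivAt G G' ‖x‖) (i : Fin n) :
    HasLineDerivAt ℝ (fun y : Space n => G ‖y‖) ((x i / ‖x‖) • G') x
      (EuclideanSpace.single i 1) := by
  have h := (hasFDerivAt_radial hx hG).hasLineDerivAt (EuclideanSpace.single i 1)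
  convert! h using 1
  simp [EuclideanSpace.inner_single_right]
  ring_nf

/-- The radial profile of a smooth cut-off at scale `ρ`: it is `1` on `[0, ρ]` and `0` on
`[2ρ, ∞)`. -/
noncomputable def cut (ρ r : ℝ) : ℝ := Real.smoothTransition (2 - r ^ 2 / ρ ^ 2)

/-- Minus the derivative of `cut ρ`: a non-negative density on `[ρ, 2ρ]` of total mass one,
written `κ_ρ` in the comments. -/
noncomputable def cutFlux (ρ r : ℝ) : ℝ :=
  deriv Real.smoothTransition (2 - r ^ 2 / ρ ^ 2) * (2 * r / ρ ^ 2)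

lemma contDiff_cut_norm (ρ : ℝ) : ContDiff ℝ ∞ (fun x : Space n => cut ρ ‖x‖) := by
  unfold cut
  exact Real.smoothTransition.contDiff.comp
    (contDiff_const.sub ((contDiff_norm_sq ℝ).div_const _))

lemma contDiff_cut_norm_complex (ρ : ℝ) :
    ContDiff ℝ ∞ (fun x : Space n => (cut ρ ‖x‖ : ℂ)) :=
  Complex.ofRealCLM.contDiff.comp (contDiff_cut_norm ρ)

lemma cut_nonneg (ρ r : ℝ) : 0 ≤ cut ρ r := Real.smoothTransition.nonneg _

lemma cut_le_one (ρ r : ℝ) : cut ρ r ≤ 1 := Real.smoothTransition.le_one _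

lemma cut_eq_one {ρ r : ℝ} (hρ : 0 < ρ) (hr : 0 ≤ r) (h : r ≤ ρ) : cut ρ r = 1 := by
  apply Real.smoothTransition.one_of_one_le
  have : r ^ 2 / ρ ^ 2 ≤ 1 := by
    rw [div_le_one (by positivity)]
    exact pow_le_pow_left₀ hr h 2
  linarith

lemma cut_eq_zero {ρ r : ℝ} (hρ : 0 < ρ) (h : 2 * ρ ≤ r) : cut ρ r = 0 := by
  apply Real.smoothTransition.zero_of_nonpos
  have : 2 ≤ r ^ 2 / ρ ^ 2 := by
    rw [le_div_iff₀ (by positivity)]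
    nlinarith
  linarith

lemma hasDerivAt_cut (ρ r : ℝ) : HasDerivAt (cut ρ) (-cutFlux ρ r) r := by
  have h1 : HasDerivAt (fun r : ℝ => 2 - r ^ 2 / ρ ^ 2) (-(2 * r / ρ ^ 2)) r := by
    have := ((hasDerivAt_pow 2 r).div_const (ρ ^ 2)).const_sub 2
    simpa using this
  have h2 : DifferentiableAt ℝ Real.smoothTransition (2 - r ^ 2 / ρ ^ 2) :=
    (Real.smoothTransition.contDiff (n := 1)).differentiable (by norm_num) _
  have := h2.hasDerivAt.comp r h1
  unfold cutFlux
  convert! this using 1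
  ring

lemma continuous_cut (ρ : ℝ) : Continuous (cut ρ) :=
  continuous_iff_continuousAt.2 fun r => (hasDerivAt_cut ρ r).continuousAt

lemma continuous_deriv_smoothTransition : Continuous (deriv Real.smoothTransition) :=
  (Real.smoothTransition.contDiff (n := 1)).continuous_deriv (by norm_num)

lemma continuous_cutFlux (ρ : ℝ) : Continuous (cutFlux ρ) := by
  unfold cutFlux
  have := continuous_deriv_smoothTransition
  fun_prop

lemma deriv_smoothTransition_of_nonpos {t : ℝ} (ht : t ≤ 0) :
    deriv Real.smoothTransition t = 0 := by
  apply IsLocalMin.deriv_eq_zero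
  refine Eventually.of_forall fun s => ?_
  rw [Real.smoothTransition.zero_of_nonpos ht]
  exact Real.smoothTransition.nonneg s

lemma deriv_smoothTransition_of_one_le {t : ℝ} (ht : 1 ≤ t) :
    deriv Real.smoothTransition t = 0 := by
  apply IsLocalMax.deriv_eq_zero
  refine Eventually.of_forall fun s => ?_
  rw [Real.smoothTransition.one_of_one_le ht]
  exact Real.smoothTransition.le_one s

lemma cutFlux_nonneg {ρ r : ℝ} (hr : 0 ≤ r) : 0 ≤ cutFlux ρ r := by
  unfold cutFlux
  have : 0 ≤ deriv Real.smoothTransition (2 - r ^ 2 / ρ ^ 2) :=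
    Real.smoothTransition.monotone.deriv_nonneg
  positivity

lemma cutFlux_eq_zero_of_le {ρ r : ℝ} (hρ : 0 < ρ) (hr : 0 ≤ r) (h : r ≤ ρ) :
    cutFlux ρ r = 0 := by
  unfold cutFlux
  rw [deriv_smoothTransition_of_one_le, zero_mul]
  have : r ^ 2 / ρ ^ 2 ≤ 1 := by
    rw [div_le_one (by positivity)]
    exact pow_le_pow_left₀ hr h 2
  linarith

lemma cutFlux_eq_zero_of_ge {ρ r : ℝ} (hρ : 0 < ρ) (h : 2 * ρ ≤ r) : cutFlux ρ r = 0 := by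
  unfold cutFlux
  rw [deriv_smoothTransition_of_nonpos, zero_mul]
  have : 2 ≤ r ^ 2 / ρ ^ 2 := by
    rw [le_div_iff₀ (by positivity)]
    nlinarith
  linarith

lemma hasLineDerivAt_cut {ρ : ℝ} (hρ : 0 < ρ) (i : Fin n) (x : Space n) :
    HasLineDerivAt ℝ (fun y : Space n => cut ρ ‖y‖) (-(cutFlux ρ ‖x‖ * (x i / ‖x‖))) x
      (EuclideanSpace.single i 1) := by
  by_cases hx : x = 0
  · subst hx
    have h1 : (fun y : Space n => cut ρ ‖y‖) =ᶠ[𝓝 0] fun _ => 1 := by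
      filter_upwards [ball_mem_nhds (0 : Space n) hρ] with y hy
      exact cut_eq_one hρ (norm_nonneg _) (by simpa using (mem_ball_zero_iff.1 hy).le)
    have h2 : HasFDerivAt (fun y : Space n => cut ρ ‖y‖) (0 : Space n →L[ℝ] ℝ) 0 :=
      (hasFDerivAt_const (1 : ℝ) (0 : Space n)).congr_of_eventuallyEq h1
    simpa using h2.hasLineDerivAt (EuclideanSpace.single i 1)
  · have := hasLineDerivAt_radial hx (hasDerivAt_cut ρ ‖x‖) i
    convert! this using 1
    simp [mul_comm]

lemma pd_cut {ρ : ℝ} (hρ : 0 < ρ) (i : Fin n) (x : Space n) :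
    pd i (fun y : Space n => (cut ρ ‖y‖ : ℂ)) x
      = -((cutFlux ρ ‖x‖ * (x i / ‖x‖) : ℝ) : ℂ) := by
  have hd : DifferentiableAt ℝ (fun y : Space n => cut ρ ‖y‖) x :=
    (contDiff_cut_norm ρ).differentiable (by simp) x
  have h1 : fderiv ℝ (fun y : Space n => cut ρ ‖y‖) x (EuclideanSpace.single i 1)
      = -(cutFlux ρ ‖x‖ * (x i / ‖x‖)) :=
    (hd.hasFDerivAt.hasLineDerivAt _).unique (hasLineDerivAt_cut hρ i x)
  have h2 := (Complex.ofRealCLM.hasFDerivAt (x := cut ρ ‖x‖)).comp x hd.hasFDerivAt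
  unfold pd
  rw [show (fun y : Space n => (cut ρ ‖y‖ : ℂ)) = Complex.ofRealCLM ∘ fun y => cut ρ ‖y‖ from rfl,
    h2.fderiv]
  simp only [ContinuousLinearMap.comp_apply, h1]
  simp

lemma hasCompactSupport_cut {ρ : ℝ} (hρ : 0 < ρ) :
    HasCompactSupport (fun x : Space n => (cut ρ ‖x‖ : ℂ)) := by
  refine HasCompactSupport.intro (isCompact_closedBall (0 : Space n) (2 * ρ)) fun x hx => ?_
  have : 2 * ρ < ‖x‖ := by simpa using hx
  simp [cut_eq_zero hρ this.le]

lemma isTest_cut {ρ : ℝ} (hρ : 0 < ρ) : IsTest (fun x : Space n => (cut ρ ‖x‖ : ℂ)) :=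
  ⟨contDiff_cut_norm_complex ρ, hasCompactSupport_cut hρ⟩

/-- The surface measure of the unit sphere of `ℝⁿ`, as `n` times the volume of the unit ball. -/
noncomputable def sphereArea (n : ℕ) : ℝ := n * volume.real (ball (0 : Space n) 1)

lemma sphereArea_pos (hn : 0 < n) : 0 < sphereArea n := by
  unfold sphereArea
  have : 0 < volume.real (ball (0 : Space n) 1) :=
    ENNReal.toReal_pos (measure_ball_pos _ _ one_pos).ne' measure_ball_lt_top.ne
  positivity

lemma integral_cutFlux {ρ : ℝ} (hρ : 0 < ρ) : ∫ r in Ioi (0 : ℝ), cutFlux ρ r = 1 := by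
  have hc : HasCompactSupport (fun r => -cutFlux ρ |r|) := by
    refine HasCompactSupport.intro (isCompact_Icc (a := -(2 * ρ)) (b := 2 * ρ)) fun r hr => ?_
    rw [cutFlux_eq_zero_of_ge hρ, neg_zero]
    by_contra! h
    exact hr (abs_le.1 h.le)
  have hi : IntegrableOn (fun r => -cutFlux ρ r) (Ioi 0) := by
    refine (((continuous_cutFlux ρ).comp continuous_abs).neg.integrable_of_hasCompactSupport
      hc).integrableOn.congr_fun (fun r hr => ?_) measurableSet_Ioi
    simp [abs_of_pos (mem_Ioi.1 hr)]
  have h := integral_Ioi_of_hasDerivAt_of_tendsto (f := cut ρ) (m := 0)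
    (continuous_cut ρ).continuousWithinAt (fun r _ => hasDerivAt_cut ρ r) hi
    (tendsto_const_nhds.congr' ?_)
  · rw [integral_neg, cut_eq_one hρ le_rfl hρ.le] at h
    linarith
  · filter_upwards [eventually_ge_atTop (2 * ρ)] with r hr
    rw [cut_eq_zero hρ hr]

/-- The density `κ_ρ(|x|) |x|^{-(n-1)}` has total mass `|S^{n-1}|` for every scale `ρ`. -/
lemma integral_cutFlux_div (hn : 0 < n) {ρ : ℝ} (hρ : 0 < ρ) :
    ∫ x : Space n, cutFlux ρ ‖x‖ / ‖x‖ ^ (n - 1) = sphereArea n := by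
  have : Nonempty (Fin n) := ⟨⟨0, hn⟩⟩
  rw [integral_fun_norm_addHaar volume (fun r => cutFlux ρ r / r ^ (n - 1))]
  have : ∫ y in Ioi (0 : ℝ), y ^ (Module.finrank ℝ (Space n) - 1) • (cutFlux ρ y / y ^ (n - 1))
      = 1 := by
    rw [← integral_cutFlux hρ]
    refine setIntegral_congr_fun measurableSet_Ioi fun y hy => ?_
    have : (0 : ℝ) < y := hy
    simp only [finrank_euclideanSpace, Fintype.card_fin, smul_eq_mul]
    field_simp
  rw [this]
  simp [sphereArea]

lemma continuous_cutFlux_div {ρ : ℝ} (hρ : 0 < ρ) :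
    Continuous fun x : Space n => cutFlux ρ ‖x‖ / ‖x‖ ^ (n - 1) := by
  rw [continuous_iff_continuousAt]
  intro x
  by_cases hx : x = 0
  · subst hx
    have : (fun x : Space n => cutFlux ρ ‖x‖ / ‖x‖ ^ (n - 1)) =ᶠ[𝓝 0] fun _ => 0 := by
      filter_upwards [ball_mem_nhds (0 : Space n) hρ] with y hy
      rw [cutFlux_eq_zero_of_le hρ (norm_nonneg _) (mem_ball_zero_iff.1 hy).le, zero_div]
    exact continuousAt_const.congr this.symm
  · exact ((continuous_cutFlux ρ).comp continuous_norm).continuousAt.div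
      (continuous_norm.pow _).continuousAt (by simpa using fun h => absurd h hx)

lemma integrable_cutFlux_div {ρ : ℝ} (hρ : 0 < ρ) :
    Integrable fun x : Space n => cutFlux ρ ‖x‖ / ‖x‖ ^ (n - 1) := by
  refine (continuous_cutFlux_div hρ).integrable_of_hasCompactSupport ?_
  refine HasCompactSupport.intro (isCompact_closedBall (0 : Space n) (2 * ρ)) fun x hx => ?_
  have : 2 * ρ < ‖x‖ := by simpa using hx
  simp [cutFlux_eq_zero_of_ge hρ this.le]

/-- `|x|^{-(n-1)}` is integrable on balls. -/
lemma integrable_ball_inv_pow (hn : 0 < n) (r : ℝ) :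
    Integrable ((ball (0 : Space n) r).indicator fun x => (‖x‖ ^ (n - 1))⁻¹) := by
  have : Nonempty (Fin n) := ⟨⟨0, hn⟩⟩
  have h : Integrable (fun x : Space n => (Iio r).indicator (fun s : ℝ => (s ^ (n - 1))⁻¹) ‖x‖) := by
    rw [integrable_fun_norm_addHaar volume]
    have : IntegrableOn (fun _ : ℝ => (1 : ℝ)) (Ioo 0 r) := by simp
    refine ((integrable_indicator_iff measurableSet_Ioo).2 this).integrableOn.congr_fun
      (fun y hy => ?_) measurableSet_Ioi
    have hy : (0 : ℝ) < y := hy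
    simp only [finrank_euclideanSpace, Fintype.card_fin, smul_eq_mul, indicator, mem_Ioo, mem_Iio,
      hy, true_and]
    split_ifs
    · field_simp
    · simp
  refine h.congr (Eventually.of_forall fun x => ?_)
  simp [indicator]

/-! ### Outgoing radial profiles -/

/-- The decay rate `r^{-(n-1)/2}` of outgoing waves in `ℝⁿ`. -/
noncomputable def decay (n : ℕ) (r : ℝ) : ℝ := r ^ (-(((n : ℝ) - 1) / 2))

lemma decay_pos {r : ℝ} (hr : 0 < r) : 0 < decay n r := Real.rpow_pos_of_pos hr _

lemma decay_nonneg {r : ℝ} (hr : 0 ≤ r) : 0 ≤ decay n r := Real.rpow_nonneg hr _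

lemma rpow_mul_decay {r : ℝ} (hr : 0 < r) : r ^ (((n : ℝ) - 1) / 2) * decay n r = 1 := by
  unfold decay
  rw [← Real.rpow_add hr]
  simp

lemma decay_sq (hn : 0 < n) {r : ℝ} (hr : 0 ≤ r) : decay n r ^ 2 = (r ^ (n - 1))⁻¹ := by
  unfold decay
  rw [← Real.rpow_natCast, ← Real.rpow_mul hr, ← Real.rpow_natCast r, ← Real.rpow_neg hr]
  congr 1
  rw [Nat.cast_sub hn]
  push_cast
  ring

lemma decay_antitone (hn : 0 < n) {r s : ℝ} (hr : 0 < r) (h : r ≤ s) : decay n s ≤ decay n r := by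
  unfold decay
  refine Real.rpow_le_rpow_of_nonpos hr h ?_
  have : (1 : ℝ) ≤ n := by exact_mod_cast hn
  linarith

lemma decay_half (r : ℝ) (hr : 0 ≤ r) : decay n (r / 2) = 2 ^ (((n : ℝ) - 1) / 2) * decay n r := by
  unfold decay
  rw [Real.div_rpow hr (by norm_num), Real.rpow_neg (by norm_num : (0 : ℝ) ≤ 2)]
  field_simp

/-- `G` is the radial profile of the outgoing fundamental solution of `-(Δ + k²)` in `ℝⁿ` and
`G'` is its derivative: `G` solves the radial Helmholtz equation on `(0, ∞)`, decays and radiates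
like an outgoing wave, and has unit flux through small spheres. Since `decay n` is in `L²` near
the origin, the bound on `G` also controls the singularity at `0`. -/
structure OutgoingProfile (n : ℕ) (k : ℝ) (G G' : ℝ → ℂ) : Prop where
  hasDerivAt : ∀ r, 0 < r → HasDerivAt G (G' r) r
  hasDerivAt' : ∀ r, 0 < r →
    HasDerivAt G' (-((((n : ℝ) - 1) / r : ℝ) * G' r) - (k : ℂ) ^ 2 * G r) r
  bound : ∃ C, 0 ≤ C ∧ ∀ r, 0 < r → ‖G r‖ ≤ C * decay n r
  radiating : ∃ C, 0 ≤ C ∧ ∀ r, 0 < r → ‖G' r - Complex.I * k * G r‖ ≤ C * decay n r / r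
  flux : Tendsto (fun r : ℝ => (r : ℂ) ^ (n - 1) * G' r) (𝓝[>] 0) (𝓝 (-(1 / sphereArea n : ℝ)))

/-- The profile `e^{ikr} / (4πr)` in dimension three, with `4π` written as the area of the
sphere. -/
lemma outgoingProfile_three (k : ℝ) :
    OutgoingProfile 3 k (fun r => Complex.exp (Complex.I * k * r) / (sphereArea 3 * r))
      (fun r => (Complex.I * k - 1 / r) *
        (Complex.exp (Complex.I * k * r) / (sphereArea 3 * r))) := by
  have hω : 0 < sphereArea 3 := sphereArea_pos (by norm_num)
  have hω' : (sphereArea 3 : ℂ) ≠ 0 := by exact_mod_cast hω.ne'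
  have hd : ∀ r : ℝ, 0 < r → decay 3 r = 1 / r := fun r hr => by
    unfold decay
    norm_num
    rw [Real.rpow_neg_one]
  have hnorm : ∀ r : ℝ, 0 < r →
      ‖Complex.exp (Complex.I * k * r) / (sphereArea 3 * r)‖ = 1 / sphereArea 3 * (1 / r) := by
    intro r hr
    rw [norm_div, show Complex.I * k * r = ((k * r : ℝ) : ℂ) * Complex.I by push_cast; ring,
      Complex.norm_exp_ofReal_mul_I, norm_mul, Complex.norm_real, Complex.norm_real,
      Real.norm_of_nonneg hω.le, Real.norm_of_nonneg hr.le]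
    field_simp
  have hG : ∀ r : ℝ, 0 < r →
      HasDerivAt (fun r : ℝ => Complex.exp (Complex.I * k * r) / (sphereArea 3 * r))
        ((Complex.I * k - 1 / r) * (Complex.exp (Complex.I * k * r) / (sphereArea 3 * r))) r := by
    intro r hr
    have hr' : (r : ℂ) ≠ 0 := by exact_mod_cast hr.ne'
    have h0 : HasDerivAt (fun r : ℝ => (r : ℂ)) 1 r := Complex.ofRealCLM.hasDerivAt
    have h1 := ((h0.const_mul (Complex.I * k)).cexp).div (h0.const_mul (sphereArea 3 : ℂ))
      (mul_ne_zero hω' hr')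
    convert! h1 using 1
    field_simp
  refine ⟨hG, fun r hr => ?_, ⟨1 / sphereArea 3, by positivity, fun r hr => ?_⟩,
    ⟨1 / sphereArea 3, by positivity, fun r hr => ?_⟩, ?_⟩
  · have hr' : (r : ℂ) ≠ 0 := by exact_mod_cast hr.ne'
    have h0 : HasDerivAt (fun r : ℝ => (r : ℂ)) 1 r := Complex.ofRealCLM.hasDerivAt
    have h2 : HasDerivAt (fun r : ℝ => Complex.I * k - 1 / (r : ℂ)) (1 / r ^ 2) r := by
      have := (h0.inv hr').const_sub (Complex.I * k)
      convert! this using 1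
      · ext; simp
      · field_simp
    convert! h2.mul (hG r hr) using 1
    push_cast
    field_simp
    ring_nf
    simp only [Complex.I_sq]
    ring
  · rw [hnorm r hr, hd r hr]
  · rw [show (Complex.I * k - 1 / r) * (Complex.exp (Complex.I * k * r) / (sphereArea 3 * r)) -
      Complex.I * k * (Complex.exp (Complex.I * k * r) / (sphereArea 3 * r)) =
      -(1 / (r : ℂ)) * (Complex.exp (Complex.I * k * r) / (sphereArea 3 * r)) by ring,
      norm_mul, hnorm r hr, hd r hr, norm_neg, norm_div, Complex.norm_real,
      Real.norm_of_nonneg hr.le]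
    simp only [norm_one]
    apply le_of_eq
    ring
  · have h1 : Tendsto (fun r : ℝ => (Complex.I * k * r - 1) *
        (Complex.exp (Complex.I * k * r) / sphereArea 3)) (𝓝[>] 0)
        (𝓝 ((Complex.I * k * (0 : ℝ) - 1) *
        (Complex.exp (Complex.I * k * (0 : ℝ)) / sphereArea 3))) := by
      apply Tendsto.mono_left _ nhdsWithin_le_nhds
      apply Continuous.tendsto
      fun_prop
    have h2 : (Complex.I * k * (0 : ℝ) - 1) *
        (Complex.exp (Complex.I * k * (0 : ℝ)) / sphereArea 3) = -(1 / sphereArea 3 : ℝ) := by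
      simp
    rw [h2] at h1
    refine h1.congr' ?_
    filter_upwards [self_mem_nhdsWithin] with r hr
    have hr' : (r : ℂ) ≠ 0 := by exact_mod_cast (ne_of_gt hr)
    field_simp
    norm_num
    ring

/-! ### The outgoing profile in dimension two -/

/-- The Laplace transform `∫₀^∞ e^{-tσ} F(σ) dσ`. -/
noncomputable def laplaceInt (F : ℝ → ℂ) (t : ℝ) : ℂ :=
  ∫ s in Ioi (0 : ℝ), Complex.exp (-(t * s)) * F s

lemma integrable_rpow_mul_exp {a t : ℝ} (ha : -1 < a) (ht : 0 < t) (C : ℝ) :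
    IntegrableOn (fun s : ℝ => C * (s ^ a * Real.exp (-(t * s)))) (Ioi 0) := by
  have h := integrableOn_rpow_mul_exp_neg_mul_rpow (p := 1) (s := a) (b := t) ha one_pos ht
  refine Integrable.const_mul (h.congr_fun (fun s _ => ?_) measurableSet_Ioi) C
  simp

lemma norm_exp_neg_mul (t s : ℝ) : ‖Complex.exp (-(t * s))‖ = Real.exp (-(t * s)) := by
  rw [Complex.norm_exp]
  simp

lemma aestronglyMeasurable_laplace {F : ℝ → ℂ} (hF : Measurable F) (t : ℝ) (μ : Measure ℝ) :
    AEStronglyMeasurable (fun s : ℝ => Complex.exp (-(t * s)) * F s) μ := by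
  apply Measurable.aestronglyMeasurable
  fun_prop

lemma integrable_laplace {F : ℝ → ℂ} (hF : Measurable F) {C a t : ℝ} (ha : -1 < a) (ht : 0 < t)
    (hb : ∀ s, 0 < s → ‖F s‖ ≤ C * s ^ a) :
    IntegrableOn (fun s : ℝ => Complex.exp (-(t * s)) * F s) (Ioi 0) := by
  refine (integrable_rpow_mul_exp ha ht C).mono' (aestronglyMeasurable_laplace hF t _) ?_
  filter_upwards [ae_restrict_mem measurableSet_Ioi] with s hs
  rw [norm_mul, norm_exp_neg_mul]
  calc _ ≤ Real.exp (-(t * s)) * (C * s ^ a) :=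
        mul_le_mul_of_nonneg_left (hb s hs) (Real.exp_nonneg _)
    _ = _ := by ring

lemma norm_laplaceInt_le {F : ℝ → ℂ} {C a t : ℝ} (ha : -1 < a) (ht : 0 < t)
    (hb : ∀ s, 0 < s → ‖F s‖ ≤ C * s ^ a) :
    ‖laplaceInt F t‖ ≤ C * Real.Gamma (a + 1) * t ^ (-(a + 1)) := by
  have h := norm_integral_le_of_norm_le (μ := volume.restrict (Ioi (0 : ℝ)))
    (f := fun s : ℝ => Complex.exp (-(t * s)) * F s) (integrable_rpow_mul_exp ha ht C) ?_
  · refine h.trans (le_of_eq ?_)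
    rw [integral_const_mul]
    have := Real.integral_rpow_mul_exp_neg_mul_Ioi (a := a + 1) (r := t) (by linarith) ht
    simp only [add_sub_cancel_right] at this
    rw [this, Real.rpow_neg ht.le, one_div, Real.inv_rpow ht.le]
    ring
  · filter_upwards [ae_restrict_mem measurableSet_Ioi] with s hs
    rw [norm_mul, norm_exp_neg_mul]
    calc _ ≤ Real.exp (-(t * s)) * (C * s ^ a) :=
          mul_le_mul_of_nonneg_left (hb s hs) (Real.exp_nonneg _)
      _ = _ := by ring

lemma hasDerivAt_laplaceInt {F : ℝ → ℂ} (hF : Measurable F) {C a t : ℝ} (ha : -1 < a)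
    (ht : 0 < t) (hb : ∀ s, 0 < s → ‖F s‖ ≤ C * s ^ a) :
    HasDerivAt (laplaceInt F) (-laplaceInt (fun s => s * F s) t) t := by
  have hb' : ∀ s : ℝ, 0 < s → ‖(s : ℂ) * F s‖ ≤ C * s ^ (a + 1) := fun s hs => by
    rw [norm_mul, Complex.norm_real, Real.norm_of_nonneg hs.le, Real.rpow_add_one hs.ne']
    nlinarith [hb s hs]
  have key := hasDerivAt_integral_of_dominated_loc_of_deriv_le
    (μ := volume.restrict (Ioi (0 : ℝ))) (x₀ := t) (s := Ioi (t / 2))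
    (F := fun (t s : ℝ) => Complex.exp (-(t * s)) * F s)
    (F' := fun (t s : ℝ) => -(Complex.exp (-(t * s)) * (s * F s)))
    (bound := fun s => C * (s ^ (a + 1) * Real.exp (-(t / 2 * s))))
    (Ioi_mem_nhds (by linarith)) (Eventually.of_forall fun t => aestronglyMeasurable_laplace hF t _)
    (integrable_laplace hF ha ht hb)
    (aestronglyMeasurable_laplace (Complex.measurable_ofReal.mul hF) t _).neg ?_
    (integrable_rpow_mul_exp (by linarith) (by linarith) C) ?_
  · have h := key.2
    rw [integral_neg] at h
    exact h
  · filter_upwards [ae_restrict_mem measurableSet_Ioi] with s hs x hx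
    have hs : 0 < s := hs
    have hx : t / 2 < x := hx
    rw [norm_neg, norm_mul, norm_exp_neg_mul]
    have h1 : Real.exp (-(x * s)) ≤ Real.exp (-(t / 2 * s)) := by
      apply Real.exp_le_exp.2
      nlinarith
    calc _ ≤ Real.exp (-(t / 2 * s)) * (C * s ^ (a + 1)) :=
          mul_le_mul h1 (hb' s hs) (norm_nonneg _) (Real.exp_nonneg _)
      _ = _ := by ring
  · refine Eventually.of_forall fun s x _ => ?_
    have h0 : HasDerivAt (fun r : ℝ => (r : ℂ)) 1 x := Complex.ofRealCLM.hasDerivAt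
    have h1 := ((h0.mul_const (s : ℂ)).neg.cexp).mul_const (F s)
    convert! h1 using 1
    simp only [Pi.neg_apply]
    ring

/-- The amplitude `σ · (σ² - 2iσ)^{-1/2} = (1 - 2i/σ)^{-1/2}` in the integral representation of
the Hankel function. -/
noncomputable def hankelAmp (s : ℝ) : ℂ := (1 - 2 * Complex.I / s) ^ ((-(1 / 2) : ℝ) : ℂ)

lemma measurable_hankelAmp : Measurable hankelAmp := by
  unfold hankelAmp
  fun_prop

lemma hankelAmp_arg_re (s : ℝ) : (1 - 2 * Complex.I / (s : ℂ)).re = 1 := by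
  simp [Complex.div_re]

lemma hankelAmp_arg_im (s : ℝ) : (1 - 2 * Complex.I / (s : ℂ)).im = -(2 / s) := by
  rw [show 2 * Complex.I / (s : ℂ) = ((2 / s : ℝ) : ℂ) * Complex.I by push_cast; ring]
  simp

lemma norm_hankelAmp_le_one (s : ℝ) : ‖hankelAmp s‖ ≤ 1 := by
  unfold hankelAmp
  rw [Complex.norm_cpow_real]
  refine Real.rpow_le_one_of_one_le_of_nonpos ?_ (by norm_num)
  have := Complex.abs_re_le_norm (1 - 2 * Complex.I / (s : ℂ))
  rw [hankelAmp_arg_re] at this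
  simpa using this

lemma norm_hankelAmp_le_rpow {s : ℝ} (hs : 0 < s) : ‖hankelAmp s‖ ≤ 1 * s ^ (1 / 2 : ℝ) := by
  unfold hankelAmp
  rw [Complex.norm_cpow_real, one_mul]
  have h1 := Complex.abs_im_le_norm (1 - 2 * Complex.I / (s : ℂ))
  rw [hankelAmp_arg_im, abs_neg, abs_of_pos (by positivity)] at h1
  calc _ ≤ (1 / s) ^ (-(1 / 2) : ℝ) := by
        refine Real.rpow_le_rpow_of_nonpos (by positivity) (le_trans ?_ h1) (by norm_num)
        gcongr
        norm_num
    _ = _ := by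
        rw [one_div, Real.inv_rpow hs.le, Real.rpow_neg hs.le, inv_inv]

lemma norm_hankelAmp_div_le {s : ℝ} (hs : 0 < s) :
    ‖hankelAmp s / s‖ ≤ 1 * s ^ (-(1 / 2) : ℝ) := by
  rw [norm_div, Complex.norm_real, Real.norm_of_nonneg hs.le, div_le_iff₀ hs, mul_assoc,
    ← Real.rpow_add_one hs.ne']
  refine (norm_hankelAmp_le_rpow hs).trans (le_of_eq ?_)
  norm_num

/-- The first-order equation of the amplitude: with `a = hankelAmp`,
`((σ - 2i) a)' = (σ - i) a / σ`. -/
lemma hasDerivAt_hankelAmp {s : ℝ} (hs : 0 < s) :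
    HasDerivAt (fun s : ℝ => (s - 2 * Complex.I) * hankelAmp s)
      ((s - Complex.I) * (hankelAmp s / s)) s := by
  have hs' : (s : ℂ) ≠ 0 := by exact_mod_cast hs.ne'
  have h0 : HasDerivAt (fun r : ℝ => (r : ℂ)) 1 s := Complex.ofRealCLM.hasDerivAt
  have hz : (1 - 2 * Complex.I / (s : ℂ)) ∈ Complex.slitPlane := by
    left
    rw [hankelAmp_arg_re]
    norm_num
  have h1 : HasDerivAt (fun r : ℝ => 1 - 2 * Complex.I / (r : ℂ)) (2 * Complex.I / s ^ 2) s := by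
    have := ((h0.inv hs').const_mul (2 * Complex.I)).const_sub 1
    convert! this using 1
    field_simp
  have h2 := (Complex.hasStrictDerivAt_cpow_const (c := ((-(1 / 2) : ℝ) : ℂ)) hz).hasDerivAt.comp s h1
  have h3 := (h0.sub_const (2 * Complex.I)).mul h2
  convert! h3 using 1
  have hz0 : (1 - 2 * Complex.I / (s : ℂ)) ≠ 0 := Complex.slitPlane_ne_zero hz
  rw [Complex.cpow_sub _ _ hz0, Complex.cpow_one]
  unfold hankelAmp
  simp only [Function.comp]
  generalize (1 - 2 * Complex.I / (s : ℂ)) ^ ((-(1 / 2) : ℝ) : ℂ) = w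
  have hz2 : 1 - 2 * Complex.I / (s : ℂ) = (s - 2 * Complex.I) / s := by field_simp
  have hz1 : (s : ℂ) - 2 * Complex.I ≠ 0 := by
    intro h
    apply hz0
    rw [hz2, h, zero_div]
  rw [hz2]
  generalize (s : ℂ) - 2 * Complex.I = d at hz1
  push_cast
  field_simp
  ring

/-- Integration by parts under the Laplace transform: this is Bessel's equation. -/
lemma laplaceInt_hankelAmp_identity {t : ℝ} (ht : 0 < t) :
    t * (laplaceInt (fun s => s * hankelAmp s) t - 2 * Complex.I * laplaceInt hankelAmp t)
      = laplaceInt hankelAmp t - Complex.I * laplaceInt (fun s => hankelAmp s / s) t := by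
  have m1 := measurable_hankelAmp
  have m0 : Measurable fun s : ℝ => hankelAmp s / s := m1.div Complex.measurable_ofReal
  have m2 : Measurable fun s : ℝ => s * hankelAmp s := Complex.measurable_ofReal.mul m1
  have b1 : ∀ s, 0 < s → ‖hankelAmp s‖ ≤ 1 * s ^ (1 / 2 : ℝ) := fun s => norm_hankelAmp_le_rpow
  have b0 : ∀ s, 0 < s → ‖hankelAmp s / s‖ ≤ 1 * s ^ (-(1 / 2) : ℝ) :=
    fun s => norm_hankelAmp_div_le
  have b2 : ∀ s : ℝ, 0 < s → ‖s * hankelAmp s‖ ≤ 1 * s ^ (1 : ℝ) := fun s hs => by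
    rw [norm_mul, Complex.norm_real, Real.norm_of_nonneg hs.le, Real.rpow_one, one_mul]
    nlinarith [norm_hankelAmp_le_one s]
  have i0 := integrable_laplace m0 (by norm_num) ht b0
  have i1 := integrable_laplace m1 (by norm_num) ht b1
  have i2 := integrable_laplace m2 (by norm_num) ht b2
  have hexp : ∀ s ∈ Ioi (0 : ℝ),
      HasDerivAt (fun s : ℝ => Complex.exp (-(t * s))) (-t * Complex.exp (-(t * s))) s := by
    intro s _
    have h0 : HasDerivAt (fun r : ℝ => (r : ℂ)) 1 s := Complex.ofRealCLM.hasDerivAt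
    have := (h0.const_mul (t : ℂ)).neg.cexp
    convert! this using 1
    simp only [Pi.neg_apply]
    ring
  have hbound : ∀ s : ℝ, 0 < s → ‖(s - 2 * Complex.I) * hankelAmp s‖ ≤ (s + 2) * s ^ (1 / 2 : ℝ) := by
    intro s hs
    rw [norm_mul]
    refine mul_le_mul ?_ (by simpa using b1 s hs) (norm_nonneg _) (by positivity)
    refine (norm_sub_le _ _).trans (le_of_eq ?_)
    simp [abs_of_pos hs]
  -- both boundary terms vanish: `(σ - 2i) a(σ)` is `O(σ^{1/2})` at `0`, and `e^{-tσ}` wins at `∞`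
  have hlim0 : Tendsto ((fun s : ℝ => Complex.exp (-(t * s))) *
      fun s : ℝ => (s - 2 * Complex.I) * hankelAmp s) (𝓝[>] 0) (𝓝 0) := by
    have h2 : Tendsto (fun s : ℝ => (s + 2) * s ^ (1 / 2 : ℝ)) (𝓝[>] 0) (𝓝 0) := by
      have : Continuous fun s : ℝ => (s + 2) * s ^ (1 / 2 : ℝ) :=
        (continuous_id.add continuous_const).mul
          (Real.continuous_rpow_const (by norm_num))
      have := (this.tendsto 0).mono_left (nhdsWithin_le_nhds (s := Ioi 0))
      simpa using this
    refine squeeze_zero_norm' ?_ h2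
    filter_upwards [self_mem_nhdsWithin] with s hs
    have hs : 0 < s := hs
    rw [Pi.mul_apply, norm_mul, norm_exp_neg_mul]
    refine (mul_le_of_le_one_left (norm_nonneg _) ?_).trans (hbound s hs)
    rw [Real.exp_le_one_iff]
    nlinarith
  have hlim1 : Tendsto ((fun s : ℝ => Complex.exp (-(t * s))) *
      fun s : ℝ => (s - 2 * Complex.I) * hankelAmp s) atTop (𝓝 0) := by
    have h2 : Tendsto (fun s : ℝ => s ^ (3 / 2 : ℝ) * Real.exp (-t * s) +
        2 * (s ^ (1 / 2 : ℝ) * Real.exp (-t * s))) atTop (𝓝 0) := by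
      simpa using (tendsto_rpow_mul_exp_neg_mul_atTop_nhds_zero (3 / 2) t ht).add
        ((tendsto_rpow_mul_exp_neg_mul_atTop_nhds_zero (1 / 2) t ht).const_mul 2)
    refine squeeze_zero_norm' ?_ h2
    filter_upwards [eventually_gt_atTop 0] with s hs
    rw [Pi.mul_apply, norm_mul, norm_exp_neg_mul]
    refine (mul_le_mul_of_nonneg_left (hbound s hs) (Real.exp_nonneg _)).trans (le_of_eq ?_)
    rw [show (3 / 2 : ℝ) = 1 / 2 + 1 by norm_num, Real.rpow_add_one hs.ne', neg_mul]
    ring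
  have key := integral_Ioi_mul_deriv_eq_deriv_mul hexp
    (fun s hs => hasDerivAt_hankelAmp (mem_Ioi.1 hs)) ?_ ?_ hlim0 hlim1
  · have e1 : ∫ s in Ioi (0 : ℝ), Complex.exp (-(t * s)) * ((s - Complex.I) * (hankelAmp s / s))
        = laplaceInt hankelAmp t - Complex.I * laplaceInt (fun s => hankelAmp s / s) t := by
      unfold laplaceInt
      rw [← integral_const_mul, ← integral_sub i1 (i0.const_mul _)]
      refine setIntegral_congr_fun measurableSet_Ioi fun s hs => ?_
      have hs' : (s : ℂ) ≠ 0 := by exact_mod_cast (ne_of_gt hs)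
      field_simp
    have e2 : ∫ s in Ioi (0 : ℝ), -t * Complex.exp (-(t * s)) * ((s - 2 * Complex.I) * hankelAmp s)
        = -(t * (laplaceInt (fun s => s * hankelAmp s) t
          - 2 * Complex.I * laplaceInt hankelAmp t)) := by
      unfold laplaceInt
      rw [← integral_const_mul, ← integral_sub i2 (i1.const_mul _), ← integral_const_mul,
        ← integral_neg]
      refine setIntegral_congr_fun measurableSet_Ioi fun s hs => ?_
      ring
    rw [e1, e2] at key
    rw [key]
    ring
  · refine (i1.sub (i0.const_mul Complex.I)).congr_fun (fun s hs => ?_) measurableSet_Ioi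
    have hs' : (s : ℂ) ≠ 0 := by exact_mod_cast (ne_of_gt hs)
    simp only [Pi.mul_apply, Pi.sub_apply]
    field_simp
  · refine IntegrableOn.congr_fun ((i2.sub (i1.const_mul (2 * Complex.I))).const_mul (-t : ℂ))
      (fun s hs => ?_) measurableSet_Ioi
    simp only [Pi.mul_apply, Pi.sub_apply]
    ring

/-- Substituting `σ = s / t` turns `t ∫ e^{-tσ} a(σ) dσ` into `∫ e^{-s} a(s / t) ds`, and
`a(s / t) → 1` as `t → 0`. This limit is the logarithmic singularity of the Hankel function. -/
lemma tendsto_mul_laplaceInt_hankelAmp :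
    Tendsto (fun t : ℝ => (t : ℂ) * laplaceInt hankelAmp t) (𝓝[>] 0) (𝓝 1) := by
  have h1 : ∀ t : ℝ, 0 < t → (t : ℂ) * laplaceInt hankelAmp t
      = ∫ s in Ioi (0 : ℝ), Complex.exp (-s) * hankelAmp (s / t) := by
    intro t ht
    have := integral_comp_mul_left_Ioi
      (fun s : ℝ => Complex.exp (-s) * hankelAmp (s / t)) 0 ht
    have ht' : (t : ℂ) ≠ 0 := by exact_mod_cast ht.ne'
    rw [mul_zero] at this
    rw [← smul_right_injective ℂ (inv_ne_zero ht.ne') |>.eq_iff]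
    rw [← this]
    simp only [Complex.real_smul]
    push_cast
    rw [← mul_assoc, inv_mul_cancel₀ ht', one_mul]
    unfold laplaceInt
    congr 1
    ext s
    congr 2
    field_simp
  have h2 : Tendsto (fun t : ℝ => ∫ s in Ioi (0 : ℝ), Complex.exp (-s) * hankelAmp (s / t))
      (𝓝[>] 0) (𝓝 (∫ s in Ioi (0 : ℝ), Complex.exp (-s) * 1)) := by
    refine tendsto_integral_filter_of_dominated_convergence (fun s => Real.exp (-s)) ?_ ?_ ?_ ?_
    · refine Eventually.of_forall fun t => Measurable.aestronglyMeasurable ?_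
      have := measurable_hankelAmp
      fun_prop
    · refine Eventually.of_forall fun t => Eventually.of_forall fun s => ?_
      have := norm_exp_neg_mul 1 s
      simp only [Complex.ofReal_one, one_mul] at this
      rw [norm_mul, this]
      exact mul_le_of_le_one_right (Real.exp_nonneg _) (norm_hankelAmp_le_one _)
    · exact integrableOn_exp_neg_Ioi 0
    · filter_upwards [ae_restrict_mem measurableSet_Ioi] with s hs
      have hs' : (s : ℂ) ≠ 0 := by exact_mod_cast (ne_of_gt hs)
      refine Tendsto.const_mul _ ?_
      have hc : ContinuousAt (fun t : ℝ => (1 - 2 * Complex.I / s * t) ^ ((-(1 / 2) : ℝ) : ℂ)) 0 := by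
        refine ContinuousAt.cpow (by fun_prop) continuousAt_const ?_
        left
        simp
      have := hc.tendsto.mono_left (nhdsWithin_le_nhds (s := Ioi 0))
      simp only [Complex.ofReal_zero, mul_zero, sub_zero, Complex.one_cpow] at this
      refine this.congr' ?_
      filter_upwards [self_mem_nhdsWithin] with t ht
      have ht' : (t : ℂ) ≠ 0 := by exact_mod_cast (ne_of_gt ht)
      unfold hankelAmp
      congr 2
      push_cast
      field_simp
  have h3 : ∫ s in Ioi (0 : ℝ), Complex.exp (-(s : ℂ)) * 1 = 1 := by
    simp only [mul_one]
    have := integral_exp_neg_Ioi_zero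
    rw [← Complex.ofReal_one, ← this, ← integral_complex_ofReal]
    simp
  rw [h3] at h2
  refine h2.congr' ?_
  filter_upwards [self_mem_nhdsWithin] with t ht
  exact (h1 t ht).symm

/-- `e^{it} ∫₀^∞ e^{-tσ} (σ² - 2iσ)^{-1/2} dσ`, a multiple of the Hankel function `H₀⁽¹⁾`. -/
noncomputable def hankel (t : ℝ) : ℂ :=
  Complex.exp (Complex.I * t) * laplaceInt (fun s => hankelAmp s / s) t

/-- The derivative of `hankel`. -/
noncomputable def hankelDeriv (t : ℝ) : ℂ :=
  Complex.exp (Complex.I * t) *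
    (Complex.I * laplaceInt (fun s => hankelAmp s / s) t - laplaceInt hankelAmp t)

lemma hasDerivAt_laplaceInt_zero {t : ℝ} (ht : 0 < t) :
    HasDerivAt (laplaceInt (fun s => hankelAmp s / s)) (-laplaceInt hankelAmp t) t := by
  have h := hasDerivAt_laplaceInt (measurable_hankelAmp.div Complex.measurable_ofReal)
    (C := 1) (a := -(1 / 2)) (by norm_num) ht (fun s hs => norm_hankelAmp_div_le hs)
  convert! h using 2
  refine setIntegral_congr_fun measurableSet_Ioi fun s hs => ?_
  have hs' : (s : ℂ) ≠ 0 := by exact_mod_cast (ne_of_gt hs)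
  simp only [Pi.div_apply]
  field_simp

lemma hasDerivAt_laplaceInt_one {t : ℝ} (ht : 0 < t) :
    HasDerivAt (laplaceInt hankelAmp) (-laplaceInt (fun s => s * hankelAmp s) t) t :=
  hasDerivAt_laplaceInt measurable_hankelAmp
    (C := 1) (a := 1 / 2) (by norm_num) ht (fun s hs => norm_hankelAmp_le_rpow hs)

lemma hasDerivAt_exp_I (t : ℝ) : HasDerivAt (fun t : ℝ => Complex.exp (Complex.I * t))
    (Complex.I * Complex.exp (Complex.I * t)) t := by
  have h0 : HasDerivAt (fun r : ℝ => (r : ℂ)) 1 t := Complex.ofRealCLM.hasDerivAt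
  have := (h0.const_mul Complex.I).cexp
  convert! this using 1
  ring

lemma hasDerivAt_hankel {t : ℝ} (ht : 0 < t) : HasDerivAt hankel (hankelDeriv t) t := by
  have := (hasDerivAt_exp_I t).mul (hasDerivAt_laplaceInt_zero ht)
  convert! this using 1
  unfold hankelDeriv
  ring

/-- Bessel's equation `H'' + H' / t + H = 0`. -/
lemma hasDerivAt_hankelDeriv {t : ℝ} (ht : 0 < t) :
    HasDerivAt hankelDeriv (-(1 / t * hankelDeriv t) - hankel t) t := by
  have := (hasDerivAt_exp_I t).mul
    (((hasDerivAt_laplaceInt_zero ht).const_mul Complex.I).sub (hasDerivAt_laplaceInt_one ht))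
  convert! this using 1
  unfold hankelDeriv hankel
  have ht' : (t : ℂ) ≠ 0 := by exact_mod_cast ht.ne'
  have key := laplaceInt_hankelAmp_identity ht
  simp only [Pi.sub_apply]
  generalize laplaceInt (fun s => hankelAmp s / s) t = L0 at key ⊢
  generalize laplaceInt (fun s => s * hankelAmp s) t = L2 at key ⊢
  generalize laplaceInt hankelAmp t = L1 at key ⊢
  have h2 : 1 / (t : ℂ) * (L1 - Complex.I * L0) = L2 - 2 * Complex.I * L1 := by
    rw [← key]
    field_simp
  linear_combination Complex.exp (Complex.I * t) * h2
    - Complex.exp (Complex.I * t) * L0 * Complex.I_sq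

lemma norm_exp_I_mul (t : ℝ) : ‖Complex.exp (Complex.I * t)‖ = 1 := by
  rw [mul_comm, Complex.norm_exp_ofReal_mul_I]

lemma norm_laplaceInt_zero_le {t : ℝ} (ht : 0 < t) :
    ‖laplaceInt (fun s => hankelAmp s / s) t‖ ≤ Real.Gamma (1 / 2) * t ^ (-(1 / 2) : ℝ) := by
  have := norm_laplaceInt_le (C := 1) (a := -(1 / 2)) (by norm_num) ht
    (fun s hs => norm_hankelAmp_div_le hs)
  norm_num at this
  norm_num
  exact this

lemma norm_laplaceInt_one_le {t : ℝ} (ht : 0 < t) : ‖laplaceInt hankelAmp t‖ ≤ 1 / t := by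
  have := norm_laplaceInt_le (C := 1) (a := 0) (by norm_num) ht
    (fun s _ => by simpa using norm_hankelAmp_le_one s)
  simpa [Real.rpow_neg_one] using this

lemma norm_laplaceInt_one_le' {t : ℝ} (ht : 0 < t) :
    ‖laplaceInt hankelAmp t‖ ≤ Real.Gamma (3 / 2) * (t ^ (-(1 / 2) : ℝ) / t) := by
  have := norm_laplaceInt_le (C := 1) (a := 1 / 2) (by norm_num) ht
    (fun s hs => norm_hankelAmp_le_rpow hs)
  rw [show -((1 : ℝ) / 2 + 1) = -(1 / 2) - 1 by norm_num, Real.rpow_sub_one ht.ne'] at this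
  norm_num at this ⊢
  exact this

lemma norm_hankel_le {t : ℝ} (ht : 0 < t) :
    ‖hankel t‖ ≤ Real.Gamma (1 / 2) * t ^ (-(1 / 2) : ℝ) := by
  unfold hankel
  rw [norm_mul, norm_exp_I_mul, one_mul]
  exact norm_laplaceInt_zero_le ht

lemma norm_hankelDeriv_le {t : ℝ} (ht : 0 < t) :
    ‖hankelDeriv t‖ ≤ Real.Gamma (1 / 2) * t ^ (-(1 / 2) : ℝ) + 1 / t := by
  unfold hankelDeriv
  rw [norm_mul, norm_exp_I_mul, one_mul]
  refine (norm_sub_le _ _).trans (add_le_add ?_ (norm_laplaceInt_one_le ht))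
  rw [norm_mul, Complex.norm_I, one_mul]
  exact norm_laplaceInt_zero_le ht

lemma tendsto_mul_hankelDeriv :
    Tendsto (fun t : ℝ => (t : ℂ) * hankelDeriv t) (𝓝[>] 0) (𝓝 (-1)) := by
  have h1 : Tendsto (fun t : ℝ => (t : ℂ) * laplaceInt (fun s => hankelAmp s / s) t)
      (𝓝[>] 0) (𝓝 0) := by
    have h2 : Tendsto (fun t : ℝ => Real.Gamma (1 / 2) * t ^ (1 / 2 : ℝ)) (𝓝[>] 0) (𝓝 0) := by
      have : Continuous fun t : ℝ => Real.Gamma (1 / 2) * t ^ (1 / 2 : ℝ) :=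
        continuous_const.mul (Real.continuous_rpow_const (by norm_num))
      have := (this.tendsto 0).mono_left (nhdsWithin_le_nhds (s := Ioi 0))
      simpa using this
    refine squeeze_zero_norm' ?_ h2
    filter_upwards [self_mem_nhdsWithin] with t ht
    have ht : 0 < t := ht
    rw [norm_mul, Complex.norm_real, Real.norm_of_nonneg ht.le]
    refine (mul_le_mul_of_nonneg_left (norm_laplaceInt_zero_le ht) ht.le).trans (le_of_eq ?_)
    rw [show (1 / 2 : ℝ) = -(1 / 2) + 1 by norm_num, Real.rpow_add_one ht.ne']
    norm_num
    ring
  have h3 : Tendsto (fun t : ℝ => Complex.exp (Complex.I * t)) (𝓝[>] 0) (𝓝 1) := by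
    have : Continuous fun t : ℝ => Complex.exp (Complex.I * t) := by fun_prop
    have := (this.tendsto 0).mono_left (nhdsWithin_le_nhds (s := Ioi 0))
    simpa using this
  have h4 := h3.mul ((h1.const_mul Complex.I).sub tendsto_mul_laplaceInt_hankelAmp)
  simp only [mul_zero, zero_sub, one_mul] at h4
  refine h4.congr fun t => ?_
  unfold hankelDeriv
  ring

/-- The scaled Hankel function is the outgoing profile in dimension two. -/
lemma outgoingProfile_two {k : ℝ} (hk : 0 < k) :
    OutgoingProfile 2 k (fun r => hankel (k * r) / sphereArea 2)
      (fun r => k * hankelDeriv (k * r) / sphereArea 2) := by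
  have hω : 0 < sphereArea 2 := sphereArea_pos (by norm_num)
  have hω' : (sphereArea 2 : ℂ) ≠ 0 := by exact_mod_cast hω.ne'
  have hk' : (k : ℂ) ≠ 0 := by exact_mod_cast hk.ne'
  have hdec : ∀ r : ℝ, 0 < r →
      (k * r) ^ (-(1 / 2) : ℝ) = k ^ (-(1 / 2) : ℝ) * decay 2 r := by
    intro r hr
    rw [Real.mul_rpow hk.le hr.le]
    unfold decay
    norm_num
  have hk2 : ∀ r : ℝ, HasDerivAt (fun r : ℝ => k * r) k r := fun r => by
    simpa using (hasDerivAt_id r).const_mul k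
  refine ⟨fun r hr => ?_, fun r hr => ?_,
    ⟨Real.Gamma (1 / 2) * k ^ (-(1 / 2) : ℝ) / sphereArea 2, ?_, fun r hr => ?_⟩,
    ⟨Real.Gamma (3 / 2) * k ^ (-(1 / 2) : ℝ) / sphereArea 2, ?_, fun r hr => ?_⟩, ?_⟩
  · have := ((hasDerivAt_hankel (mul_pos hk hr)).scomp r (hk2 r)).div_const (sphereArea 2 : ℂ)
    simpa [Function.comp_def] using this
  · have hr' : (r : ℂ) ≠ 0 := by exact_mod_cast hr.ne'
    have := (((hasDerivAt_hankelDeriv (mul_pos hk hr)).scomp r (hk2 r)).const_mul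
      (k : ℂ)).div_const (sphereArea 2 : ℂ)
    simp only [Function.comp_def] at this
    convert! this using 1
    simp only [Complex.real_smul]
    push_cast
    field_simp
    ring
  · have := Real.Gamma_pos_of_pos (s := 1 / 2) (by norm_num)
    positivity
  · rw [norm_div, Complex.norm_real, Real.norm_of_nonneg hω.le, div_mul_eq_mul_div]
    gcongr
    rw [mul_assoc, ← hdec r hr]
    exact norm_hankel_le (mul_pos hk hr)
  · have := Real.Gamma_pos_of_pos (s := 3 / 2) (by norm_num)
    positivity
  · have : k * hankelDeriv (k * r) / sphereArea 2
        - Complex.I * k * (hankel (k * r) / sphereArea 2)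
        = -(k * (Complex.exp (Complex.I * (k * r : ℝ)) * laplaceInt hankelAmp (k * r))
          / sphereArea 2) := by
      unfold hankelDeriv hankel
      ring
    rw [this, norm_neg, norm_div, norm_mul, norm_mul, norm_exp_I_mul, Complex.norm_real,
      Complex.norm_real, Real.norm_of_nonneg hω.le, Real.norm_of_nonneg hk.le, one_mul]
    calc _ ≤ k * (Real.Gamma (3 / 2) * ((k * r) ^ (-(1 / 2) : ℝ) / (k * r))) / sphereArea 2 := by
          gcongr
          exact norm_laplaceInt_one_le' (mul_pos hk hr)
      _ = _ := by
          rw [hdec r hr]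
          field_simp
  · have h1 : Tendsto (fun r : ℝ => k * r) (𝓝[>] 0) (𝓝[>] 0) := by
      refine tendsto_nhdsWithin_iff.2 ⟨?_, ?_⟩
      · have : Continuous fun r : ℝ => k * r := by fun_prop
        simpa using (this.tendsto 0).mono_left (nhdsWithin_le_nhds (s := Ioi 0))
      · filter_upwards [self_mem_nhdsWithin] with r hr
        exact mul_pos hk hr
    have h2 := (tendsto_mul_hankelDeriv.comp h1).div_const (sphereArea 2 : ℂ)
    convert! h2 using 2
    · simp
      ring
    · push_cast
      ring

/-- An outgoing profile `G` exists in dimensions two and three, and up to an additive constant `c`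
it is bounded by an integrable singularity uniformly in the wave number. In dimension two `c`
absorbs the logarithmic growth as `k → 0`; what matters is that `|c| ≤ C k^{-1/2}`. -/
theorem exists_outgoingProfile {n : ℕ} (hn : n = 2 ∨ n = 3) {R : ℝ} (hR : 0 < R) :
    ∃ C : ℝ, 0 < C ∧ ∀ k : ℝ, 0 < k → ∃ (G G' : ℝ → ℂ) (c : ℂ), OutgoingProfile n k G G' ∧
      (∀ r, 0 < r → r ≤ 2 * R → ‖G r - c‖ ≤ C / r ^ (n - 1)) ∧ ‖c‖ * √k ≤ C := by
  rcases hn with rfl | rfl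
  · have hω : 0 < sphereArea 2 := sphereArea_pos (by norm_num)
    have hΓ : 0 < Real.Gamma (1 / 2) := Real.Gamma_pos_of_pos (by norm_num)
    set T : ℝ := 2 * R + 1 with hT
    have hT1 : 1 ≤ T := by linarith
    set A : ℝ := Real.Gamma (1 / 2) * √T + 1 with hA
    have hApos : 0 < A := by positivity
    have hsq : ∀ t : ℝ, 0 < t → t ≤ T → t ^ (-(1 / 2) : ℝ) ≤ √T / t := by
      intro t ht htT
      rw [le_div_iff₀ ht, ← Real.rpow_add_one ht.ne', Real.sqrt_eq_rpow]
      norm_num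
      exact Real.rpow_le_rpow ht.le htT (by norm_num)
    have hder : ∀ t : ℝ, 0 < t → t ≤ T → ‖hankelDeriv t‖ ≤ A / t := by
      intro t ht htT
      refine (norm_hankelDeriv_le ht).trans ?_
      rw [hA, add_div]
      gcongr
      rw [mul_div_assoc]
      gcongr
      exact hsq t ht htT
    refine ⟨(A * T * T + A) / sphereArea 2, by positivity, fun k hk => ?_⟩
    -- For `k ≤ 1` the constant is the value of the profile at `r = 1`, and the difference is bounded by
    -- the mean value inequality, since the derivative is `O(1/r)` uniformly in `k`.
    -- For `k ≥ 1` the decay of the Hankel function suffices and the constant is `0`.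
    rcases le_total k 1 with hk1 | hk1
    · refine ⟨_, _, hankel (k * 1) / sphereArea 2, outgoingProfile_two hk, fun r hr hr2 => ?_, ?_⟩
      · have hm : 0 < min r 1 := lt_min hr one_pos
        have hrT : r ≤ T := by linarith
        have hmv := (convex_Icc (min r 1) (max r 1)).norm_image_sub_le_of_norm_hasDerivWithin_le
          (f := fun r : ℝ => hankel (k * r) / sphereArea 2)
          (f' := fun r => k * hankelDeriv (k * r) / sphereArea 2)
          (C := A / sphereArea 2 / min r 1) (x := 1) (y := r) (fun s hs => ?_) (fun s hs => ?_)
          ⟨min_le_right _ _, le_max_right _ _⟩ ⟨min_le_left _ _, le_max_left _ _⟩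
        · refine hmv.trans ?_
          have h1 : ‖r - 1‖ ≤ T := by
            rw [Real.norm_eq_abs, abs_le]
            constructor <;> linarith
          have h2 : 1 / min r 1 ≤ T / r := by
            rw [div_le_div_iff₀ hm hr]
            rcases le_total r 1 with h | h
            · rw [min_eq_left h]
              nlinarith
            · rw [min_eq_right h]
              linarith
          calc A / sphereArea 2 / min r 1 * ‖r - 1‖
              = A / sphereArea 2 * (1 / min r 1) * ‖r - 1‖ := by ring
            _ ≤ A / sphereArea 2 * (T / r) * T := by gcongr
            _ = A * T * T / sphereArea 2 / r := by ring
            _ ≤ (A * T * T + A) / sphereArea 2 / r ^ (2 - 1) := by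
              norm_num
              gcongr
              linarith
        · exact ((outgoingProfile_two hk).hasDerivAt s (hm.trans_le hs.1)).hasDerivWithinAt
        · have hs0 : 0 < s := hm.trans_le hs.1
          have hsT : s ≤ T := hs.2.trans (max_le hrT hT1)
          rw [norm_div, norm_mul, Complex.norm_real, Complex.norm_real,
            Real.norm_of_nonneg hω.le, Real.norm_of_nonneg hk.le]
          have h3 : k * ‖hankelDeriv (k * s)‖ ≤ A / s := by
            have := hder (k * s) (mul_pos hk hs0) (by nlinarith)
            calc _ ≤ k * (A / (k * s)) := by gcongr
              _ = _ := by field_simp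
          calc _ ≤ A / s / sphereArea 2 := by gcongr
            _ ≤ A / min r 1 / sphereArea 2 := by gcongr; exact hs.1
            _ = _ := by ring
      · rw [mul_one, norm_div, Complex.norm_real, Real.norm_of_nonneg hω.le]
        have h1 : ‖hankel k‖ * √k ≤ Real.Gamma (1 / 2) := by
          calc _ ≤ Real.Gamma (1 / 2) * k ^ (-(1 / 2) : ℝ) * √k := by
                gcongr
                exact norm_hankel_le hk
            _ = _ := by
                rw [Real.sqrt_eq_rpow, mul_assoc, ← Real.rpow_add hk]
                simp
        have h2 : 1 ≤ √T := Real.one_le_sqrt.2 hT1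
        rw [div_mul_eq_mul_div]
        gcongr
        have : 0 ≤ A * T * T := by positivity
        nlinarith
    · refine ⟨_, _, 0, outgoingProfile_two hk, fun r hr hr2 => ?_, ?_⟩
      · rw [sub_zero, norm_div, Complex.norm_real, Real.norm_of_nonneg hω.le]
        have h1 : ‖hankel (k * r)‖ ≤ A / r := by
          calc _ ≤ Real.Gamma (1 / 2) * (k * r) ^ (-(1 / 2) : ℝ) := norm_hankel_le (mul_pos hk hr)
            _ ≤ Real.Gamma (1 / 2) * r ^ (-(1 / 2) : ℝ) := by
                gcongr 1
                exact Real.rpow_le_rpow_of_nonpos hr (by nlinarith) (by norm_num)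
            _ ≤ Real.Gamma (1 / 2) * (√T / r) := by
                gcongr
                exact hsq r hr (by linarith)
            _ ≤ _ := by
                rw [hA, add_div, mul_div_assoc]
                have : 0 < 1 / r := by positivity
                linarith
        calc _ ≤ A / r / sphereArea 2 := by gcongr
          _ = A / sphereArea 2 / r := by ring
          _ ≤ _ := by
            norm_num
            gcongr
            have : 0 ≤ A * T * T := by positivity
            linarith
      · simp
        positivity
  · have hω : 0 < sphereArea 3 := sphereArea_pos (by norm_num)
    refine ⟨2 * R / sphereArea 3, by positivity, fun k hk =>
      ⟨_, _, 0, outgoingProfile_three k, fun r hr hr2 => ?_, by simp; positivity⟩⟩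
    rw [sub_zero, norm_div, show Complex.I * k * r = ((k * r : ℝ) : ℂ) * Complex.I by
      push_cast; ring, Complex.norm_exp_ofReal_mul_I, norm_mul, Complex.norm_real,
      Complex.norm_real, Real.norm_of_nonneg hω.le, Real.norm_of_nonneg hr.le, div_div,
      div_le_div_iff₀ (by positivity) (by positivity)]
    norm_num
    have : 0 < sphereArea 3 * r := by positivity
    nlinarith

variable {k : ℝ} {G G' : ℝ → ℂ}

/-! ### The fundamental solution -/

lemma OutgoingProfile.continuousAt (h : OutgoingProfile n k G G') {x : Space n} (hx : x ≠ 0) :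
    ContinuousAt (fun y : Space n => G ‖y‖) x :=
  ContinuousAt.comp (f := fun y : Space n => ‖y‖) (h.hasDerivAt _ (norm_pos_iff.2 hx)).continuousAt
    continuous_norm.continuousAt

lemma OutgoingProfile.continuousAt' (h : OutgoingProfile n k G G') {x : Space n} (hx : x ≠ 0) :
    ContinuousAt (fun y : Space n => G' ‖y‖) x :=
  ContinuousAt.comp (f := fun y : Space n => ‖y‖) (h.hasDerivAt' _ (norm_pos_iff.2 hx)).continuousAt
    continuous_norm.continuousAt

lemma aestronglyMeasurable_of_continuousAt (hn : 0 < n) {F : Space n → ℂ}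
    (hF : ∀ x, x ≠ 0 → ContinuousAt F x) : AEStronglyMeasurable F volume := by
  have : Nonempty (Fin n) := ⟨⟨0, hn⟩⟩
  have h : ContinuousOn F ({0}ᶜ) := fun x hx => (hF x hx).continuousWithinAt
  have := h.aestronglyMeasurable (μ := volume) (measurableSet_singleton (0 : Space n)).compl
  rwa [restrict_compl_singleton] at this

lemma OutgoingProfile.aestronglyMeasurable (h : OutgoingProfile n k G G') (hn : 0 < n) :
    AEStronglyMeasurable (fun y : Space n => G ‖y‖) volume :=
  aestronglyMeasurable_of_continuousAt hn fun _ hx => h.continuousAt hx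

lemma ae_ne_zero (hn : 0 < n) : ∀ᵐ x : Space n, x ≠ 0 := by
  have : Nonempty (Fin n) := ⟨⟨0, hn⟩⟩
  exact compl_mem_ae_iff.2 (measure_singleton (0 : Space n))

/-- The fundamental solution is square integrable on balls. -/
lemma OutgoingProfile.memLp_ball (h : OutgoingProfile n k G G') (hn : 0 < n) (r : ℝ) :
    MemLp ((ball (0 : Space n) r).indicator fun y => G ‖y‖) 2 := by
  have hm := (h.aestronglyMeasurable hn).indicator (measurableSet_ball (x := (0 : Space n)) (ε := r))
  obtain ⟨C, hC, hb⟩ := h.bound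
  rw [memLp_two_iff_integrable_sq_norm hm]
  refine ((integrable_ball_inv_pow hn r).const_mul (C ^ 2)).mono' (hm.norm.pow 2) ?_
  filter_upwards [ae_ne_zero hn] with x hx
  by_cases hxr : x ∈ ball (0 : Space n) r
  · have := hb ‖x‖ (norm_pos_iff.2 hx)
    rw [indicator_of_mem hxr, indicator_of_mem hxr, ← decay_sq hn (norm_nonneg x), ← mul_pow]
    simp only [norm_pow, norm_norm]
    gcongr
  · simp [indicator_of_notMem hxr]

lemma OutgoingProfile.integrable_ball (h : OutgoingProfile n k G G') (hn : 0 < n) (r : ℝ) :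
    Integrable ((ball (0 : Space n) r).indicator fun y => G ‖y‖) := by
  rw [integrable_indicator_iff measurableSet_ball]
  have := (memLp_indicator_iff_restrict measurableSet_ball).1 (h.memLp_ball hn r)
  have hf : IsFiniteMeasure (volume.restrict (ball (0 : Space n) r)) :=
    ⟨by simpa using measure_ball_lt_top⟩
  exact this.integrable (by norm_num)

lemma OutgoingProfile.locallyIntegrable (h : OutgoingProfile n k G G') (hn : 0 < n) :
    LocallyIntegrable (fun y : Space n => G ‖y‖) := by
  rw [locallyIntegrable_iff]
  intro K hK
  obtain ⟨r, hr⟩ := hK.isBounded.subset_ball 0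
  exact ((integrable_indicator_iff measurableSet_ball).1 (h.integrable_ball hn r)).mono_set hr

lemma continuous_of_vanishing_near_zero {F : Space n → ℂ} (hF : ∀ x, x ≠ 0 → ContinuousAt F x)
    {δ : ℝ} (hδ : 0 < δ) (h0 : ∀ x, ‖x‖ ≤ δ → F x = 0) : Continuous F := by
  rw [continuous_iff_continuousAt]
  intro x
  by_cases hx : x = 0
  · subst hx
    refine (continuousAt_const (y := (0 : ℂ))).congr ?_
    filter_upwards [ball_mem_nhds (0 : Space n) hδ] with y hy
    exact (h0 y (mem_ball_zero_iff.1 hy).le).symm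
  · exact hF x hx

lemma continuousAt_coord_div_norm (i : Fin n) {x : Space n} (hx : x ≠ 0) :
    ContinuousAt (fun y : Space n => ((y i / ‖y‖ : ℝ) : ℂ)) x := by
  apply Complex.continuous_ofReal.continuousAt.comp
  exact ContinuousAt.div (by fun_prop) (by fun_prop) (norm_ne_zero_iff.2 hx)

lemma sum_sq_eq (x : Space n) : ∑ i, x i * x i = ‖x‖ ^ 2 := by
  rw [EuclideanSpace.norm_sq_eq]
  simp [sq]

/-- The fundamental solution with its singularity cut off at scale `δ`. -/
noncomputable def cutFund (G : ℝ → ℂ) (δ : ℝ) (x : Space n) : ℂ := (1 - cut δ ‖x‖) * G ‖x‖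

/-- The partial derivatives of `cutFund`. -/
noncomputable def cutFundDeriv (G G' : ℝ → ℂ) (δ : ℝ) (i : Fin n) (x : Space n) : ℂ :=
  (x i / ‖x‖ : ℝ) * ((1 - cut δ ‖x‖) * G' ‖x‖) + (x i / ‖x‖ : ℝ) * (cutFlux δ ‖x‖ * G ‖x‖)

lemma continuous_cut_norm (δ : ℝ) : Continuous fun x : Space n => (cut δ ‖x‖ : ℂ) :=
  Complex.continuous_ofReal.comp ((continuous_cut δ).comp continuous_norm)

lemma continuous_cutFlux_norm (δ : ℝ) : Continuous fun x : Space n => (cutFlux δ ‖x‖ : ℂ) :=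
  Complex.continuous_ofReal.comp ((continuous_cutFlux δ).comp continuous_norm)

lemma OutgoingProfile.continuous_cutFund (h : OutgoingProfile n k G G') {δ : ℝ} (hδ : 0 < δ) :
    Continuous (cutFund (n := n) G δ) := by
  refine continuous_of_vanishing_near_zero (fun x hx => ?_) hδ fun x hx => ?_
  · exact (continuousAt_const.sub (continuous_cut_norm δ).continuousAt).mul (h.continuousAt hx)
  · simp [cutFund, cut_eq_one hδ (norm_nonneg x) hx]

lemma OutgoingProfile.continuous_cutFundDeriv (h : OutgoingProfile n k G G') {δ : ℝ} (hδ : 0 < δ)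
    (i : Fin n) : Continuous (cutFundDeriv (n := n) G G' δ i) := by
  refine continuous_of_vanishing_near_zero (fun x hx => ?_) hδ fun x hx => ?_
  · exact ((continuousAt_coord_div_norm i hx).mul
      ((continuousAt_const.sub (continuous_cut_norm δ).continuousAt).mul (h.continuousAt' hx))).add
      ((continuousAt_coord_div_norm i hx).mul
      ((continuous_cutFlux_norm δ).continuousAt.mul (h.continuousAt hx)))
  · simp [cutFundDeriv, cut_eq_one hδ (norm_nonneg x) hx,
      cutFlux_eq_zero_of_le hδ (norm_nonneg x) hx]

lemma hasLineDerivAt_of_vanishing {F : Space n → ℂ} {δ : ℝ} (hδ : 0 < δ)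
    (h0 : ∀ x, ‖x‖ ≤ δ → F x = 0) (v : Space n) : HasLineDerivAt ℝ F 0 0 v := by
  have h1 : F =ᶠ[𝓝 0] fun _ => 0 := by
    filter_upwards [ball_mem_nhds (0 : Space n) hδ] with y hy
    exact h0 y (mem_ball_zero_iff.1 hy).le
  have h2 : HasFDerivAt F (0 : Space n →L[ℝ] ℂ) 0 :=
    (hasFDerivAt_const (0 : ℂ) (0 : Space n)).congr_of_eventuallyEq h1
  simpa using h2.hasLineDerivAt v

lemma hasDerivAt_one_sub_cut (δ r : ℝ) :
    HasDerivAt (fun r : ℝ => (1 - cut δ r : ℂ)) (cutFlux δ r) r := by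
  have := ((hasDerivAt_cut δ r).ofReal_comp).const_sub 1
  simpa using this

lemma OutgoingProfile.hasLineDerivAt_cutFund (h : OutgoingProfile n k G G') {δ : ℝ} (hδ : 0 < δ)
    (i : Fin n) (x : Space n) :
    HasLineDerivAt ℝ (cutFund G δ) (cutFundDeriv G G' δ i x) x (EuclideanSpace.single i 1) := by
  by_cases hx : x = 0
  · subst hx
    have := hasLineDerivAt_of_vanishing (F := cutFund (n := n) G δ) hδ (fun x hx => by
      simp [cutFund, cut_eq_one hδ (norm_nonneg x) hx]) (EuclideanSpace.single i 1)
    simpa [cutFundDeriv] using this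
  · have hr := norm_pos_iff.2 hx
    have := hasLineDerivAt_radial hx ((hasDerivAt_one_sub_cut δ ‖x‖).mul (h.hasDerivAt _ hr)) i
    convert! this using 1
    simp only [cutFundDeriv, Complex.real_smul]
    ring

/-- `(1 - cut) G' / r`, so that `radialField · xᵢ` is the cut-off gradient of the fundamental
solution. -/
noncomputable def radialField (G' : ℝ → ℂ) (δ r : ℝ) : ℂ := (1 - cut δ r) * G' r / r

/-- The derivative of `radialField`, simplified with the radial Helmholtz equation. -/
noncomputable def radialFieldDeriv (n : ℕ) (k : ℝ) (G G' : ℝ → ℂ) (δ r : ℝ) : ℂ :=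
  (cutFlux δ r * G' r - (1 - cut δ r) * (n * G' r / r + (k : ℂ) ^ 2 * G r)) / r

lemma OutgoingProfile.hasDerivAt_radialField (h : OutgoingProfile n k G G') (δ : ℝ) {r : ℝ}
    (hr : 0 < r) :
    HasDerivAt (radialField G' δ) (radialFieldDeriv n k G G' δ r) r := by
  have hr' : (r : ℂ) ≠ 0 := by exact_mod_cast hr.ne'
  have h0 : HasDerivAt (fun r : ℝ => (r : ℂ)) 1 r := Complex.ofRealCLM.hasDerivAt
  have := ((hasDerivAt_one_sub_cut δ r).mul (h.hasDerivAt' r hr)).div h0 hr'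
  convert! this using 1
  unfold radialFieldDeriv
  simp only [Pi.mul_apply]
  push_cast
  field_simp
  ring

lemma OutgoingProfile.hasLineDerivAt_radialField (h : OutgoingProfile n k G G') {δ : ℝ}
    (hδ : 0 < δ) (i : Fin n) (x : Space n) :
    HasLineDerivAt ℝ (fun x : Space n => radialField G' δ ‖x‖ * x i)
      ((x i / ‖x‖ : ℝ) * radialFieldDeriv n k G G' δ ‖x‖ * x i + radialField G' δ ‖x‖) x
      (EuclideanSpace.single i 1) := by
  by_cases hx : x = 0
  · subst hx
    have := hasLineDerivAt_of_vanishing (F := fun x : Space n => radialField G' δ ‖x‖ * x i) hδ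
      (fun x hx => by simp [radialField, cut_eq_one hδ (norm_nonneg x) hx])
      (EuclideanSpace.single i 1)
    simpa [radialField] using this
  · have hr := norm_pos_iff.2 hx
    have h1 := hasFDerivAt_radial hx (h.hasDerivAt_radialField δ hr)
    have h2 : HasFDerivAt (fun x : Space n => ((x i : ℝ) : ℂ))
        (Complex.ofRealCLM.comp (EuclideanSpace.proj i : Space n →L[ℝ] ℝ)) x :=
      (Complex.ofRealCLM.comp (EuclideanSpace.proj i : Space n →L[ℝ] ℝ)).hasFDerivAt
    have h3 := (h1.mul h2).hasLineDerivAt (EuclideanSpace.single i 1)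
    convert! h3 using 1
    simp [EuclideanSpace.inner_single_right]
    ring

lemma OutgoingProfile.continuousAt_radialField (h : OutgoingProfile n k G G') (δ : ℝ)
    {x : Space n} (hx : x ≠ 0) : ContinuousAt (fun x : Space n => radialField G' δ ‖x‖) x :=
  ContinuousAt.comp (f := fun y : Space n => ‖y‖)
    (h.hasDerivAt_radialField δ (norm_pos_iff.2 hx)).continuousAt continuous_norm.continuousAt

lemma OutgoingProfile.continuousAt_radialFieldDeriv (h : OutgoingProfile n k G G') (δ : ℝ)
    {x : Space n} (hx : x ≠ 0) :
    ContinuousAt (fun x : Space n => radialFieldDeriv n k G G' δ ‖x‖) x := by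
  have hr : ((‖x‖ : ℝ) : ℂ) ≠ 0 := by exact_mod_cast norm_ne_zero_iff.2 hx
  have h1 := h.continuousAt hx
  have h2 := h.continuousAt' hx
  have h3 := (continuous_cut_norm (n := n) δ).continuousAt (x := x)
  have h4 := (continuous_cutFlux_norm (n := n) δ).continuousAt (x := x)
  have h5 : ContinuousAt (fun x : Space n => ((‖x‖ : ℝ) : ℂ)) x := by fun_prop
  unfold radialFieldDeriv
  exact ((h4.mul h2).sub ((continuousAt_const.sub h3).mul
    (((continuousAt_const.mul h2).div h5 hr).add (continuousAt_const.mul h1)))).div h5 hr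

lemma continuousAt_coord (i : Fin n) (x : Space n) :
    ContinuousAt (fun y : Space n => ((y i : ℝ) : ℂ)) x := by fun_prop

/-- Green's identity for a test function and the cut-off fundamental solution: the cut-off
leaves only a flux term at scale `δ`. -/
lemma OutgoingProfile.integral_cutFund_mul (h : OutgoingProfile n k G G') {δ : ℝ} (hδ : 0 < δ)
    {ψ : Space n → ℂ} (hψ : IsTest ψ) :
    ∫ x, cutFund G δ x * (Δ ψ x + (k : ℂ) ^ 2 * ψ x)
      = ∫ x, (cutFlux δ ‖x‖ * (G' ‖x‖ * ψ x)
        - cutFlux δ ‖x‖ * (G ‖x‖ * ∑ i, (x i / ‖x‖ : ℝ) * pd i ψ x)) := by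
  have cM := h.continuous_cutFund (n := n) hδ
  have cN : ∀ i : Fin n, Continuous fun x : Space n => radialField G' δ ‖x‖ * x i := fun i => by
    refine continuous_of_vanishing_near_zero (fun x hx => ?_) hδ fun x hx => ?_
    · exact (h.continuousAt_radialField δ hx).mul (continuousAt_coord i x)
    · simp [radialField, cut_eq_one hδ (norm_nonneg x) hx]
  have cN' : ∀ i : Fin n, Continuous fun x : Space n =>
      (x i / ‖x‖ : ℝ) * radialFieldDeriv n k G G' δ ‖x‖ * x i + radialField G' δ ‖x‖ := fun i => by
    refine continuous_of_vanishing_near_zero (fun x hx => ?_) hδ fun x hx => ?_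
    · exact (((continuousAt_coord_div_norm i hx).mul (h.continuousAt_radialFieldDeriv δ hx)).mul
        (continuousAt_coord i x)).add (h.continuousAt_radialField δ hx)
    · simp [radialField, radialFieldDeriv, cut_eq_one hδ (norm_nonneg x) hx,
        cutFlux_eq_zero_of_le hδ (norm_nonneg x) hx]
  have cF : ∀ i : Fin n, Continuous fun x : Space n =>
      (x i / ‖x‖ : ℝ) * (cutFlux δ ‖x‖ * G ‖x‖) := fun i => by
    refine continuous_of_vanishing_near_zero (fun x hx => ?_) hδ fun x hx => ?_
    · exact (continuousAt_coord_div_norm i hx).mul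
        ((continuous_cutFlux_norm δ).continuousAt.mul (h.continuousAt hx))
    · simp [cutFlux_eq_zero_of_le hδ (norm_nonneg x) hx]
  have int : ∀ (F φ : Space n → ℂ), Continuous F → IsTest φ → Integrable fun x => F x * φ x :=
    fun F φ hF hφ => (hF.mul hφ.continuous).integrable_of_hasCompactSupport hφ.2.mul_left
  -- integrate by parts twice, splitting off the part of the gradient that falls on the cut-off
  have h1 : ∀ i : Fin n, ∫ x, cutFund G δ x * pd i (pd i ψ) x
      = (∫ x : Space n, ((x i / ‖x‖ : ℝ) * radialFieldDeriv n k G G' δ ‖x‖ * x i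
          + radialField G' δ ‖x‖) * ψ x)
        - ∫ x : Space n, (x i / ‖x‖ : ℝ) * (cutFlux δ ‖x‖ * G ‖x‖) * pd i ψ x := by
    intro i
    rw [integral_mul_pd_eq_neg cM (h.continuous_cutFundDeriv hδ i)
      (h.hasLineDerivAt_cutFund hδ i) (hψ.pd i)]
    have e := integral_mul_pd_eq_neg (cN i) (cN' i) (h.hasLineDerivAt_radialField hδ i) hψ
    have e2 : ∫ x, cutFundDeriv G G' δ i x * pd i ψ x
        = (∫ x : Space n, radialField G' δ ‖x‖ * x i * pd i ψ x)
          + ∫ x : Space n, (x i / ‖x‖ : ℝ) * (cutFlux δ ‖x‖ * G ‖x‖) * pd i ψ x := by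
      rw [← integral_add (int _ _ (cN i) (hψ.pd i)) (int _ _ (cF i) (hψ.pd i))]
      congr 1
      ext x
      unfold cutFundDeriv radialField
      push_cast
      ring
    rw [e2, e]
    ring
  have hsplit : ∀ x, cutFund G δ x * (Δ ψ x + (k : ℂ) ^ 2 * ψ x)
      = (∑ i, cutFund G δ x * pd i (pd i ψ) x) + (k : ℂ) ^ 2 * (cutFund G δ x * ψ x) := by
    intro x
    rw [laplacian_eq_sum_pd (hψ.1.of_le (by norm_cast)), mul_add, Finset.mul_sum]
    ring
  simp_rw [hsplit]
  rw [integral_add (integrable_finsetSum _ fun i _ => int _ _ cM ((hψ.pd i).pd i))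
    ((int _ _ cM hψ).const_mul _), integral_finsetSum _ fun i _ => int _ _ cM ((hψ.pd i).pd i)]
  simp_rw [h1]
  have iA : Integrable fun x : Space n => ∑ i, ((x i / ‖x‖ : ℝ) *
      radialFieldDeriv n k G G' δ ‖x‖ * x i + radialField G' δ ‖x‖) * ψ x :=
    integrable_finsetSum _ fun i _ => int _ _ (cN' i) hψ
  have iB : Integrable fun x : Space n => ∑ i, (x i / ‖x‖ : ℝ) *
      (cutFlux δ ‖x‖ * G ‖x‖) * pd i ψ x :=
    integrable_finsetSum _ fun i _ => int _ _ (cF i) (hψ.pd i)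
  rw [Finset.sum_sub_distrib, ← integral_finsetSum _ fun i _ => int _ _ (cN' i) hψ,
    ← integral_finsetSum _ fun i _ => int _ _ (cF i) (hψ.pd i), ← integral_sub iA iB]
  refine (integral_add (iA.sub iB) ((int _ _ cM hψ).const_mul _)).symm.trans ?_
  simp only [Pi.sub_apply]
  congr 1
  ext x
  -- pointwise, the radial Helmholtz equation cancels everything but the flux terms
  by_cases hx : x = 0
  · subst hx
    have c0 : cut δ 0 = 1 := cut_eq_one hδ le_rfl hδ.le
    have f0 : cutFlux δ 0 = 0 := cutFlux_eq_zero_of_le hδ le_rfl hδ.le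
    simp [cutFund, radialField, c0, f0]
  · have hr : ((‖x‖ : ℝ) : ℂ) ≠ 0 := by exact_mod_cast norm_ne_zero_iff.2 hx
    have hs : (∑ i, (x i : ℂ) * x i) = (‖x‖ : ℂ) ^ 2 := by
      have := sum_sq_eq x
      exact_mod_cast this
    have e1 : ∑ i, ((x i / ‖x‖ : ℝ) * radialFieldDeriv n k G G' δ ‖x‖ * x i
        + radialField G' δ ‖x‖) * ψ x
        = ((∑ i, (x i : ℂ) * x i) / ‖x‖ * radialFieldDeriv n k G G' δ ‖x‖
          + n * radialField G' δ ‖x‖) * ψ x := by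
      rw [← Finset.sum_mul, Finset.sum_add_distrib, Finset.sum_const, Finset.card_univ,
        Fintype.card_fin, Finset.sum_div, Finset.sum_mul, nsmul_eq_mul]
      congr 2
      refine Finset.sum_congr rfl fun i _ => ?_
      push_cast
      ring
    rw [e1, hs, Finset.mul_sum, Finset.mul_sum]
    have e2 : ∑ i, (x i / ‖x‖ : ℝ) * (cutFlux δ ‖x‖ * G ‖x‖) * pd i ψ x
        = ∑ i, cutFlux δ ‖x‖ * (G ‖x‖ * ((x i / ‖x‖ : ℝ) * pd i ψ x)) :=
      Finset.sum_congr rfl fun i _ => by ring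
    rw [e2]
    simp only [cutFund, radialField, radialFieldDeriv]
    field_simp
    ring

/-- The densities `κ_δ(|x|)|x|^{-(n-1)}` concentrate at the origin as `δ → 0`. -/
lemma tendsto_integral_cutFlux_div (hn : 0 < n) {b : Space n → ℂ} {b0 : ℂ}
    (hi : ∀ δ : ℝ, 0 < δ → Integrable fun x : Space n => (cutFlux δ ‖x‖ / ‖x‖ ^ (n - 1) : ℝ) * b x)
    (hb : Tendsto b (𝓝[≠] 0) (𝓝 b0)) :
    Tendsto (fun δ : ℝ => ∫ x : Space n, (cutFlux δ ‖x‖ / ‖x‖ ^ (n - 1) : ℝ) * b x) (𝓝[>] 0)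
      (𝓝 (sphereArea n * b0)) := by
  have hω := sphereArea_pos hn
  rw [Metric.tendsto_nhds]
  intro ε hε
  have hε' : 0 < ε / (2 * sphereArea n) := by positivity
  have h1 := (Metric.tendsto_nhds.1 hb) _ hε'
  rw [eventually_nhdsWithin_iff, Metric.eventually_nhds_iff] at h1
  obtain ⟨η, hη, h1⟩ := h1
  have h2 : ∀ᶠ δ in 𝓝[>] (0 : ℝ), δ < η / 2 :=
    nhdsWithin_le_nhds (Iio_mem_nhds (by positivity))
  filter_upwards [self_mem_nhdsWithin, h2] with δ hδ hδη
  have hδ : 0 < δ := hδ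
  have e1 : (sphereArea n : ℂ) * b0
      = ∫ x : Space n, (cutFlux δ ‖x‖ / ‖x‖ ^ (n - 1) : ℝ) * b0 := by
    rw [integral_mul_const, integral_complex_ofReal, integral_cutFlux_div hn hδ]
  have i2 : Integrable fun x : Space n => ((cutFlux δ ‖x‖ / ‖x‖ ^ (n - 1) : ℝ) : ℂ) * b0 :=
    (integrable_cutFlux_div hδ).ofReal.mul_const b0
  rw [dist_eq_norm, e1, ← integral_sub (hi δ hδ) i2]
  calc _ ≤ ∫ x : Space n, cutFlux δ ‖x‖ / ‖x‖ ^ (n - 1) * (ε / (2 * sphereArea n)) := by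
        refine norm_integral_le_of_norm_le ((integrable_cutFlux_div hδ).mul_const _)
          (Eventually.of_forall fun x => ?_)
        have hnn : 0 ≤ cutFlux δ ‖x‖ / ‖x‖ ^ (n - 1) :=
          div_nonneg (cutFlux_nonneg (norm_nonneg _)) (by positivity)
        rw [← mul_sub, norm_mul, Complex.norm_real, Real.norm_of_nonneg hnn]
        by_cases hx : ‖x‖ ≤ δ
        · simp [cutFlux_eq_zero_of_le hδ (norm_nonneg _) hx]
        by_cases hx2 : 2 * δ ≤ ‖x‖
        · simp [cutFlux_eq_zero_of_ge hδ hx2]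
        · push Not at hx hx2
          gcongr
          rw [← dist_eq_norm]
          refine (h1 ?_ ?_).le
          · rw [dist_zero_right]
            linarith
          · exact norm_pos_iff.1 (hδ.trans hx)
    _ = ε / 2 := by
        rw [integral_mul_const, integral_cutFlux_div hn hδ]
        field_simp
    _ < ε := by linarith

lemma tendsto_norm_nhdsNE_zero : Tendsto (fun x : Space n => ‖x‖) (𝓝[≠] 0) (𝓝[>] 0) := by
  refine tendsto_nhdsWithin_iff.2 ⟨?_, ?_⟩
  · simpa using (continuous_norm.tendsto (0 : Space n)).mono_left nhdsWithin_le_nhds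
  · filter_upwards [self_mem_nhdsWithin] with x hx
    exact norm_pos_iff.2 hx

lemma norm_sum_coord_mul_le (x : Space n) (g : Fin n → ℂ) :
    ‖∑ i, (x i / ‖x‖ : ℝ) * g i‖ ≤ ∑ i, ‖g i‖ := by
  refine (norm_sum_le _ _).trans (Finset.sum_le_sum fun i _ => ?_)
  rw [norm_mul, Complex.norm_real]
  refine mul_le_of_le_one_left (norm_nonneg _) ?_
  rw [norm_div, norm_norm]
  exact div_le_one_of_le₀ (PiLp.norm_apply_le x i) (norm_nonneg _)

/-- The fundamental solution satisfies `(Δ + k²) Φ = -δ₀` in the sense of distributions. -/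
theorem OutgoingProfile.integral_fund_mul (h : OutgoingProfile n k G G') (hn : 2 ≤ n)
    {ψ : Space n → ℂ} (hψ : IsTest ψ) :
    ∫ x : Space n, G ‖x‖ * (Δ ψ x + (k : ℂ) ^ 2 * ψ x) = -ψ 0 := by
  have hn0 : 0 < n := by omega
  have hω := sphereArea_pos hn0
  have hω' : (sphereArea n : ℂ) ≠ 0 := by exact_mod_cast hω.ne'
  set φ : Space n → ℂ := fun x => Δ ψ x + (k : ℂ) ^ 2 * ψ x with hφ
  have hlap : Δ ψ = fun x => ∑ i, pd i (pd i ψ) x :=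
    funext fun x => laplacian_eq_sum_pd (hψ.1.of_le (by norm_cast)) x
  have cφ : Continuous φ := by
    rw [hφ, hlap]
    exact (continuous_finsetSum _ fun i _ => ((hψ.pd i).pd i).continuous).add
      (continuous_const.mul hψ.continuous)
  have sφ : HasCompactSupport φ := by
    obtain ⟨r, hr, h0⟩ := hψ.exists_radius
    refine HasCompactSupport.intro (isCompact_closedBall (0 : Space n) r) fun x hx => ?_
    have hx : r < ‖x‖ := by simpa using hx
    have : ψ =ᶠ[𝓝 x] fun _ => 0 := by
      filter_upwards [(continuous_norm.isOpen_preimage _ isOpen_Ioi).mem_nhds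
        (show x ∈ norm ⁻¹' Ioi r from hx)] with y hy
      exact h0 y (le_of_lt hy)
    rw [hφ]
    simp only
    rw [(InnerProductSpace.laplacian_congr_nhds this).eq_of_nhds, h0 x hx.le]
    simp
  -- remove the cut-off from the volume term
  have hleft : Tendsto (fun δ : ℝ => ∫ x, cutFund G δ x * φ x) (𝓝[>] 0)
      (𝓝 (∫ x : Space n, G ‖x‖ * φ x)) := by
    refine tendsto_integral_filter_of_dominated_convergence (fun x => ‖G ‖x‖ * φ x‖) ?_ ?_ ?_ ?_
    · filter_upwards [self_mem_nhdsWithin] with δ hδ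
      exact ((h.continuous_cutFund hδ).mul cφ).aestronglyMeasurable
    · refine Eventually.of_forall fun δ => Eventually.of_forall fun x => ?_
      rw [cutFund, mul_assoc, norm_mul]
      refine mul_le_of_le_one_left (norm_nonneg _) ?_
      rw [← Complex.ofReal_one, ← Complex.ofReal_sub, Complex.norm_real, Real.norm_eq_abs, abs_le]
      constructor <;> linarith [cut_nonneg δ ‖x‖, cut_le_one δ ‖x‖]
    · have := (h.locallyIntegrable hn0).integrable_smul_right_of_hasCompactSupport cφ sφ
      refine Integrable.norm ?_
      simpa [mul_comm] using this
    · filter_upwards [ae_ne_zero hn0] with x hx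
      refine tendsto_const_nhds.congr' ?_
      have : ∀ᶠ δ in 𝓝[>] (0 : ℝ), δ < ‖x‖ / 2 :=
        nhdsWithin_le_nhds (Iio_mem_nhds (by have := norm_pos_iff.2 hx; positivity))
      filter_upwards [self_mem_nhdsWithin, this] with δ hδ hδx
      rw [cutFund, cut_eq_zero hδ (by linarith)]
      simp
  -- the flux through small spheres
  have hpow : ∀ x : Space n, x ≠ 0 → ((‖x‖ : ℂ) ^ (n - 1)) ≠ 0 := fun x hx =>
    pow_ne_zero _ (by exact_mod_cast norm_ne_zero_iff.2 hx)
  have hA : ∀ (F : Space n → ℂ), (∀ x, x ≠ 0 → ContinuousAt F x) → ∀ δ : ℝ, 0 < δ →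
      Integrable (fun x => cutFlux δ ‖x‖ * F x) := by
    intro F hF δ hδ
    refine Continuous.integrable_of_hasCompactSupport ?_ ?_
    · refine continuous_of_vanishing_near_zero (fun x hx => ?_) hδ fun x hx => ?_
      · exact (continuous_cutFlux_norm δ).continuousAt.mul (hF x hx)
      · simp [cutFlux_eq_zero_of_le hδ (norm_nonneg x) hx]
    · refine HasCompactSupport.intro (isCompact_closedBall (0 : Space n) (2 * δ)) fun x hx => ?_
      have : 2 * δ < ‖x‖ := by simpa using hx
      simp [cutFlux_eq_zero_of_ge hδ this.le]
  -- a field `F` with `|x|^{n-1} F(x) → b0` has flux `|S^{n-1}| b0` through small spheres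
  have hB : ∀ (F : Space n → ℂ) (b0 : ℂ), (∀ x, x ≠ 0 → ContinuousAt F x) →
      Tendsto (fun x : Space n => (‖x‖ : ℂ) ^ (n - 1) * F x) (𝓝[≠] 0) (𝓝 b0) →
      Tendsto (fun δ : ℝ => ∫ x : Space n, cutFlux δ ‖x‖ * F x) (𝓝[>] 0)
        (𝓝 (sphereArea n * b0)) := by
    intro F b0 hF hlim
    have hae : ∀ δ : ℝ, (fun x : Space n => (cutFlux δ ‖x‖ : ℂ) * F x) =ᵐ[volume] fun x =>
        (cutFlux δ ‖x‖ / ‖x‖ ^ (n - 1) : ℝ) * ((‖x‖ : ℂ) ^ (n - 1) * F x) := by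
      intro δ
      filter_upwards [ae_ne_zero hn0] with x hx
      have := hpow x hx
      push_cast
      field_simp
    refine (tendsto_integral_cutFlux_div hn0 (fun δ hδ => (hA F hF δ hδ).congr (hae δ)) hlim).congr
      fun δ => ?_
    exact (integral_congr_ae (hae δ)).symm
  have cψ : Tendsto ψ (𝓝[≠] 0) (𝓝 (ψ 0)) := (hψ.continuous.tendsto 0).mono_left nhdsWithin_le_nhds
  have hr1 : Tendsto (fun δ : ℝ => ∫ x : Space n, cutFlux δ ‖x‖ * (G' ‖x‖ * ψ x)) (𝓝[>] 0)
      (𝓝 (sphereArea n * (-(1 / sphereArea n : ℝ) * ψ 0))) := by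
    refine hB _ _ (fun x hx => (h.continuousAt' hx).mul hψ.continuous.continuousAt) ?_
    refine ((h.flux.comp tendsto_norm_nhdsNE_zero).mul cψ).congr fun x => ?_
    simp only [Function.comp]
    ring
  have cD : ∀ x, x ≠ 0 → ContinuousAt
      (fun x : Space n => G ‖x‖ * ∑ i, (x i / ‖x‖ : ℝ) * pd i ψ x) x := fun x hx =>
    (h.continuousAt hx).mul (tendsto_finsetSum _ fun i _ =>
      (continuousAt_coord_div_norm i hx).mul (hψ.pd i).continuous.continuousAt)
  -- `|x|^{n-1} G(|x|)` is `O(|x|^{(n-1)/2})`, so this term carries no flux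
  have hr2 : Tendsto (fun δ : ℝ => ∫ x : Space n, cutFlux δ ‖x‖ *
      (G ‖x‖ * ∑ i, (x i / ‖x‖ : ℝ) * pd i ψ x)) (𝓝[>] 0) (𝓝 (sphereArea n * 0)) := by
    refine hB _ _ cD ?_
    obtain ⟨C, hC, hbd⟩ := h.bound
    choose D hD using fun i => (hψ.pd i).exists_bound
    have hlim : Tendsto (fun r : ℝ => C * r ^ (((n : ℝ) - 1) / 2) * ∑ i, D i) (𝓝[>] 0) (𝓝 0) := by
      have hpos : 0 < ((n : ℝ) - 1) / 2 := by
        have : (2 : ℝ) ≤ n := by exact_mod_cast hn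
        linarith
      have : Continuous fun r : ℝ => C * r ^ (((n : ℝ) - 1) / 2) * ∑ i, D i :=
        (continuous_const.mul (Real.continuous_rpow_const hpos.le)).mul continuous_const
      have := (this.tendsto 0).mono_left (nhdsWithin_le_nhds (s := Ioi 0))
      simpa [Real.zero_rpow hpos.ne'] using this
    refine squeeze_zero_norm' ?_ (hlim.comp tendsto_norm_nhdsNE_zero)
    filter_upwards [self_mem_nhdsWithin] with x hx
    have hx0 : 0 < ‖x‖ := norm_pos_iff.2 hx
    have e : C * ‖x‖ ^ (((n : ℝ) - 1) / 2) * ∑ i, D i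
        = ‖x‖ ^ (n - 1) * (C * decay n ‖x‖) * ∑ i, D i := by
      have h1 : ‖x‖ ^ (n - 1) * decay n ‖x‖ = ‖x‖ ^ (((n : ℝ) - 1) / 2) := by
        have h2 : decay n ‖x‖ ^ 2 * ‖x‖ ^ (n - 1) = 1 := by
          rw [decay_sq hn0 hx0.le]
          field_simp
        have h3 := rpow_mul_decay (n := n) hx0
        have h4 : 0 < decay n ‖x‖ := decay_pos hx0
        have : decay n ‖x‖ * (‖x‖ ^ (n - 1) * decay n ‖x‖)
            = decay n ‖x‖ * ‖x‖ ^ (((n : ℝ) - 1) / 2) := by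
          rw [mul_comm (decay n ‖x‖) (‖x‖ ^ (((n : ℝ) - 1) / 2)), h3, ← h2]
          ring
        exact mul_left_cancel₀ h4.ne' this
      rw [← h1]
      ring
    simp only [Function.comp]
    rw [e, norm_mul, norm_mul, norm_pow, Complex.norm_real, norm_norm, mul_assoc]
    gcongr
    · exact mul_nonneg hC (decay_nonneg hx0.le)
    · exact hbd _ hx0
    · exact (norm_sum_coord_mul_le x _).trans (Finset.sum_le_sum fun i _ => hD i x)
  have hright := hr1.sub hr2
  have key : Tendsto (fun δ : ℝ => ∫ x, cutFund G δ x * φ x) (𝓝[>] 0) (𝓝 (-ψ 0)) := by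
    have e : (sphereArea n * (-(1 / sphereArea n : ℝ) * ψ 0) - sphereArea n * 0 : ℂ) = -ψ 0 := by
      push_cast
      field_simp
      ring
    rw [e] at hright
    refine hright.congr' ?_
    filter_upwards [self_mem_nhdsWithin] with δ hδ
    rw [h.integral_cutFund_mul hδ hψ, integral_sub]
    · exact hA _ (fun x hx => (h.continuousAt' hx).mul hψ.continuous.continuousAt) δ hδ
    · exact hA _ cD δ hδ
  exact tendsto_nhds_unique hleft key

/-! ### Outgoing potentials of test functions -/

/-- The volume potential `Φ * ψ` with radial kernel `Φ(y) = G(|y|)`. -/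
noncomputable def potential (G : ℝ → ℂ) (ψ : Space n → ℂ) (x : Space n) : ℂ :=
  ∫ y : Space n, G ‖y‖ * ψ (x - y)

lemma potential_eq_convolution (G : ℝ → ℂ) (ψ : Space n → ℂ) :
    potential G ψ = convolution (fun y : Space n => G ‖y‖) ψ (ContinuousLinearMap.mul ℝ ℂ) volume :=
  rfl

lemma OutgoingProfile.contDiff_potential (h : OutgoingProfile n k G G') (hn : 0 < n)
    {ψ : Space n → ℂ} (hψ : IsTest ψ) : ContDiff ℝ ∞ (potential G ψ) := by
  rw [potential_eq_convolution]
  exact hψ.2.contDiff_convolution_right _ (h.locallyIntegrable hn) hψ.1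

lemma OutgoingProfile.pd_potential (h : OutgoingProfile n k G G') (hn : 0 < n)
    {ψ : Space n → ℂ} (hψ : IsTest ψ) (i : Fin n) :
    pd i (potential G ψ) = potential G (pd i ψ) := by
  ext x
  have h1 := hψ.2.hasFDerivAt_convolution_right (ContinuousLinearMap.mul ℝ ℂ)
    (h.locallyIntegrable hn) (hψ.1.of_le (by norm_cast)) x
  rw [← potential_eq_convolution] at h1
  rw [HelmholtzScattering.pd, h1.fderiv, convolution_precompR_apply _ (h.locallyIntegrable hn)
    (hψ.2.fderiv ℝ) (hψ.1.continuous_fderiv (by simp))]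
  rfl

lemma OutgoingProfile.integrable_fund_mul (h : OutgoingProfile n k G G') (hn : 0 < n)
    {φ : Space n → ℂ} (hφ : IsTest φ) : Integrable fun x : Space n => G ‖x‖ * φ x := by
  have := (h.locallyIntegrable hn).integrable_smul_right_of_hasCompactSupport hφ.continuous hφ.2
  simpa [mul_comm] using this

/-- The potential `W = Φ * ψ` solves `(Δ + k²) W = -ψ`. -/
lemma OutgoingProfile.helmholtz_potential (h : OutgoingProfile n k G G') (hn : 2 ≤ n)
    {ψ : Space n → ℂ} (hψ : IsTest ψ) (x : Space n) :
    ∑ i, pd i (pd i (potential G ψ)) x + (k : ℂ) ^ 2 * potential G ψ x = -ψ x := by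
  have hn0 : 0 < n := by omega
  have e1 : ∀ i, pd i (pd i (potential G ψ)) x
      = ∫ y : Space n, G ‖y‖ * pd i (pd i ψ) (x - y) := fun i => by
    rw [h.pd_potential hn0 hψ, h.pd_potential hn0 (hψ.pd i)]
    rfl
  simp_rw [e1]
  have i1 : ∀ i, Integrable fun y : Space n => G ‖y‖ * pd i (pd i ψ) (x - y) := fun i =>
    h.integrable_fund_mul hn0 (((hψ.pd i).pd i).comp_sub x)
  have key := h.integral_fund_mul hn (hψ.comp_sub x)
  rw [sub_zero] at key
  rw [← key, potential, ← integral_finsetSum _ fun i _ => i1 i, ← integral_const_mul,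
    ← integral_add (integrable_finsetSum _ fun i _ => i1 i)
      ((h.integrable_fund_mul hn0 (hψ.comp_sub x)).const_mul _)]
  congr 1
  ext y
  rw [laplacian_eq_sum_pd ((hψ.comp_sub x).1.of_le (by norm_cast))]
  have e2 : ∀ i, pd i (pd i fun y => ψ (x - y)) y = pd i (pd i ψ) (x - y) := fun i => by
    have e3 : pd i (fun y => ψ (x - y)) = fun y => -pd i ψ (x - y) :=
      funext fun y => pd_comp_sub hψ.differentiable i x y
    rw [e3]
    have e4 := pd_comp_sub (hψ.pd i).differentiable i x y
    have e5 : pd i (fun y => -pd i ψ (x - y)) y = -pd i (fun y => pd i ψ (x - y)) y := by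
      unfold HelmholtzScattering.pd
      rw [fderiv_fun_neg]
      rfl
    rw [e5, e4, neg_neg]
  simp_rw [e2]
  rw [mul_add, Finset.mul_sum]
  ring

/-- Far from the support of `ψ`, the derivative of the potential falls on the kernel. -/
lemma OutgoingProfile.pd_potential_far (h : OutgoingProfile n k G G') (hn : 0 < n)
    {ψ : Space n → ℂ} (hψ : IsTest ψ) {r : ℝ} (h0 : ∀ y, r ≤ ‖y‖ → ψ y = 0) (i : Fin n)
    {x : Space n} (hx : r + 3 ≤ ‖x‖) :
    pd i (potential G ψ) x = ∫ y : Space n, (y i / ‖y‖ : ℝ) * G' ‖y‖ * ψ (x - y) := by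
  have hfar : ∀ y, ‖x - y‖ ≤ r + 1 → 2 ≤ ‖y‖ := fun y hy => by
    have := norm_sub_norm_le x y
    linarith
  have hpd : ∀ z, r + 1 ≤ ‖z‖ → pd i ψ z = 0 := fun z hz => by
    have : ψ =ᶠ[𝓝 z] fun _ => 0 := by
      filter_upwards [(continuous_norm.isOpen_preimage _ isOpen_Ioi).mem_nhds
        (show z ∈ norm ⁻¹' Ioi r by simp only [mem_preimage, mem_Ioi]; linarith)] with y hy
      exact h0 y (le_of_lt hy)
    unfold HelmholtzScattering.pd
    rw [this.fderiv_eq]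
    simp
  -- the cut-off at scale `1` smooths the kernel at the origin without changing it near `x - supp ψ`
  have e := integral_mul_pd_eq_neg (h.continuous_cutFund one_pos)
    (h.continuous_cutFundDeriv one_pos i) (h.hasLineDerivAt_cutFund one_pos i) (hψ.comp_sub x)
  rw [h.pd_potential hn hψ, potential]
  have e1 : ∫ y : Space n, G ‖y‖ * pd i ψ (x - y)
      = -∫ y : Space n, cutFund G 1 y * pd i (fun y => ψ (x - y)) y := by
    rw [← integral_neg]
    congr 1
    ext y
    rw [pd_comp_sub hψ.differentiable]
    by_cases hy : r + 1 ≤ ‖x - y‖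
    · simp [hpd _ hy]
    · push Not at hy
      rw [cutFund, cut_eq_zero one_pos (by simpa using hfar y hy.le)]
      simp
  rw [e1, e, neg_neg]
  congr 1
  ext y
  by_cases hy : r ≤ ‖x - y‖
  · simp [h0 _ hy]
  · push Not at hy
    have h2 := hfar y (by linarith)
    rw [cutFundDeriv, cut_eq_zero one_pos (by simpa using h2),
      cutFlux_eq_zero_of_ge one_pos (by simpa using h2)]
    simp

lemma norm_integral_shift_le {ψ F : Space n → ℂ} (hψ : IsTest ψ) (x : Space n) {B : ℝ}
    (hF : ∀ y, ψ (x - y) ≠ 0 → ‖F y‖ ≤ B) :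
    ‖∫ y, F y * ψ (x - y)‖ ≤ B * ∫ y, ‖ψ y‖ := by
  have hi : Integrable fun y => B * ‖ψ (x - y)‖ := (hψ.comp_sub x).integrable.norm.const_mul B
  refine (norm_integral_le_of_norm_le hi (Eventually.of_forall fun y => ?_)).trans (le_of_eq ?_)
  · by_cases hy : ψ (x - y) = 0
    · simp [hy]
    · rw [norm_mul]
      gcongr
      exact hF y hy
  · rw [integral_const_mul, integral_sub_left_eq_self (fun y => ‖ψ y‖)]

lemma decay_le_of_half_le (hn : 0 < n) {r s : ℝ} (hr : 0 < r) (h : r / 2 ≤ s) :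
    decay n s ≤ 2 ^ (((n : ℝ) - 1) / 2) * decay n r := by
  rw [← decay_half r hr.le]
  exact decay_antitone hn (by positivity) h

lemma OutgoingProfile.norm_potential_le (h : OutgoingProfile n k G G') (hn : 0 < n)
    {ψ : Space n → ℂ} (hψ : IsTest ψ) :
    ∃ C r₀ : ℝ, 0 ≤ C ∧ 0 < r₀ ∧ ∀ x, r₀ ≤ ‖x‖ → ‖potential G ψ x‖ ≤ C * decay n ‖x‖ := by
  obtain ⟨C, hC, hb⟩ := h.bound
  obtain ⟨r, hr, h0⟩ := hψ.exists_radius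
  refine ⟨C * 2 ^ (((n : ℝ) - 1) / 2) * ∫ y, ‖ψ y‖, 2 * r,
    mul_nonneg (by positivity) (integral_nonneg fun y => norm_nonneg _), by positivity,
    fun x hx => ?_⟩
  have hx0 : 0 < ‖x‖ := by linarith
  refine (norm_integral_shift_le (F := fun y => G ‖y‖) hψ x
    (B := C * (2 ^ (((n : ℝ) - 1) / 2) * decay n ‖x‖)) fun y hy => ?_).trans (le_of_eq (by ring))
  have hxy : ‖x - y‖ < r := by
    by_contra! hc
    exact hy (h0 _ hc)
  have h2 : ‖x‖ / 2 ≤ ‖y‖ := by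
    have := norm_sub_norm_le x y
    linarith
  refine (hb _ (by linarith)).trans ?_
  gcongr
  exact decay_le_of_half_le hn hx0 h2

/-- The directions `x/|x|` and `y/|y|` agree up to `O(|x-y|/|x|)`. -/
lemma abs_one_sub_cos_le {x y : Space n} (hx : x ≠ 0) (hy : y ≠ 0) :
    |1 - inner ℝ x y / (‖x‖ * ‖y‖)| ≤ 2 * ‖x - y‖ / ‖x‖ := by
  have hx' := norm_pos_iff.2 hx
  have hy' := norm_pos_iff.2 hy
  have h1 : inner ℝ x y ≤ ‖x‖ * ‖y‖ := real_inner_le_norm x y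
  have h2 : ‖x‖ * ‖y‖ - inner ℝ x y ≤ 2 * ‖x - y‖ * ‖y‖ := by
    have e : inner ℝ x y = inner ℝ (x - y) y + ‖y‖ ^ 2 := by
      rw [inner_sub_left, real_inner_self_eq_norm_sq]
      ring
    have h3 := abs_le.1 (abs_real_inner_le_norm (x - y) y)
    have h4 := norm_sub_norm_le x y
    rw [e]
    nlinarith
  rw [show 1 - inner ℝ x y / (‖x‖ * ‖y‖) = (‖x‖ * ‖y‖ - inner ℝ x y) / (‖x‖ * ‖y‖) by field_simp,
    abs_of_nonneg (div_nonneg (by linarith) (by positivity)), div_le_div_iff₀ (by positivity) hx']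
  nlinarith

/-- The potential of a test function satisfies the Sommerfeld radiation condition. -/
lemma OutgoingProfile.radiating_potential (h : OutgoingProfile n k G G') (hn : 0 < n)
    {ψ : Space n → ℂ} (hψ : IsTest ψ) {ε : ℝ} (hε : 0 < ε) :
    ∃ r₀ : ℝ, 0 < r₀ ∧ ∀ x, r₀ ≤ ‖x‖ →
      ‖(∑ i, (x i / ‖x‖ : ℝ) * pd i (potential G ψ) x) - Complex.I * k * potential G ψ x‖
        ≤ ε * decay n ‖x‖ := by
  obtain ⟨C, hC, hb⟩ := h.bound
  obtain ⟨C', hC', hb'⟩ := h.radiating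
  obtain ⟨r, hr, h0⟩ := hψ.exists_radius
  set I := ∫ y, ‖ψ y‖ with hI
  have hI0 : 0 ≤ I := integral_nonneg fun y => norm_nonneg _
  set A : ℝ := 2 ^ (((n : ℝ) - 1) / 2) with hA
  have hA0 : 0 < A := by positivity
  set D : ℝ := (2 * C' + 2 * r * (C' + |k| * C)) * A * I with hD
  have hD0 : 0 ≤ D := by positivity
  refine ⟨max (2 * r + 3) (D / ε), by positivity, fun x hx => ?_⟩
  have hx1 : 2 * r + 3 ≤ ‖x‖ := (le_max_left _ _).trans hx
  have hx2 : D / ε ≤ ‖x‖ := (le_max_right _ _).trans hx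
  have hx0 : 0 < ‖x‖ := by linarith
  have hxne : x ≠ 0 := norm_pos_iff.1 hx0
  have hy : ∀ y, ψ (x - y) ≠ 0 → ‖x - y‖ ≤ r ∧ ‖x‖ / 2 ≤ ‖y‖ ∧ 1 ≤ ‖y‖ := by
    intro y hy
    have hxy : ‖x - y‖ < r := by
      by_contra! hc
      exact hy (h0 _ hc)
    have := norm_sub_norm_le x y
    exact ⟨hxy.le, by linarith, by linarith⟩
  have hint : ∀ F : Space n → ℂ, (∀ x, x ≠ 0 → ContinuousAt F x) →
      Integrable fun y => F y * ψ (x - y) := by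
    intro F hF
    have hc : Continuous fun y => F y * ψ (x - y) := by
      refine continuous_of_vanishing_near_zero (fun z hz => ?_) one_half_pos fun z hz => ?_
      · exact (hF z hz).mul (hψ.comp_sub x).continuous.continuousAt
      · by_cases hz' : ψ (x - z) = 0
        · simp [hz']
        · have := (hy z hz').2.2
          norm_num at hz
          linarith
    exact hc.integrable_of_hasCompactSupport (hψ.comp_sub x).2.mul_left
  have i1 : ∀ i : Fin n, Integrable fun y : Space n => (y i / ‖y‖ : ℝ) * G' ‖y‖ * ψ (x - y) :=
    fun i => hint _ fun z hz => (continuousAt_coord_div_norm i hz).mul (h.continuousAt' hz)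
  have i2 : Integrable fun y : Space n => G ‖y‖ * ψ (x - y) := hint _ fun z hz => h.continuousAt hz
  have e : (∑ i, (x i / ‖x‖ : ℝ) * pd i (potential G ψ) x) - Complex.I * k * potential G ψ x
      = ∫ y : Space n, ((∑ i, (x i / ‖x‖ : ℝ) * ((y i / ‖y‖ : ℝ) * G' ‖y‖))
        - Complex.I * k * G ‖y‖) * ψ (x - y) := by
    simp_rw [fun i => h.pd_potential_far hn hψ h0 i (x := x) (by linarith), potential,
      ← integral_const_mul]
    rw [← integral_finsetSum _ fun i _ => (i1 i).const_mul _, ← integral_sub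
      (integrable_finsetSum _ fun i _ => (i1 i).const_mul _) (i2.const_mul _)]
    congr 1
    ext y
    rw [sub_mul, Finset.sum_mul]
    congr 1
    · exact Finset.sum_congr rfl fun i _ => by ring
    · ring
  rw [e]
  refine (norm_integral_shift_le hψ x
    (B := (2 * C' + 2 * r * (C' + |k| * C)) * (A * decay n ‖x‖) / ‖x‖) fun y hψy => ?_).trans ?_
  · obtain ⟨hxy, hy2, hy1⟩ := hy y hψy
    have hy0 : 0 < ‖y‖ := by linarith
    have hdec : decay n ‖y‖ ≤ A * decay n ‖x‖ := decay_le_of_half_le hn hx0 hy2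
    have hsum : (∑ i, ((x i / ‖x‖ : ℝ) : ℂ) * ((y i / ‖y‖ : ℝ) * G' ‖y‖))
        = ((inner ℝ x y / (‖x‖ * ‖y‖) : ℝ) : ℂ) * G' ‖y‖ := by
      rw [show inner ℝ x y = ∑ i, x i * y i by
        rw [PiLp.inner_apply]; simp [mul_comm]]
      rw [Finset.sum_div, Complex.ofReal_sum, Finset.sum_mul]
      refine Finset.sum_congr rfl fun i _ => ?_
      push_cast
      ring
    rw [hsum]
    -- the radial derivatives at `x` and at `y` differ only by the angle between `x` and `y`, and both
    -- errors gain a factor `1 / |x|`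
    have e2 : ((inner ℝ x y / (‖x‖ * ‖y‖) : ℝ) : ℂ) * G' ‖y‖ - Complex.I * k * G ‖y‖
        = (G' ‖y‖ - Complex.I * k * G ‖y‖)
          - ((1 - inner ℝ x y / (‖x‖ * ‖y‖) : ℝ) : ℂ) * G' ‖y‖ := by
      push_cast
      ring
    rw [e2]
    have b1 : ‖G' ‖y‖ - Complex.I * k * G ‖y‖‖ ≤ C' * (A * decay n ‖x‖) * (2 / ‖x‖) := by
      have h3 : 1 / ‖y‖ ≤ 2 / ‖x‖ := by
        rw [div_le_div_iff₀ hy0 hx0]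
        linarith
      calc _ ≤ C' * decay n ‖y‖ / ‖y‖ := hb' _ hy0
        _ = C' * decay n ‖y‖ * (1 / ‖y‖) := by ring
        _ ≤ _ := by
          have := decay_nonneg (n := n) hx0.le
          gcongr
    have b2 : ‖G' ‖y‖‖ ≤ (C' + |k| * C) * (A * decay n ‖x‖) := by
      have e3 : G' ‖y‖ = (G' ‖y‖ - Complex.I * k * G ‖y‖) + Complex.I * k * G ‖y‖ := by ring
      rw [e3]
      refine (norm_add_le _ _).trans ?_
      rw [norm_mul, norm_mul, Complex.norm_I, one_mul, Complex.norm_real, Real.norm_eq_abs]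
      have h4 : ‖G' ‖y‖ - Complex.I * k * G ‖y‖‖ ≤ C' * decay n ‖y‖ :=
        (hb' _ hy0).trans (div_le_self (mul_nonneg hC' (decay_nonneg hy0.le)) hy1)
      have h5 := hb _ hy0
      calc _ ≤ C' * decay n ‖y‖ + |k| * (C * decay n ‖y‖) := by gcongr
        _ = (C' + |k| * C) * decay n ‖y‖ := by ring
        _ ≤ _ := by gcongr
    have b3 : |1 - inner ℝ x y / (‖x‖ * ‖y‖)| ≤ 2 * r / ‖x‖ :=
      (abs_one_sub_cos_le hxne (norm_pos_iff.1 hy0)).trans (by gcongr)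
    refine (norm_sub_le _ _).trans ?_
    rw [norm_mul, Complex.norm_real, Real.norm_eq_abs]
    calc _ ≤ C' * (A * decay n ‖x‖) * (2 / ‖x‖)
          + 2 * r / ‖x‖ * ((C' + |k| * C) * (A * decay n ‖x‖)) := by gcongr
      _ = _ := by ring
  · have hdx := decay_nonneg (n := n) hx0.le
    have h6 : D / ‖x‖ ≤ ε := by
      rw [div_le_iff₀ hx0]
      rw [div_le_iff₀ hε] at hx2
      linarith
    calc _ = D / ‖x‖ * decay n ‖x‖ := by rw [hD]; ring
      _ ≤ _ := by gcongr

/-! ### Square integrable functions, translation and mollification -/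

lemma MemL2Loc.memLp_indicator {v : Space n → ℂ} (hv : MemL2Loc v) (r : ℝ) :
    MemLp ((ball (0 : Space n) r).indicator v) 2 :=
  (memLp_indicator_iff_restrict measurableSet_ball).2 (hv r)

lemma MemL2Loc.memLp_mul {v φ : Space n → ℂ} (hv : MemL2Loc v) (hφ : Continuous φ)
    (hφ' : HasCompactSupport φ) : MemLp (fun x => v x * φ x) 2 := by
  obtain ⟨r, hr, h0⟩ := exists_radius_of_hasCompactSupport hφ'
  obtain ⟨C, hC⟩ := hφ.bounded_above_of_compact_support hφ'
  have e : (fun x => v x * φ x) = fun x => (ball (0 : Space n) r).indicator v x * φ x := by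
    ext x
    by_cases hx : x ∈ ball (0 : Space n) r
    · simp [indicator_of_mem hx]
    · rw [h0 x (by simpa using hx), mul_zero, mul_zero]
  rw [e]
  refine (hv.memLp_indicator r).of_le_mul (c := C)
    ((hv.memLp_indicator r).1.mul hφ.aestronglyMeasurable)
    (Eventually.of_forall fun x => ?_)
  rw [norm_mul, mul_comm]
  exact mul_le_mul_of_nonneg_right (hC x) (norm_nonneg _)

lemma MemL2Loc.integrable_mul_mul {v h φ : Space n → ℂ} (hv : MemL2Loc v) (hh : MemL2Loc h)
    (hφ : Continuous φ) (hφ' : HasCompactSupport φ) : Integrable fun x => v x * φ x * h x := by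
  obtain ⟨r, hr, h0⟩ := exists_radius_of_hasCompactSupport hφ'
  refine ((hv.memLp_mul hφ hφ').integrable_mul (hh.memLp_indicator r)).congr
    (Eventually.of_forall fun x => ?_)
  by_cases hx : x ∈ ball (0 : Space n) r
  · simp [indicator_of_mem hx]
  · simp [h0 x (by simpa using hx)]

lemma memL2Loc_of_continuous {v : Space n → ℂ} (hv : Continuous v) : MemL2Loc v := by
  intro r
  have hf : IsFiniteMeasure (volume.restrict (ball (0 : Space n) r)) :=
    ⟨by simpa using measure_ball_lt_top⟩
  obtain ⟨C, hC⟩ := (isCompact_closedBall (0 : Space n) r).exists_bound_of_continuousOn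
    hv.continuousOn
  refine MemLp.of_bound hv.aestronglyMeasurable C ?_
  filter_upwards [ae_restrict_mem measurableSet_ball] with x hx
  exact hC x (ball_subset_closedBall hx)

lemma MemL2Loc.integrable_mul {v φ : Space n → ℂ} (hv : MemL2Loc v) (hφ : Continuous φ)
    (hφ' : HasCompactSupport φ) : Integrable fun x => v x * φ x := by
  simpa using hv.integrable_mul_mul
    (memL2Loc_of_continuous (continuous_const (y := (1 : ℂ)))) hφ hφ'

lemma MemL2Loc.integrableOn_ball {v : Space n → ℂ} (hv : MemL2Loc v) (r : ℝ) :
    IntegrableOn v (ball 0 r) := by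
  have hf : IsFiniteMeasure (volume.restrict (ball (0 : Space n) r)) :=
    ⟨by simpa using measure_ball_lt_top⟩
  exact (hv r).integrable (by norm_num)

lemma MemL2Loc.locallyIntegrable {v : Space n → ℂ} (hv : MemL2Loc v) : LocallyIntegrable v := by
  rw [locallyIntegrable_iff]
  intro K hK
  obtain ⟨r, hr⟩ := hK.isBounded.subset_ball 0
  exact (hv.integrableOn_ball r).mono_set hr

/-- Correlations of square integrable functions are continuous, since translation is continuous
in `L²`. -/
lemma continuous_integral_mul_translate {a b : Space n → ℂ} (ha : MemLp a 2) (hb : MemLp b 2) :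
    Continuous fun y : Space n => ∫ x, a x * b (y + x) := by
  have : Fact ((2 : ENNReal) ≠ ⊤) := ⟨by norm_num⟩
  have hca : MemLp (fun x => (starRingEnd ℂ) (a x)) 2 := ha.star
  have hc : Continuous fun y : Space n => (DomAddAct.mk y : (Space n)ᵈᵃᵃ) +ᵥ (hb.toLp b) :=
    (DomAddAct.continuous_mk).vadd continuous_const
  have h2 : Continuous fun y : Space n =>
      (inner ℂ (hca.toLp _) ((DomAddAct.mk y : (Space n)ᵈᵃᵃ) +ᵥ (hb.toLp b)) : ℂ) :=
    continuous_const.inner hc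
  refine h2.congr fun y => ?_
  rw [L2.inner_def, DomAddAct.mk_vadd_toLp]
  refine integral_congr_ae ?_
  filter_upwards [hca.coeFn_toLp, (hb.comp_measurePreserving
    (measurePreserving_vadd y volume)).coeFn_toLp] with x h1 h2
  rw [h1]
  erw [h2]
  simp [mul_comm]

/-- Bumps concentrating at the origin. -/
noncomputable def bump (n j : ℕ) : ContDiffBump (0 : Space n) where
  rIn := 1 / (2 * (j + 1))
  rOut := 1 / (j + 1)
  rIn_pos := by positivity
  rIn_lt_rOut := by
    apply one_div_lt_one_div_of_lt (by positivity)
    have : (0 : ℝ) ≤ j := by positivity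
    linarith

/-- The complex-valued mollifier of the `j`-th bump. -/
noncomputable def mollifier (n j : ℕ) (x : Space n) : ℂ := ((bump n j).normed volume x : ℂ)

lemma isTest_mollifier (n j : ℕ) : IsTest (mollifier n j) := by
  refine ⟨Complex.ofRealCLM.contDiff.comp (bump n j).contDiff_normed, ?_⟩
  exact (bump n j).hasCompactSupport_normed.comp_left (g := fun t : ℝ => (t : ℂ)) (by simp)

/-- The mollification of a function. -/
noncomputable def mollify (j : ℕ) (v : Space n → ℂ) (x : Space n) : ℂ :=
  ∫ y, v y * mollifier n j (x - y)

lemma MemL2Loc.contDiff_mollify {v : Space n → ℂ} (hv : MemL2Loc v) (j : ℕ) :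
    ContDiff ℝ ∞ (mollify j v) :=
  (isTest_mollifier n j).2.contDiff_convolution_right (ContinuousLinearMap.mul ℝ ℂ)
    hv.locallyIntegrable (isTest_mollifier n j).1

/-- Mollification commutes with weak derivatives. -/
lemma pd_mollify {w : Space n → ℂ} {g : Fin n → Space n → ℂ} (hw : MemL2Loc w)
    (hg : HasWeakGradient w g) (j : ℕ) (i : Fin n) :
    pd i (mollify j w) = mollify j (g i) := by
  ext x
  have ht := isTest_mollifier n j
  have h1 := ht.2.hasFDerivAt_convolution_right (ContinuousLinearMap.mul ℝ ℂ)
    hw.locallyIntegrable (ht.1.of_le (by norm_cast)) x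
  rw [show convolution w (mollifier n j) (ContinuousLinearMap.mul ℝ ℂ) volume = mollify j w
    from rfl] at h1
  rw [pd, h1.fderiv, convolution_precompR_apply _ hw.locallyIntegrable
    (ht.2.fderiv ℝ) (ht.1.continuous_fderiv (by simp))]
  change ∫ y, w y * pd i (mollifier n j) (x - y) = ∫ y, g i y * mollifier n j (x - y)
  have h2 := hg i _ (ht.comp_sub x)
  have h3 : ∀ y, fderiv ℝ (fun y => mollifier n j (x - y)) y (EuclideanSpace.single i 1)
      = -pd i (mollifier n j) (x - y) := fun y => pd_comp_sub ht.differentiable i x y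
  simp_rw [h3, mul_neg, integral_neg] at h2
  exact neg_inj.1 h2

lemma mollifier_eq_zero (j : ℕ) {x : Space n} (hx : 1 ≤ ‖x‖) : mollifier n j x = 0 := by
  unfold mollifier
  have : x ∉ Function.support ((bump n j).normed volume) := by
    rw [ContDiffBump.support_normed_eq, mem_ball_zero_iff, not_lt]
    refine le_trans ?_ hx
    change 1 / ((j : ℝ) + 1) ≤ 1
    rw [div_le_one (by positivity)]
    have : (0 : ℝ) ≤ j := by positivity
    linarith
  rw [Function.notMem_support.1 this, Complex.ofReal_zero]

/-- Mollifications converge weakly in `L²` on bounded sets. -/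
lemma tendsto_integral_mul_mollify {h v : Space n → ℂ} (hh : MemLp h 2) {r : ℝ}
    (h0 : ∀ x, r ≤ ‖x‖ → h x = 0) (hv : MemL2Loc v) :
    Tendsto (fun j => ∫ x, h x * mollify j v x) atTop (𝓝 (∫ x, h x * v x)) := by
  set v' := (ball (0 : Space n) (r + 1)).indicator v with hv'
  have mv' : MemLp v' 2 := hv.memLp_indicator (r + 1)
  have iv' : Integrable v' := (integrable_indicator_iff measurableSet_ball).2
    (hv.integrableOn_ball _)
  have ih : Integrable h := by
    have e : (ball (0 : Space n) r).indicator h = h := by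
      ext x
      by_cases hx : x ∈ ball (0 : Space n) r
      · simp [indicator_of_mem hx]
      · rw [indicator_of_notMem hx, h0 x (by simpa using hx)]
    rw [← e, integrable_indicator_iff measurableSet_ball]
    exact MemL2Loc.integrableOn_ball (fun s => hh.restrict _) r
  -- By Fubini the pairing is the mollification of the continuous correlation `c`, evaluated at `0`.
  set c : Space n → ℂ := fun z => ∫ x, h x * v' (-z + x) with hc
  have cc : Continuous c := (continuous_integral_mul_translate hh mv').comp continuous_neg
  have hlim : Tendsto (fun j => ∫ z, mollifier n j z * c z) atTop (𝓝 (c 0)) := by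
    have hφ : Tendsto (fun j => (bump n j).rOut) atTop (𝓝 0) := tendsto_one_div_add_atTop_nhds_zero_nat
    have := ContDiffBump.convolution_tendsto_right_of_continuous (μ := volume) hφ
      (cc.comp continuous_neg) 0
    simp only [convolution_def, Function.comp, zero_sub, neg_neg, neg_zero,
      ContinuousLinearMap.lsmul_apply, Complex.real_smul] at this
    exact this
  have hc0 : c 0 = ∫ x, h x * v x := by
    simp only [hc, neg_zero, zero_add]
    congr 1
    ext x
    by_cases hx : x ∈ ball (0 : Space n) r
    · rw [hv', indicator_of_mem (ball_subset_ball (by linarith) hx)]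
    · rw [h0 x (by simpa using hx), zero_mul, zero_mul]
  rw [← hc0]
  refine hlim.congr fun j => ?_
  have ht := isTest_mollifier n j
  obtain ⟨B, hB⟩ := ht.exists_bound
  have hF : Integrable (Function.uncurry fun z x : Space n => mollifier n j z * (h x * v' (-z + x)))
      (volume.prod volume) := by
    have h1 := Integrable.convolution_integrand (ContinuousLinearMap.mul ℝ ℂ) ih iv'.comp_neg
    have h2 := h1.bdd_mul (f := fun p : Space n × Space n => mollifier n j p.1) (c := B)
      (ht.continuous.comp continuous_fst).aestronglyMeasurable
      (Eventually.of_forall fun p => hB p.1)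
    refine h2.congr (Eventually.of_forall fun p => ?_)
    simp only [Function.uncurry, ContinuousLinearMap.mul_apply']
    congr 3
    abel
  calc ∫ z, mollifier n j z * c z
      = ∫ z, ∫ x, mollifier n j z * (h x * v' (-z + x)) := by
        simp_rw [hc, integral_const_mul]
    _ = ∫ x, ∫ z, mollifier n j z * (h x * v' (-z + x)) := integral_integral_swap hF
    _ = ∫ x, h x * mollify j v x := by
        congr 1
        ext x
        by_cases hx : x ∈ ball (0 : Space n) r
        · rw [mollify, ← integral_const_mul,
            ← integral_sub_left_eq_self (fun y => h x * (v y * mollifier n j (x - y))) volume x]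
          congr 1
          ext z
          rw [sub_sub_cancel]
          by_cases hz : 1 ≤ ‖z‖
          · simp [mollifier_eq_zero j hz]
          · have : x - z ∈ ball (0 : Space n) (r + 1) := by
              rw [mem_ball_zero_iff] at hx ⊢
              have := norm_sub_le x z
              linarith
            rw [hv', neg_add_eq_sub, indicator_of_mem this]
            ring
        · simp [h0 x (by simpa using hx)]

/-! ### The flux identity -/

/-- `w` with weak gradient `g` is a weak `H¹_loc` solution of `(Δ + k²) w = -f`. -/
structure WeakSolution (k : ℝ) (w : Space n → ℂ) (g : Fin n → Space n → ℂ)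
    (f : Space n → ℂ) : Prop where
  memL2Loc : MemL2Loc w
  memL2Loc_grad : ∀ i, MemL2Loc (g i)
  hasWeakGradient : HasWeakGradient w g
  memLp : MemLp f 2
  eq : ∀ φ : Space n → ℂ, IsTest φ →
    (∑ i, ∫ x, g i x * pd i φ x) - (k : ℂ) ^ 2 * ∫ x, w x * φ x = ∫ x, f x * φ x

lemma memL2Loc_of_memLp {f : Space n → ℂ} (hf : MemLp f 2) : MemL2Loc f := fun _ => hf.restrict _

lemma MemL2Loc.conj {v : Space n → ℂ} (hv : MemL2Loc v) :
    MemL2Loc fun x => (starRingEnd ℂ) (v x) := fun r => (hv r).star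

/-- Weak convergence of mollifications against a test function times an `L²_loc` function. -/
lemma tendsto_integral_mul_conj_mollify {h v φ : Space n → ℂ} (hh : MemL2Loc h) (hφ : IsTest φ)
    (hv : MemL2Loc v) :
    Tendsto (fun j => ∫ x, h x * φ x * (starRingEnd ℂ) (mollify j v x)) atTop
      (𝓝 (∫ x, h x * φ x * (starRingEnd ℂ) (v x))) := by
  obtain ⟨r, hr, h0⟩ := hφ.exists_radius
  have h1 := tendsto_integral_mul_mollify (r := r) (hh.conj.memLp_mul hφ.conj.continuous
    hφ.conj.2)
    (fun x hx => by simp [h0 x hx]) hv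
  have h2 := (Complex.continuous_conj.tendsto _).comp h1
  rw [← integral_conj] at h2
  have e : ∀ x, (starRingEnd ℂ) ((starRingEnd ℂ) (h x) * (starRingEnd ℂ) (φ x) * v x)
      = h x * φ x * (starRingEnd ℂ) (v x) := fun x => by simp
  simp_rw [e] at h2
  refine h2.congr fun j => ?_
  simp only [Function.comp]
  rw [← integral_conj]
  congr 1
  ext x
  simp

/-- The energy identity obtained by testing the equation with `φ` times the conjugate of the
solution; the latter is approximated by its mollifications. -/
lemma WeakSolution.energy {k : ℝ} {w f : Space n → ℂ} {g : Fin n → Space n → ℂ}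
    (h : WeakSolution k w g f) {φ : Space n → ℂ} (hφ : IsTest φ) :
    ∑ i, ((∫ x, g i x * pd i φ x * (starRingEnd ℂ) (w x))
        + ∫ x, g i x * φ x * (starRingEnd ℂ) (g i x))
      - (k : ℂ) ^ 2 * ∫ x, w x * φ x * (starRingEnd ℂ) (w x)
      = ∫ x, f x * φ x * (starRingEnd ℂ) (w x) := by
  have hw := h.memL2Loc
  have hg := h.memL2Loc_grad
  have hf := memL2Loc_of_memLp h.memLp
  have hL : Tendsto (fun j => ∑ i, ((∫ x, g i x * pd i φ x * (starRingEnd ℂ) (mollify j w x))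
        + ∫ x, g i x * φ x * (starRingEnd ℂ) (mollify j (g i) x))
      - (k : ℂ) ^ 2 * ∫ x, w x * φ x * (starRingEnd ℂ) (mollify j w x)) atTop
      (𝓝 (∑ i, ((∫ x, g i x * pd i φ x * (starRingEnd ℂ) (w x))
        + ∫ x, g i x * φ x * (starRingEnd ℂ) (g i x))
      - (k : ℂ) ^ 2 * ∫ x, w x * φ x * (starRingEnd ℂ) (w x))) := by
    refine Tendsto.sub (tendsto_finsetSum _ fun i _ => ?_) ?_
    · exact (tendsto_integral_mul_conj_mollify (hg i) (hφ.pd i) hw).add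
        (tendsto_integral_mul_conj_mollify (hg i) hφ (hg i))
    · exact (tendsto_integral_mul_conj_mollify hw hφ hw).const_mul _
  have hR := tendsto_integral_mul_conj_mollify hf hφ hw
  refine tendsto_nhds_unique hL (hR.congr fun j => ?_)
  have cW := hw.contDiff_mollify j
  have cW' : ContDiff ℝ ∞ fun x => (starRingEnd ℂ) (mollify j w x) := Complex.conjCLE.contDiff.comp cW
  have dW : Differentiable ℝ (mollify j w) := cW.differentiable (by simp)
  have ht : IsTest fun x => φ x * (starRingEnd ℂ) (mollify j w x) := hφ.mul_right cW'
  have e := h.eq _ ht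
  simp_rw [← mul_assoc] at e
  rw [← e]
  congr 1
  refine Finset.sum_congr rfl fun i _ => ?_
  have c2 : Continuous fun x => (starRingEnd ℂ) (mollify j (g i) x) :=
    Complex.continuous_conj.comp ((hg i).contDiff_mollify j).continuous
  rw [← integral_add ((hg i).integrable_mul_mul (memL2Loc_of_continuous cW'.continuous)
    (hφ.pd i).continuous (hφ.pd i).2)
    ((hg i).integrable_mul_mul (memL2Loc_of_continuous c2) hφ.continuous hφ.2)]
  congr 1
  ext x
  rw [pd_mul hφ.differentiable (cW'.differentiable (by simp)), pd_conj dW,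
    pd_mollify hw h.hasWeakGradient]
  ring

/-! ### Radiating solutions are potentials of their sources -/

/-- The radial defect `(∂ᵣ - ik) w` of a function `w` with gradient `g`. -/
noncomputable def radialDefect (k : ℝ) (w : Space n → ℂ) (g : Fin n → Space n → ℂ)
    (x : Space n) : ℂ :=
  (∑ i, (x i / ‖x‖ : ℝ) * g i x) - Complex.I * k * w x

lemma memL2Loc_radialDefect {w : Space n → ℂ} {g : Fin n → Space n → ℂ} (hw : MemL2Loc w)
    (hg : ∀ i, MemL2Loc (g i)) : MemL2Loc (radialDefect k w g) := by
  intro r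
  refine MemLp.sub (memLp_finsetSum _ fun i _ => ?_) ((hw r).const_mul _)
  refine (hg i r).of_le_mul (c := 1) (AEStronglyMeasurable.mul ?_ (hg i r).1)
    (Eventually.of_forall fun x => ?_)
  · apply Measurable.aestronglyMeasurable
    fun_prop
  · rw [norm_mul, Complex.norm_real]
    refine mul_le_mul_of_nonneg_right ?_ (norm_nonneg _)
    rw [norm_div, norm_norm]
    exact div_le_one_of_le₀ (PiLp.norm_apply_le x i) (norm_nonneg _)

lemma hasCompactSupport_cutFlux_norm {ρ : ℝ} (hρ : 0 < ρ) :
    HasCompactSupport fun x : Space n => (cutFlux ρ ‖x‖ : ℂ) := by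
  refine HasCompactSupport.intro (isCompact_closedBall (0 : Space n) (2 * ρ)) fun x hx => ?_
  have : 2 * ρ < ‖x‖ := by simpa using hx
  simp [cutFlux_eq_zero_of_ge hρ this.le]

lemma integrable_cutFlux_mul_sq {w : Space n → ℂ} (hw : MemL2Loc w) {ρ : ℝ} (hρ : 0 < ρ) :
    Integrable fun x => cutFlux ρ ‖x‖ * ‖w x‖ ^ 2 := by
  have h := (hw.integrable_mul_mul hw.conj (continuous_cutFlux_norm ρ)
    (hasCompactSupport_cutFlux_norm hρ)).norm
  refine h.congr (Eventually.of_forall fun x => ?_)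
  simp only [norm_mul, RCLike.norm_conj, Complex.norm_real,
    Real.norm_of_nonneg (cutFlux_nonneg (norm_nonneg x))]
  ring

lemma integrable_cutFlux_mul_decay (hn : 0 < n) {ρ : ℝ} (hρ : 0 < ρ) :
    Integrable fun x : Space n => cutFlux ρ ‖x‖ * decay n ‖x‖ ^ 2 := by
  refine (integrable_cutFlux_div hρ).congr (Eventually.of_forall fun x => ?_)
  simp only [decay_sq hn (norm_nonneg x)]
  rfl

lemma integral_cutFlux_mul_decay (hn : 0 < n) {ρ : ℝ} (hρ : 0 < ρ) :
    ∫ x : Space n, cutFlux ρ ‖x‖ * decay n ‖x‖ ^ 2 = sphereArea n := by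
  rw [← integral_cutFlux_div hn hρ]
  congr 1
  ext x
  rw [decay_sq hn (norm_nonneg x)]
  rfl

/-- The Sommerfeld condition bounds the radial defect by `ε` times the decay rate. -/
def DefectSmall (k : ℝ) (w : Space n → ℂ) (g : Fin n → Space n → ℂ) : Prop :=
  ∀ ε : ℝ, 0 < ε → ∃ r₀ : ℝ, 0 < r₀ ∧ ∀ᵐ x : Space n, r₀ ≤ ‖x‖ →
    ‖radialDefect k w g x‖ ≤ ε * decay n ‖x‖

/-- Pairing with the flux density: if `|a| ≤ ε r^{-(n-1)/2}` in the region that `cutFlux ρ` sees,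
then `∫ κ_ρ |a| |w| ≤ (ε/2) (|S| + ∫ κ_ρ |w|²)`. -/
lemma norm_integral_cutFlux_le (hn : 0 < n) {w a : Space n → ℂ} (hw : MemL2Loc w) {ε ρ r₀ : ℝ}
    (hε : 0 ≤ ε) (hρ : 0 < ρ) (hρ' : r₀ ≤ ρ)
    (ha : ∀ᵐ x : Space n, r₀ ≤ ‖x‖ → ‖a x‖ ≤ ε * decay n ‖x‖) :
    ‖∫ x, a x * cutFlux ρ ‖x‖ * w x‖
      ≤ ε / 2 * (sphereArea n + ∫ x, cutFlux ρ ‖x‖ * ‖w x‖ ^ 2) := by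
  rw [← integral_cutFlux_mul_decay hn hρ, ← integral_add (integrable_cutFlux_mul_decay hn hρ)
    (integrable_cutFlux_mul_sq hw hρ), ← integral_const_mul]
  refine norm_integral_le_of_norm_le (((integrable_cutFlux_mul_decay hn hρ).add
    (integrable_cutFlux_mul_sq hw hρ)).const_mul _) ?_
  filter_upwards [ha] with x hx
  have hκ := cutFlux_nonneg (ρ := ρ) (norm_nonneg x)
  rw [norm_mul, norm_mul, Complex.norm_real, Real.norm_of_nonneg hκ]
  by_cases hxρ : ‖x‖ ≤ ρ
  · simp [cutFlux_eq_zero_of_le hρ (norm_nonneg _) hxρ]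
  · push Not at hxρ
    have h1 := hx (hρ'.trans hxρ.le)
    have h2 : ‖a x‖ * ‖w x‖ ≤ ε / 2 * (decay n ‖x‖ ^ 2 + ‖w x‖ ^ 2) := by
      have h3 : ‖a x‖ * ‖w x‖ ≤ ε * decay n ‖x‖ * ‖w x‖ := by gcongr
      nlinarith [mul_nonneg hε (sq_nonneg (decay n ‖x‖ - ‖w x‖))]
    nlinarith [mul_le_mul_of_nonneg_left h2 hκ]

/-- The energy of a radiating solution through the sphere of radius `ρ`, averaged with
`cutFlux ρ`, stays bounded: the imaginary part of the energy identity bounds it by the power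
`|∫ f w̄|` supplied by the source. -/
lemma WeakSolution.exists_flux_bound (hn : 0 < n) (hk : 0 < k) {w f : Space n → ℂ}
    {g : Fin n → Space n → ℂ} (h : WeakSolution k w g f) (hrad : DefectSmall k w g) {R : ℝ}
    (hf : ∀ x, R ≤ ‖x‖ → f x = 0) :
    ∃ N ρ₀ : ℝ, 0 ≤ N ∧ 0 < ρ₀ ∧ ∀ ρ, ρ₀ ≤ ρ → ∫ x, cutFlux ρ ‖x‖ * ‖w x‖ ^ 2 ≤ N := by
  have hw := h.memL2Loc
  have hg := h.memL2Loc_grad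
  have hω := sphereArea_pos hn
  obtain ⟨r₀, hr₀, hr⟩ := hrad k hk
  set B := ∫ x, f x * (starRingEnd ℂ) (w x) with hB
  refine ⟨2 * ‖B‖ / k + sphereArea n, max r₀ R, by positivity,
    lt_max_of_lt_left hr₀, fun ρ hρ => ?_⟩
  have hρ1 : r₀ ≤ ρ := (le_max_left _ _).trans hρ
  have hρ2 : R ≤ ρ := (le_max_right _ _).trans hρ
  have hρ0 : 0 < ρ := hr₀.trans_le hρ1
  have hχ := isTest_cut (n := n) hρ0
  have he := h.energy hχ
  set N := ∫ x, cutFlux ρ ‖x‖ * ‖w x‖ ^ 2 with hN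
  set A := ∫ x, radialDefect k w g x * cutFlux ρ ‖x‖ * (starRingEnd ℂ) (w x) with hA
  -- replace the radial derivative in the flux by `ik w` plus the radial defect
  have e1 : ∑ i, ∫ x, g i x * pd i (fun x => (cut ρ ‖x‖ : ℂ)) x * (starRingEnd ℂ) (w x)
      = -A - Complex.I * k * N := by
    have hNc : (N : ℂ) = ∫ x, w x * cutFlux ρ ‖x‖ * (starRingEnd ℂ) (w x) := by
      rw [hN, ← integral_complex_ofReal]
      congr 1
      ext x
      rw [mul_right_comm, Complex.mul_conj']
      push_cast
      ring
    rw [hNc, ← integral_finsetSum _ fun i _ => (hg i).integrable_mul_mul hw.conj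
      (hχ.pd i).continuous (hχ.pd i).2, ← integral_const_mul, hA, ← neg_add',
      ← integral_add ((memL2Loc_radialDefect hw hg).integrable_mul_mul hw.conj
      (continuous_cutFlux_norm ρ) (hasCompactSupport_cutFlux_norm hρ0))
      ((hw.integrable_mul_mul hw.conj (continuous_cutFlux_norm ρ)
      (hasCompactSupport_cutFlux_norm hρ0)).const_mul _), ← integral_neg]
    congr 1
    ext x
    have e2 : ∑ i, g i x * pd i (fun x => (cut ρ ‖x‖ : ℂ)) x * (starRingEnd ℂ) (w x)
        = -((∑ i, (x i / ‖x‖ : ℝ) * g i x) * cutFlux ρ ‖x‖ * (starRingEnd ℂ) (w x)) := by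
      rw [Finset.sum_mul, Finset.sum_mul, ← Finset.sum_neg_distrib]
      refine Finset.sum_congr rfl fun i _ => ?_
      rw [pd_cut hρ0]
      push_cast
      ring
    rw [e2]
    simp only [radialDefect]
    ring
  have e3 : ∀ v : Space n → ℂ, ∫ x, v x * (cut ρ ‖x‖ : ℂ) * (starRingEnd ℂ) (v x)
      = ((∫ x, cut ρ ‖x‖ * ‖v x‖ ^ 2 : ℝ) : ℂ) := by
    intro v
    rw [← integral_complex_ofReal]
    congr 1
    ext x
    rw [mul_right_comm, Complex.mul_conj']
    push_cast
    ring
  have e4 : ∫ x, f x * (cut ρ ‖x‖ : ℂ) * (starRingEnd ℂ) (w x) = B := by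
    rw [hB]
    congr 1
    ext x
    by_cases hx : R ≤ ‖x‖
    · simp [hf x hx]
    · push Not at hx
      rw [cut_eq_one hρ0 (norm_nonneg _) (by linarith)]
      simp
  simp_rw [e3] at he
  rw [Finset.sum_add_distrib, e1, e4] at he
  -- the volume terms are real and drop out of the imaginary part
  have him := congrArg Complex.im he
  have e5 : (Complex.I * k * N).im = k * N := by simp
  simp only [Complex.sub_im, Complex.add_im, Complex.neg_im, ← Complex.ofReal_sum,
    Complex.ofReal_im, ← Complex.ofReal_pow, Complex.im_ofReal_mul, e5, mul_zero, sub_zero,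
    add_zero] at him
  have hA' := norm_integral_cutFlux_le hn hw.conj hk.le hρ0 hρ1 hr
  simp only [RCLike.norm_conj] at hA'
  rw [← hA, ← hN] at hA'
  have h1 := abs_le.1 (Complex.abs_im_le_norm A)
  have h2 := abs_le.1 (Complex.abs_im_le_norm B)
  have h3 : k * N ≤ ‖B‖ + k / 2 * (sphereArea n + N) := by linarith
  have h4 : N ≤ 2 * ‖B‖ / k + sphereArea n := by
    rw [← sub_le_iff_le_add, le_div_iff₀ hk]
    linarith
  exact h4

/-- Green's second identity for a weak solution and the potential of a test function, localised
by a cut-off at scale `ρ`. -/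
lemma WeakSolution.green {w f : Space n → ℂ} {g : Fin n → Space n → ℂ}
    (h : WeakSolution k w g f) (hG : OutgoingProfile n k G G') (hn : 2 ≤ n) {ψ : Space n → ℂ}
    (hψ : IsTest ψ) {ρ : ℝ} (hρ : 0 < ρ) :
    (∫ x, f x * (cut ρ ‖x‖ * potential G ψ x)) - ∫ x, w x * (cut ρ ‖x‖ * ψ x)
      = (∫ x, radialDefect k (potential G ψ) (fun i => pd i (potential G ψ)) x
          * cutFlux ρ ‖x‖ * w x)
        - ∫ x, radialDefect k w g x * cutFlux ρ ‖x‖ * potential G ψ x := by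
  have hn0 : 0 < n := by omega
  have hw := h.memL2Loc
  have hg := h.memL2Loc_grad
  set W := potential G ψ with hW
  set χ : Space n → ℂ := fun x => (cut ρ ‖x‖ : ℂ) with hχ'
  have hχ : IsTest χ := isTest_cut hρ
  have cW : ContDiff ℝ ∞ W := hG.contDiff_potential hn0 hψ
  have dW : Differentiable ℝ W := cW.differentiable (by simp)
  have cWi := contDiff_pd cW
  have cWii := fun i => contDiff_pd (cWi i) i
  have lW : MemL2Loc W := memL2Loc_of_continuous cW.continuous
  have lWi : ∀ i, MemL2Loc (pd i W) := fun i => memL2Loc_of_continuous (cWi i).continuous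
  have lWii : ∀ i, MemL2Loc (pd i (pd i W)) := fun i => memL2Loc_of_continuous (cWii i).continuous
  have ia : ∀ i, Integrable fun x => g i x * pd i χ x * W x := fun i =>
    (hg i).integrable_mul_mul lW (hχ.pd i).continuous (hχ.pd i).2
  have ib : ∀ i, Integrable fun x => g i x * χ x * pd i W x := fun i =>
    (hg i).integrable_mul_mul (lWi i) hχ.continuous hχ.2
  have ic : ∀ i, Integrable fun x => w x * pd i χ x * pd i W x := fun i =>
    hw.integrable_mul_mul (lWi i) (hχ.pd i).continuous (hχ.pd i).2
  have id : ∀ i, Integrable fun x => w x * χ x * pd i (pd i W) x := fun i =>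
    hw.integrable_mul_mul (lWii i) hχ.continuous hχ.2
  have im : Integrable fun x => w x * χ x * W x := hw.integrable_mul_mul lW hχ.continuous hχ.2
  have ip : Integrable fun x => w x * χ x * ψ x :=
    hw.integrable_mul_mul (memL2Loc_of_continuous hψ.continuous) hχ.continuous hχ.2
  -- test the equation of `w` with `χ W`, and the weak gradient of `w` with `χ ∂ᵢW`
  have h1 := h.eq _ (hχ.mul_right cW)
  have h1' : ∀ i, ∫ x, g i x * pd i (fun x => χ x * W x) x
      = (∫ x, g i x * pd i χ x * W x) + ∫ x, g i x * χ x * pd i W x := fun i => by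
    rw [← integral_add (ia i) (ib i)]
    congr 1
    ext x
    rw [pd_mul hχ.differentiable dW]
    ring
  simp_rw [h1'] at h1
  rw [Finset.sum_add_distrib] at h1
  have h2 : ∀ i, (∫ x, w x * pd i χ x * pd i W x) + ∫ x, w x * χ x * pd i (pd i W) x
      = - ∫ x, g i x * χ x * pd i W x := fun i => by
    have h3 := h.hasWeakGradient i _ (hχ.mul_right (cWi i))
    rw [← integral_add (ic i) (id i)]
    simp_rw [← mul_assoc] at h3
    rw [← h3]
    congr 1
    ext x
    have := pd_mul hχ.differentiable ((cWi i).differentiable (by simp)) i x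
    unfold pd at this ⊢
    rw [this]
    ring
  -- the equation `(Δ + k²) W = -ψ` of the potential
  have h4 : ∑ i, ∫ x, w x * χ x * pd i (pd i W) x
      = -(∫ x, w x * χ x * ψ x) - (k : ℂ) ^ 2 * ∫ x, w x * χ x * W x := by
    rw [← integral_finsetSum _ fun i _ => id i, ← integral_const_mul, ← neg_add',
      ← integral_add ip (im.const_mul _), ← integral_neg]
    congr 1
    ext x
    rw [← Finset.mul_sum]
    have := hG.helmholtz_potential hn hψ x
    rw [← hW] at this
    linear_combination (w x * χ x) * this
  -- the contributions `ik w W` of the two radial derivatives cancel, which leaves the defects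
  have h5 : ∑ i, ((∫ x, g i x * pd i χ x * W x) - ∫ x, w x * pd i χ x * pd i W x)
      = (∫ x, radialDefect k W (fun i => pd i W) x * cutFlux ρ ‖x‖ * w x)
        - ∫ x, radialDefect k w g x * cutFlux ρ ‖x‖ * W x := by
    simp_rw [fun i => (integral_sub (ia i) (ic i)).symm]
    have iac : ∀ i, Integrable fun x => g i x * pd i χ x * W x - w x * pd i χ x * pd i W x :=
      fun i => (ia i).sub (ic i)
    rw [← integral_finsetSum _ fun i _ => iac i,
      ← integral_sub ((memL2Loc_radialDefect lW lWi).integrable_mul_mul hw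
        (continuous_cutFlux_norm ρ) (hasCompactSupport_cutFlux_norm hρ))
      ((memL2Loc_radialDefect hw hg).integrable_mul_mul lW
        (continuous_cutFlux_norm ρ) (hasCompactSupport_cutFlux_norm hρ))]
    congr 1
    ext x
    simp only [radialDefect, sub_mul, Finset.sum_mul]
    have e : ∀ i, g i x * pd i χ x * W x - w x * pd i χ x * pd i W x
        = (x i / ‖x‖ : ℝ) * pd i W x * cutFlux ρ ‖x‖ * w x
          - (x i / ‖x‖ : ℝ) * g i x * cutFlux ρ ‖x‖ * W x := fun i => by
      rw [hχ', pd_cut hρ]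
      push_cast
      ring
    simp_rw [e]
    rw [Finset.sum_sub_distrib]
    ring
  have h6 : ∑ i, ((∫ x, w x * pd i χ x * pd i W x) + ∫ x, w x * χ x * pd i (pd i W) x)
      = ∑ i, - ∫ x, g i x * χ x * pd i W x := Finset.sum_congr rfl fun i _ => h2 i
  rw [Finset.sum_add_distrib, Finset.sum_neg_distrib, h4] at h6
  rw [← h5, Finset.sum_sub_distrib, ← h1]
  simp_rw [← mul_assoc]
  linear_combination h6

/-- A radiating weak solution of `(Δ + k²) w = -f` with compactly supported `f` is, in the weak
sense, the potential of `f`. -/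
theorem WeakSolution.integral_mul_eq (hn : 2 ≤ n) (hk : 0 < k) {w f : Space n → ℂ}
    {g : Fin n → Space n → ℂ} (h : WeakSolution k w g f) (hrad : DefectSmall k w g) {R : ℝ}
    (hf : ∀ x, R ≤ ‖x‖ → f x = 0) (hG : OutgoingProfile n k G G') {ψ : Space n → ℂ}
    (hψ : IsTest ψ) : ∫ x, w x * ψ x = ∫ x, f x * potential G ψ x := by
  have hn0 : 0 < n := by omega
  have hω := sphereArea_pos hn0
  obtain ⟨N, ρ₀, hN, hρ₀, hflux⟩ := h.exists_flux_bound hn0 hk hrad hf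
  obtain ⟨C, r₁, hC, hr₁, hWb⟩ := hG.norm_potential_le hn0 hψ
  obtain ⟨r₂, hr₂, hψ0⟩ := hψ.exists_radius
  set W := potential G ψ with hW
  have cW : Continuous W := (hG.contDiff_potential hn0 hψ).continuous
  have hle : ∀ ε : ℝ, 0 < ε → ‖(∫ x, f x * W x) - ∫ x, w x * ψ x‖
      ≤ ε * (sphereArea n + N + sphereArea n + C ^ 2 * sphereArea n) := by
    intro ε hε
    obtain ⟨r₃, hr₃, hb⟩ := hG.radiating_potential hn0 hψ hε
    obtain ⟨r₄, hr₄, hd⟩ := hrad ε hε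
    -- a scale at which all asymptotic bounds hold and the cut-off is `1` on the supports of `f` and `ψ`
    set ρ := max ρ₀ (max r₁ (max r₂ (max r₃ (max r₄ R)))) with hρ
    have l0 : ρ₀ ≤ ρ := by simp [hρ]
    have l1 : r₁ ≤ ρ := by simp [hρ]
    have l2 : r₂ ≤ ρ := by simp [hρ]
    have l3 : r₃ ≤ ρ := by simp [hρ]
    have l4 : r₄ ≤ ρ := by simp [hρ]
    have l5 : R ≤ ρ := by simp [hρ]
    have hρ0 : 0 < ρ := hρ₀.trans_le l0
    have hg := h.green hG hn hψ hρ0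
    rw [← hW] at hg
    have e1 : ∫ x, f x * (cut ρ ‖x‖ * W x) = ∫ x, f x * W x := by
      congr 1
      ext x
      by_cases hx : R ≤ ‖x‖
      · simp [hf x hx]
      · push Not at hx
        rw [cut_eq_one hρ0 (norm_nonneg _) (by linarith)]
        simp
    have e2 : ∫ x, w x * (cut ρ ‖x‖ * ψ x) = ∫ x, w x * ψ x := by
      congr 1
      ext x
      by_cases hx : r₂ ≤ ‖x‖
      · simp [hψ0 x hx]
      · push Not at hx
        rw [cut_eq_one hρ0 (norm_nonneg _) (by linarith)]
        simp
    rw [← e1, ← e2, hg]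
    have b1 := norm_integral_cutFlux_le hn0 h.memL2Loc hε.le hρ0 l3
      (a := radialDefect k W fun i => pd i W) (Eventually.of_forall fun x hx => hb x hx)
    have b2 := norm_integral_cutFlux_le hn0 (memL2Loc_of_continuous cW) hε.le hρ0 l4 hd
    -- the averaged energy of the potential is bounded by its pointwise decay
    have b3 : ∫ x, cutFlux ρ ‖x‖ * ‖W x‖ ^ 2 ≤ C ^ 2 * sphereArea n := by
      rw [← integral_cutFlux_mul_decay hn0 hρ0, ← integral_const_mul]
      refine integral_mono (integrable_cutFlux_mul_sq (memL2Loc_of_continuous cW) hρ0)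
        ((integrable_cutFlux_mul_decay hn0 hρ0).const_mul _) fun x => ?_
      have hκ := cutFlux_nonneg (ρ := ρ) (norm_nonneg x)
      by_cases hx : ‖x‖ ≤ ρ
      · simp [cutFlux_eq_zero_of_le hρ0 (norm_nonneg _) hx]
      · push Not at hx
        have h1 := hWb x (by linarith)
        calc cutFlux ρ ‖x‖ * ‖W x‖ ^ 2 ≤ cutFlux ρ ‖x‖ * (C * decay n ‖x‖) ^ 2 := by gcongr
          _ = _ := by ring
    have b4 := hflux ρ l0
    refine (norm_sub_le _ _).trans ((add_le_add b1 b2).trans ?_)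
    have b5 : 0 ≤ C ^ 2 * sphereArea n := by positivity
    nlinarith
  set K := sphereArea n + N + sphereArea n + C ^ 2 * sphereArea n with hK
  have hK0 : 0 < K := by positivity
  have hz : ‖(∫ x, f x * W x) - ∫ x, w x * ψ x‖ ≤ 0 := by
    refine le_of_forall_pos_le_add fun δ hδ => ?_
    have := hle (δ / K) (by positivity)
    rw [div_mul_cancel₀ _ hK0.ne'] at this
    linarith
  exact (sub_eq_zero.1 (norm_le_zero_iff.1 hz)).symm

/-! ### Plane waves and scattered fields -/

lemma IsUnitPlaneWave.continuous {ui : Space n → ℂ} (h : IsUnitPlaneWave k ui) :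
    Continuous ui := by
  obtain ⟨c, d, -, -, hu⟩ := h
  rw [funext hu]
  fun_prop

lemma IsUnitPlaneWave.norm_eq_one {ui : Space n → ℂ} (h : IsUnitPlaneWave k ui) (x : Space n) :
    ‖ui x‖ = 1 := by
  obtain ⟨c, d, hc, -, hu⟩ := h
  rw [hu, norm_mul, hc, one_mul,
    show Complex.I * k * ((inner ℝ x d : ℝ) : ℂ) = ((k * inner ℝ x d : ℝ) : ℂ) * Complex.I by
      push_cast; ring, Complex.norm_exp_ofReal_mul_I]

lemma IsUnitPlaneWave.norm_sub_le {ui : Space n → ℂ} (h : IsUnitPlaneWave k ui) (hk : 0 < k)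
    (x : Space n) : ‖ui x - ui 0‖ ≤ k * ‖x‖ := by
  obtain ⟨c, d, hc, hd, hu⟩ := h
  rw [hu, hu, ← mul_sub, norm_mul, hc, one_mul]
  have e : Complex.I * k * ((inner ℝ x d : ℝ) : ℂ) = Complex.I * ((k * inner ℝ x d : ℝ) : ℂ) := by
    push_cast
    ring
  have h1 := Real.norm_exp_I_mul_ofReal_sub_one_le (x := k * inner ℝ x d)
  rw [e]
  simp only [inner_zero_left, Complex.ofReal_zero, mul_zero, Complex.exp_zero]
  refine h1.trans ?_
  rw [norm_mul, Real.norm_of_nonneg hk.le]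
  gcongr
  have := norm_inner_le_norm (𝕜 := ℝ) x d
  rwa [hd, mul_one] at this

/-- A plane wave solves the free Helmholtz equation in the sense of distributions. -/
lemma IsUnitPlaneWave.integral_mul {ui : Space n → ℂ} (h : IsUnitPlaneWave k ui)
    {φ : Space n → ℂ} (hφ : IsTest φ) :
    ∑ i, ∫ x, ui x * pd i (pd i φ) x = -(k : ℂ) ^ 2 * ∫ x, ui x * φ x := by
  have hc := h.continuous
  obtain ⟨c, d, -, hd, hu⟩ := h
  have hder : ∀ (i : Fin n) (x : Space n), HasLineDerivAt ℝ ui (Complex.I * k * d i * ui x) x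
      (EuclideanSpace.single i 1) := by
    intro i x
    have h1 : HasFDerivAt (fun x : Space n => inner ℝ x d) (innerSL ℝ d) x := by
      simpa [real_inner_comm] using (innerSL ℝ d).hasFDerivAt (x := x)
    have h2 := ((Complex.ofRealCLM.hasFDerivAt.comp x h1).const_mul (Complex.I * k)).cexp.const_mul c
    have h3 := h2.hasLineDerivAt (EuclideanSpace.single i 1)
    rw [funext hu]
    convert! h3 using 1
    simp [EuclideanSpace.inner_single_right]
    ring
  have hder2 : ∀ (i : Fin n) (x : Space n), HasLineDerivAt ℝ
      (fun x => Complex.I * k * d i * ui x)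
      (Complex.I * k * d i * (Complex.I * k * d i * ui x)) x (EuclideanSpace.single i 1) :=
    fun i x => (hder i x).const_mul _
  have h1 : ∀ i, ∫ x, ui x * pd i (pd i φ) x
      = -(k : ℂ) ^ 2 * (d i * d i) * ∫ x, ui x * φ x := fun i => by
    rw [integral_mul_pd_eq_neg hc (continuous_const.mul hc) (hder i) (hφ.pd i),
      integral_mul_pd_eq_neg (continuous_const.mul hc) (continuous_const.mul
        (continuous_const.mul hc)) (hder2 i) hφ, neg_neg, ← integral_const_mul]
    congr 1
    ext x
    simp only [Pi.mul_apply]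
    linear_combination (k ^ 2 * d i * d i * ui x * φ x : ℂ) * Complex.I_sq
  simp_rw [h1]
  rw [← Finset.sum_mul, ← Finset.mul_sum]
  have h2 : (∑ i, (d i : ℂ) * d i) = 1 := by
    have := sum_sq_eq d
    rw [hd] at this
    exact_mod_cast this.trans (one_pow 2)
  rw [h2, mul_one]

/-- The source `k² V u` of the scattered field, for a potential supported in `B_R`. -/
noncomputable def source (k R : ℝ) (V u : Space n → ℂ) (x : Space n) : ℂ :=
  (k : ℂ) ^ 2 * (ball (0 : Space n) R).indicator V x * u x

lemma source_eq_zero {R : ℝ} {V u : Space n → ℂ} {x : Space n} (hx : R ≤ ‖x‖) :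
    source k R V u x = 0 := by
  have : x ∉ ball (0 : Space n) R := by simpa using hx
  simp [source, indicator_of_notMem this]

lemma ae_norm_indicator_le {R : ℝ} {V : Space n → ℂ}
    (hV : MemLp V ⊤ (volume.restrict (ball (0 : Space n) R))) :
    ∀ᵐ x, ‖(ball (0 : Space n) R).indicator V x‖
      ≤ (eLpNorm V ⊤ (volume.restrict (ball (0 : Space n) R))).toReal := by
  have h1 : ∀ᵐ x ∂(volume.restrict (ball (0 : Space n) R)),
      ‖V x‖ ≤ (eLpNorm V ⊤ (volume.restrict (ball (0 : Space n) R))).toReal := by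
    have h2 := ae_le_eLpNormEssSup (f := V) (μ := volume.restrict (ball (0 : Space n) R))
    filter_upwards [h2] with x hx
    rw [← eLpNorm_exponent_top] at hx
    have := ENNReal.toReal_mono hV.2.ne hx
    simpa using this
  rw [ae_restrict_iff' measurableSet_ball] at h1
  filter_upwards [h1] with x hx
  by_cases hxR : x ∈ ball (0 : Space n) R
  · rw [indicator_of_mem hxR]
    exact hx hxR
  · rw [indicator_of_notMem hxR]
    simp

lemma memLp_source {R : ℝ} {V u : Space n → ℂ}
    (hV : MemLp V ⊤ (volume.restrict (ball (0 : Space n) R))) (hu : MemL2Loc u) :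
    MemLp (source k R V u) 2 := by
  set Q := (eLpNorm V ⊤ (volume.restrict (ball (0 : Space n) R))).toReal with hQ
  have e : source k R V u = fun x => (k : ℂ) ^ 2 * (ball (0 : Space n) R).indicator V x *
      (ball (0 : Space n) R).indicator u x := by
    ext x
    by_cases hxR : x ∈ ball (0 : Space n) R
    · simp [source, indicator_of_mem hxR]
    · simp [source, indicator_of_notMem hxR]
  rw [e]
  have hm : AEStronglyMeasurable ((ball (0 : Space n) R).indicator V) volume :=
    (aestronglyMeasurable_indicator_iff measurableSet_ball).2 hV.1
  refine (hu.memLp_indicator R).of_le_mul (c := k ^ 2 * Q)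
    ((hm.const_mul _).mul (hu.memLp_indicator R).1) ?_
  filter_upwards [ae_norm_indicator_le hV] with x hx
  rw [norm_mul, norm_mul, norm_pow, Complex.norm_real, Real.norm_eq_abs, sq_abs]
  gcongr

lemma MemH1Loc.memL2Loc {u : Space n → ℂ} (h : MemH1Loc u) : MemL2Loc u := by
  obtain ⟨g, hg⟩ := h
  exact hg.1

/-- The scattered field of a total field is a weak solution with source `k² V u`. -/
lemma IsTotalField.weakSolution {R : ℝ} {V ui u : Space n → ℂ}
    (hV : MemLp V ⊤ (volume.restrict (ball (0 : Space n) R))) (hui : IsUnitPlaneWave k ui)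
    (h : IsTotalField k ((ball (0 : Space n) R).indicator V) ui u)
    {g : Fin n → Space n → ℂ} (hg : IsH1LocWith (fun x => u x - ui x) g) :
    WeakSolution k (fun x => u x - ui x) g (source k R V u) := by
  have hu := h.memH1Loc.memL2Loc
  have hui' := memL2Loc_of_continuous hui.continuous
  have hf := memLp_source (k := k) hV hu
  refine ⟨hg.1, hg.2.1, hg.2.2, hf, fun φ hφ => ?_⟩
  have h1 := h.helmholtz φ hφ
  have h2 := hui.integral_mul hφ
  have iu : ∀ i, Integrable fun x => u x * pd i (pd i φ) x := fun i =>
    hu.integrable_mul ((hφ.pd i).pd i).continuous ((hφ.pd i).pd i).2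
  have iui : ∀ i, Integrable fun x => ui x * pd i (pd i φ) x := fun i =>
    hui'.integrable_mul ((hφ.pd i).pd i).continuous ((hφ.pd i).pd i).2
  have iu0 := hu.integrable_mul hφ.continuous hφ.2
  have iui0 := hui'.integrable_mul hφ.continuous hφ.2
  have if0 := (memL2Loc_of_memLp hf).integrable_mul hφ.continuous hφ.2
  have iuf : Integrable fun x => (k : ℂ) ^ 2 * (u x * φ x) + source k R V u x * φ x :=
    (iu0.const_mul _).add if0
  have h3 : ∫ x, u x * (Δ φ x + (k : ℂ) ^ 2 * (1 + (ball (0 : Space n) R).indicator V x) * φ x)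
      = (∑ i, ∫ x, u x * pd i (pd i φ) x) + ((k : ℂ) ^ 2 * (∫ x, u x * φ x)
        + ∫ x, source k R V u x * φ x) := by
    rw [← integral_finsetSum _ fun i _ => iu i, ← integral_const_mul,
      ← integral_add (iu0.const_mul _) if0,
      ← integral_add (integrable_finsetSum _ fun i _ => iu i) iuf]
    congr 1
    ext x
    rw [laplacian_eq_sum_pd (hφ.1.of_le (by norm_cast)), ← Finset.mul_sum]
    simp only [source]
    ring
  have h4 : ∀ i, (∫ x, u x * pd i (pd i φ) x) - ∫ x, ui x * pd i (pd i φ) x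
      = - ∫ x, g i x * pd i φ x := fun i => by
    rw [← integral_sub (iu i) (iui i)]
    have := hg.2.2 i _ (hφ.pd i)
    rw [← this]
    congr 1
    ext x
    rw [← sub_mul]
    rfl
  have h5 : ∫ x, (u x - ui x) * φ x = (∫ x, u x * φ x) - ∫ x, ui x * φ x := by
    rw [← integral_sub iu0 iui0]
    congr 1
    ext x
    ring
  have h6 : ∑ i, ((∫ x, u x * pd i (pd i φ) x) - ∫ x, ui x * pd i (pd i φ) x)
      = ∑ i, - ∫ x, g i x * pd i φ x := Finset.sum_congr rfl fun i _ => h4 i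
  rw [Finset.sum_sub_distrib, Finset.sum_neg_distrib, h2] at h6
  rw [h3] at h1
  rw [h5]
  linear_combination h6 - h1

lemma defectSmall_of_bound {w : Space n → ℂ} {g : Fin n → Space n → ℂ}
    (h : ∀ ε : ℝ, 0 < ε → ∃ r₀ : ℝ, 0 < r₀ ∧ ∀ᵐ x : Space n, r₀ ≤ ‖x‖ →
      ‖x‖ ^ (((n : ℝ) - 1) / 2) *
        ‖(∑ i, ((x i / ‖x‖ : ℝ) : ℂ) * g i x) - Complex.I * (k : ℂ) * w x‖ ≤ ε) :
    DefectSmall k w g := by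
  intro ε hε
  obtain ⟨r₀, hr₀, hae⟩ := h ε hε
  refine ⟨r₀, hr₀, ?_⟩
  filter_upwards [hae] with x hx hxr
  have hx0 : 0 < ‖x‖ := hr₀.trans_le hxr
  have h1 := hx hxr
  have h2 := rpow_mul_decay (n := n) hx0
  have h3 := decay_pos (n := n) hx0
  calc ‖radialDefect k w g x‖
      = (‖x‖ ^ (((n : ℝ) - 1) / 2) * ‖radialDefect k w g x‖) * decay n ‖x‖ := by
        rw [mul_right_comm, h2, one_mul]
    _ ≤ ε * decay n ‖x‖ := mul_le_mul_of_nonneg_right h1 h3.le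

/-! ### The Lippmann–Schwinger equation -/

/-- The potential of a source in `B_R`, with the kernel cut off outside `B_{2R}`; the cut-off
has no effect on its values in `B_R`. -/
noncomputable def localPotential (G : ℝ → ℂ) (R : ℝ) (f : Space n → ℂ) (x : Space n) : ℂ :=
  ∫ y, f y * (ball (0 : Space n) (2 * R)).indicator (fun z => G ‖z‖) (x - y)

lemma OutgoingProfile.continuous_localPotential (hG : OutgoingProfile n k G G') (hn : 0 < n)
    (R : ℝ) {f : Space n → ℂ} (hf : MemLp f 2) : Continuous (localPotential G R f) := by
  have h1 : MemLp (fun z : Space n => (ball (0 : Space n) (2 * R)).indicator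
      (fun z => G ‖z‖) (-z)) 2 :=
    (hG.memLp_ball hn (2 * R)).comp_measurePreserving (Measure.measurePreserving_neg volume)
  have h2 := (continuous_integral_mul_translate hf h1).comp continuous_neg
  refine h2.congr fun x => ?_
  simp only [Function.comp, localPotential]
  congr 1
  ext y
  congr 2
  abel

/-- A function agreeing weakly with the potential of `f` agrees with it almost everywhere in
`B_R`. -/
lemma OutgoingProfile.ae_eq_localPotential (hG : OutgoingProfile n k G G') (hn : 0 < n)
    {R : ℝ} {w f : Space n → ℂ} (hw : MemL2Loc w) (hf : MemLp f 2)
    (hf0 : ∀ x, R ≤ ‖x‖ → f x = 0)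
    (hweak : ∀ ψ, IsTest ψ → ∫ x, w x * ψ x = ∫ x, f x * potential G ψ x) :
    ∀ᵐ x, x ∈ ball (0 : Space n) R → w x = localPotential G R f x := by
  set K := (ball (0 : Space n) (2 * R)).indicator (fun z => G ‖z‖) with hK
  have cp := hG.continuous_localPotential hn R hf
  have lp := memL2Loc_of_continuous cp
  have iK : Integrable K := hG.integrable_ball hn (2 * R)
  have iF : Integrable f := by
    have e : (ball (0 : Space n) R).indicator f = f := by
      ext x
      by_cases hx : x ∈ ball (0 : Space n) R
      · simp [indicator_of_mem hx]
      · rw [indicator_of_notMem hx, hf0 x (by simpa using hx)]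
    rw [← e, integrable_indicator_iff measurableSet_ball]
    exact (memL2Loc_of_memLp hf).integrableOn_ball R
  have key := isOpen_ball.ae_eq_zero_of_integral_contDiff_smul_eq_zero
    (f := fun x => w x - localPotential G R f x) (U := ball (0 : Space n) R) (μ := volume)
    ((hw.locallyIntegrable.sub lp.locallyIntegrable).locallyIntegrableOn _) ?_
  · filter_upwards [key] with x hx hxR
    exact sub_eq_zero.1 (hx hxR)
  intro η hη hηc hηR
  set ψ : Space n → ℂ := fun x => (η x : ℂ) with hψ'
  have hψ : IsTest ψ :=
    ⟨Complex.ofRealCLM.contDiff.comp hη, hηc.comp_left (g := fun t : ℝ => (t : ℂ)) (by simp)⟩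
  have hψ0 : ∀ x, x ∉ ball (0 : Space n) R → ψ x = 0 := fun x hx => by
    rw [hψ']
    simp only
    rw [image_eq_zero_of_notMem_tsupport fun h => hx (hηR h), Complex.ofReal_zero]
  have e1 : ∫ x, η x • (w x - localPotential G R f x)
      = (∫ x, w x * ψ x) - ∫ x, localPotential G R f x * ψ x := by
    rw [← integral_sub (hw.integrable_mul hψ.continuous hψ.2)
      (lp.integrable_mul hψ.continuous hψ.2)]
    congr 1
    ext x
    rw [Complex.real_smul]
    ring
  rw [e1, hweak ψ hψ, sub_eq_zero]
  obtain ⟨B, hB⟩ := hψ.exists_bound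
  have hF : Integrable (Function.uncurry fun x y : Space n => ψ x * (f y * K (x - y)))
      (volume.prod volume) := by
    have h1 := Integrable.convolution_integrand (ContinuousLinearMap.mul ℝ ℂ) iF iK
    exact h1.bdd_mul (f := fun p : Space n × Space n => ψ p.1) (c := B)
      (hψ.continuous.comp continuous_fst).aestronglyMeasurable
      (Eventually.of_forall fun p => hB p.1)
  have e2 : ∫ x, localPotential G R f x * ψ x = ∫ x, ∫ y, ψ x * (f y * K (x - y)) := by
    congr 1
    ext x
    rw [localPotential, integral_const_mul, mul_comm]
  -- for `y` in `B_R`, only `x` in `B_R` contribute, where the cut-off of the kernel is invisible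
  rw [e2, integral_integral_swap hF]
  congr 1
  ext y
  by_cases hy : y ∈ ball (0 : Space n) R
  · rw [potential, ← integral_const_mul,
      ← integral_sub_left_eq_self (fun z => f y * (G ‖z‖ * ψ (y - z))) volume y]
    congr 1
    ext x
    rw [sub_sub_cancel]
    by_cases hx : x ∈ ball (0 : Space n) R
    · have hxy : x - y ∈ ball (0 : Space n) (2 * R) := by
        rw [mem_ball_zero_iff] at hx hy ⊢
        have := norm_sub_le x y
        linarith
      rw [hK, indicator_of_mem hxy, norm_sub_rev]
      ring
    · rw [hψ0 x hx]
      ring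
  · have : f y = 0 := hf0 y (by simpa using hy)
    simp [this]

/-- In `B_R` the total field agrees almost everywhere with the continuous function
`uⁱ + Φ * (k² V u)`. -/
lemma IsTotalField.ae_eq {R : ℝ} (hn : 2 ≤ n) (hk : 0 < k) {V ui u : Space n → ℂ}
    (hV : MemLp V ⊤ (volume.restrict (ball (0 : Space n) R))) (hui : IsUnitPlaneWave k ui)
    (h : IsTotalField k ((ball (0 : Space n) R).indicator V) ui u)
    (hG : OutgoingProfile n k G G') :
    ∀ᵐ x, x ∈ ball (0 : Space n) R → u x = ui x + localPotential G R (source k R V u) x := by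
  obtain ⟨g, hg, hrad⟩ := h.radiating
  have hws := h.weakSolution hV hui hg
  have h1 := hG.ae_eq_localPotential (by omega) hg.1 hws.memLp
    (fun x hx => source_eq_zero hx) fun ψ hψ => hws.integral_mul_eq hn hk
      (defectSmall_of_bound hrad) (fun x hx => source_eq_zero hx) hG hψ
  filter_upwards [h1] with x hx hxR
  rw [← hx hxR]
  ring

/-! ### Non-vanishing -/

/-- The quantitative Lippmann–Schwinger equation on `B_R`: up to the constant `c m` produced by
the constant part `c` of the kernel, the continuous representative `v` differs from the incident
wave by a small multiple of its maximum `M`. -/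
lemma exists_representative {R : ℝ} (hR : 0 < R) (hn : 2 ≤ n) (hk : 0 < k) {V ui u : Space n → ℂ}
    (hV : MemLp V ⊤ (volume.restrict (ball (0 : Space n) R))) (hui : IsUnitPlaneWave k ui)
    (h : IsTotalField k ((ball (0 : Space n) R).indicator V) ui u)
    (hG : OutgoingProfile n k G G') {c : ℂ} {C : ℝ} (hC : 0 ≤ C)
    (hGc : ∀ r, 0 < r → r ≤ 2 * R → ‖G r - c‖ ≤ C / r ^ (n - 1)) :
    ∃ (v : Space n → ℂ) (M : ℝ) (m : ℂ) (x₀ : Space n), Continuous v ∧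
      u =ᵐ[volume.restrict (ball 0 R)] v ∧ x₀ ∈ closedBall (0 : Space n) R ∧ ‖v x₀‖ = M ∧
      ‖m‖ ≤ k ^ 2 * (eLpNorm V ⊤ (volume.restrict (ball (0 : Space n) R))).toReal * M *
        volume.real (ball (0 : Space n) R) ∧
      ∀ x ∈ closedBall (0 : Space n) R, ‖v x - (ui x + c * m)‖ ≤
        k ^ 2 * (eLpNorm V ⊤ (volume.restrict (ball (0 : Space n) R))).toReal * M * (C *
          ∫ z, (ball (0 : Space n) (2 * R)).indicator (fun z => (‖z‖ ^ (n - 1))⁻¹) z) := by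
  have hn0 : 0 < n := by omega
  set Q := (eLpNorm V ⊤ (volume.restrict (ball (0 : Space n) R))).toReal with hQ
  have hQ0 : 0 ≤ Q := ENNReal.toReal_nonneg
  set f := source k R V u with hf
  have hu := h.memH1Loc.memL2Loc
  have mf : MemLp f 2 := memLp_source hV hu
  set v : Space n → ℂ := fun x => ui x + localPotential G R f x with hv
  have cv : Continuous v := hui.continuous.add (hG.continuous_localPotential hn0 R mf)
  have hae := h.ae_eq hn hk hV hui hG
  obtain ⟨x₀, hx₀, hmax⟩ := (isCompact_closedBall (0 : Space n) R).exists_isMaxOn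
    ⟨0, by simpa using hR.le⟩ cv.norm.continuousOn
  -- on `B_R` the source can be bounded by `v`, since `u = v` almost everywhere there
  have hfb : ∀ᵐ y, ‖f y‖ ≤ (ball (0 : Space n) R).indicator (fun _ => k ^ 2 * Q * ‖v x₀‖) y := by
    filter_upwards [hae, ae_norm_indicator_le hV] with y hy hy2
    by_cases hyR : y ∈ ball (0 : Space n) R
    · rw [indicator_of_mem hyR, hf, source, norm_mul, norm_mul, norm_pow, Complex.norm_real,
        Real.norm_eq_abs, sq_abs, hy hyR]
      have : ‖v y‖ ≤ ‖v x₀‖ := hmax (ball_subset_closedBall hyR)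
      gcongr
    · rw [indicator_of_notMem hyR, hf, source_eq_zero (by simpa using hyR), norm_zero]
  have iball : Integrable ((ball (0 : Space n) R).indicator fun _ => k ^ 2 * Q * ‖v x₀‖) :=
    (integrable_indicator_iff measurableSet_ball).2 (integrableOn_const measure_ball_lt_top.ne)
  have iF : Integrable f := iball.mono' mf.1 hfb
  refine ⟨v, ‖v x₀‖, ∫ y, f y, x₀, cv, ?_, hx₀, rfl, ?_, fun x hx => ?_⟩
  · rw [Filter.EventuallyEq, ae_restrict_iff' measurableSet_ball]
    exact hae
  · refine (norm_integral_le_of_norm_le iball hfb).trans (le_of_eq ?_)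
    rw [integral_indicator measurableSet_ball, setIntegral_const, smul_eq_mul, mul_comm]
  · set K := (ball (0 : Space n) (2 * R)).indicator (fun z => G ‖z‖) with hK
    set L := (ball (0 : Space n) (2 * R)).indicator (fun z : Space n => (‖z‖ ^ (n - 1))⁻¹) with hL
    have iL : Integrable L := integrable_ball_inv_pow hn0 (2 * R)
    have hbd : ∀ᵐ y, ‖f y * (K (x - y) - c)‖ ≤ k ^ 2 * Q * ‖v x₀‖ * C * L (x - y) := by
      have hne : ∀ᵐ y, x - y ≠ 0 := by
        have : Nonempty (Fin n) := ⟨⟨0, hn0⟩⟩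
        have h0 : ∀ᵐ y : Space n, y ≠ x := compl_mem_ae_iff.2 (measure_singleton x)
        filter_upwards [h0] with y hy h
        exact hy (sub_eq_zero.1 h).symm
      filter_upwards [hfb, hne] with y hy hxy
      have hL0 : 0 ≤ L (x - y) := indicator_nonneg (fun z _ => by positivity) _
      by_cases hyR : y ∈ ball (0 : Space n) R
      · rw [indicator_of_mem hyR] at hy
        have hmem : x - y ∈ ball (0 : Space n) (2 * R) := by
          rw [mem_ball_zero_iff] at hyR ⊢
          rw [mem_closedBall_zero_iff] at hx
          have := norm_sub_le x y
          linarith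
        have h1 : ‖K (x - y) - c‖ ≤ C * L (x - y) := by
          rw [hK, hL, indicator_of_mem hmem, indicator_of_mem hmem, ← div_eq_mul_inv]
          exact hGc _ (norm_pos_iff.2 hxy) (mem_ball_zero_iff.1 hmem).le
        rw [norm_mul]
        calc _ ≤ k ^ 2 * Q * ‖v x₀‖ * (C * L (x - y)) := by gcongr
          _ = _ := by ring
      · rw [hf, source_eq_zero (by simpa using hyR), zero_mul, norm_zero]
        positivity
    have iKf : Integrable fun y => f y * (K (x - y) - c) := by
      refine Integrable.mono' ((iL.comp_sub_left x).const_mul _) ?_ hbd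
      exact mf.1.mul (((hG.integrable_ball hn0 (2 * R)).comp_sub_left x).1.sub
        aestronglyMeasurable_const)
    have e1 : v x - (ui x + c * ∫ y, f y) = ∫ y, f y * (K (x - y) - c) := by
      have e2 : localPotential G R f x = (∫ y, f y * (K (x - y) - c)) + ∫ y, c * f y := by
        rw [← integral_add iKf (iF.const_mul c), localPotential]
        congr 1
        ext y
        ring
      rw [hv]
      simp only
      rw [e2, integral_const_mul]
      ring
    rw [e1]
    refine (norm_integral_le_of_norm_le ((iL.comp_sub_left x).const_mul _) hbd).trans
      (le_of_eq ?_)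
    rw [integral_const_mul, integral_sub_left_eq_self L]
    ring

end HelmholtzScattering

theorem mainTheorem7 (n : ℕ) (hn : n = 2 ∨ n = 3) (R : ℝ) (hR : 0 < R) :
    ∃ C : ℝ, 0 < C ∧
      ∀ (k : ℝ), 0 < k →
      ∀ (V ui u : EuclideanSpace ℝ (Fin n) → ℂ),
        MemLp V ⊤ (volume.restrict (ball (0 : EuclideanSpace ℝ (Fin n)) R)) →
        k ^ 2 * (eLpNorm V ⊤
          (volume.restrict (ball (0 : EuclideanSpace ℝ (Fin n)) R))).toReal < C →
        HelmholtzScattering.IsUnitPlaneWave k ui →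
        HelmholtzScattering.IsTotalField k
          ((ball (0 : EuclideanSpace ℝ (Fin n)) R).indicator V) ui u →
        ∃ v : EuclideanSpace ℝ (Fin n) → ℂ,
          ContinuousOn v (ball 0 R) ∧
          u =ᵐ[volume.restrict (ball 0 R)] v ∧
          ∀ x ∈ ball (0 : EuclideanSpace ℝ (Fin n)) R, v x ≠ 0 := by
  obtain ⟨C₁, hC₁, hprof⟩ := HelmholtzScattering.exists_outgoingProfile hn hR
  set b := volume.real (ball (0 : EuclideanSpace ℝ (Fin n)) R) with hb
  have hb0 : 0 ≤ b := measureReal_nonneg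
  set κ := C₁ * ∫ z, (ball (0 : EuclideanSpace ℝ (Fin n)) (2 * R)).indicator
    (fun z => (‖z‖ ^ (n - 1))⁻¹) z with hκ
  have hκ0 : 0 ≤ κ :=
    mul_nonneg hC₁.le (integral_nonneg fun z => Set.indicator_nonneg (fun z _ => by positivity) _)
  set D := 4 / 3 * R + 8 / 3 * (C₁ * b * R) with hD
  have hD0 : 0 ≤ D := by positivity
  -- The threshold for `√k` separating low from higher frequencies: below it, `D √k < 1`.
  -- At low frequencies a zero of the field would give `|a| + |c m| ≤ D √k`.
  set s₀ := 1 / (1 + D) with hs₀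
  have hs₀0 : 0 < s₀ := by positivity
  set S := 1 + 8 * κ + 4 * (C₁ / s₀ * b) with hS
  have hS1 : 0 < S := by positivity
  refine ⟨1 / S, by positivity, fun k hk V ui u hV hq hui hu => ?_⟩
  set q := k ^ 2 * (eLpNorm V ⊤
    (volume.restrict (ball (0 : EuclideanSpace ℝ (Fin n)) R))).toReal with hq'
  have hq0 : 0 ≤ q := mul_nonneg (sq_nonneg k) ENNReal.toReal_nonneg
  have hqS : q * S < 1 := (lt_div_iff₀ hS1).1 hq
  have hT : 0 ≤ C₁ / s₀ * b := by positivity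
  have hq1 : q ≤ 1 := by nlinarith [mul_nonneg hq0 hκ0, mul_nonneg hq0 hT]
  have hqκ : q * κ ≤ 1 / 8 := by nlinarith [mul_nonneg hq0 hκ0, mul_nonneg hq0 hT]
  have hqT : q * (C₁ / s₀ * b) ≤ 1 / 4 - q * κ := by
    nlinarith [mul_nonneg hq0 hκ0, mul_nonneg hq0 hT]
  obtain ⟨G, G', c, hG, hGc, hck⟩ := hprof k hk
  obtain ⟨v, M, m, x₀, cv, hae, hx₀, hM, hm, hrep⟩ :=
    HelmholtzScattering.exists_representative hR (by omega) hk hV hui hu hG hC₁.le hGc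
  refine ⟨v, cv.continuousOn, hae, fun x hx hvx => ?_⟩
  have hM0 : 0 ≤ M := hM ▸ norm_nonneg _
  rw [← hκ, ← hq'] at hrep
  rw [← hb, ← hq'] at hm
  have h0 := hrep x₀ hx₀
  have h1 := hrep x (ball_subset_closedBall hx)
  rw [hvx, zero_sub, norm_neg] at h1
  have hqκM : q * M * κ ≤ 1 / 8 * M := by nlinarith
  rcases lt_or_ge (√k) s₀ with hks | hks
  · -- Low frequencies: `v` is close to the constant `a`. A zero makes `a`, hence `M` and `m`, of
    -- order `k`, and then `1 = |uⁱ(0)| ≤ |a| + |c m|` fails.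
    set a := ui 0 + c * m with ha
    have hui1 : ∀ y ∈ closedBall (0 : EuclideanSpace ℝ (Fin n)) R, ‖ui y - ui 0‖ ≤ k * R :=
      fun y hy => (hui.norm_sub_le hk y).trans
        (mul_le_mul_of_nonneg_left (mem_closedBall_zero_iff.1 hy) hk.le)
    have hMa : M ≤ ‖a‖ + k * R + 1 / 8 * M := by
      have e : v x₀ = a + (ui x₀ - ui 0) + (v x₀ - (ui x₀ + c * m)) := by
        rw [ha]
        ring
      calc M = ‖a + (ui x₀ - ui 0) + (v x₀ - (ui x₀ + c * m))‖ := by rw [← e, hM]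
        _ ≤ ‖a‖ + ‖ui x₀ - ui 0‖ + ‖v x₀ - (ui x₀ + c * m)‖ := norm_add₃_le
        _ ≤ _ := by linarith [hui1 x₀ hx₀]
    have haM : ‖a‖ ≤ k * R + 1 / 8 * M := by
      have e : a = (ui x + c * m) - (ui x - ui 0) := by
        rw [ha]
        ring
      rw [e]
      refine (norm_sub_le _ _).trans ?_
      linarith [hui1 x (ball_subset_closedBall hx)]
    have h1a : 1 ≤ ‖a‖ + ‖c‖ * ‖m‖ := by
      have e : ui 0 = a - c * m := by
        rw [ha]
        ring
      rw [← hui.norm_eq_one 0, e, ← norm_mul]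
      exact norm_sub_le _ _
    have hMk : M ≤ 8 / 3 * (k * R) := by linarith
    have hak : ‖a‖ ≤ 4 / 3 * (k * R) := by linarith
    have hsq : √k * √k = k := Real.mul_self_sqrt hk.le
    have hs0 : 0 ≤ √k := Real.sqrt_nonneg k
    have hs1 : √k ≤ 1 := by
      refine hks.le.trans ?_
      rw [hs₀, div_le_one (by positivity)]
      linarith
    have hkk : k ≤ √k := by nlinarith
    have hcm : ‖c‖ * ‖m‖ ≤ 8 / 3 * (C₁ * b * R) * √k := by
      have hmb : ‖m‖ ≤ 8 / 3 * (k * R) * b := by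
        have : q * M ≤ 8 / 3 * (k * R) := (mul_le_of_le_one_left hM0 hq1).trans hMk
        exact hm.trans (mul_le_mul_of_nonneg_right this hb0)
      calc ‖c‖ * ‖m‖ ≤ ‖c‖ * (8 / 3 * (k * R) * b) := by gcongr
        _ = ‖c‖ * √k * (8 / 3 * R * b * √k) := by
          nth_rewrite 1 [← hsq]
          ring
        _ ≤ C₁ * (8 / 3 * R * b * √k) := by gcongr
        _ = _ := by ring
    have hfin : 1 ≤ D * √k := by
      have : k * R ≤ √k * R := by gcongr
      rw [hD]
      linarith
    have : √k * (1 + D) < 1 := (lt_div_iff₀ (by positivity)).1 hks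
    linarith
  · -- Higher frequencies: `c` is bounded and `v` is within `M / 4` of the incident wave. This gives
    -- `M ≤ 4 / 3`, while a zero gives `1 ≤ M / 4`.
    have hc : ‖c‖ ≤ C₁ / s₀ := by
      rw [le_div_iff₀ hs₀0]
      exact (mul_le_mul_of_nonneg_left hks (norm_nonneg c)).trans hck
    have hcm : ‖c * m‖ ≤ (1 / 4 - q * κ) * M := by
      rw [norm_mul]
      calc ‖c‖ * ‖m‖ ≤ C₁ / s₀ * (q * M * b) := by gcongr
        _ = q * (C₁ / s₀ * b) * M := by ring
        _ ≤ _ := by gcongr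
    have hM1 : M ≤ 1 + 1 / 4 * M := by
      have e : v x₀ = ui x₀ + c * m + (v x₀ - (ui x₀ + c * m)) := by ring
      calc M = ‖ui x₀ + c * m + (v x₀ - (ui x₀ + c * m))‖ := by rw [← e, hM]
        _ ≤ ‖ui x₀‖ + ‖c * m‖ + ‖v x₀ - (ui x₀ + c * m)‖ := norm_add₃_le
        _ ≤ _ := by
          rw [hui.norm_eq_one]
          linarith
    have hx1 : 1 ≤ 1 / 4 * M := by
      have e : ui x = (ui x + c * m) - c * m := by ring
      calc 1 = ‖ui x + c * m - c * m‖ := by rw [← e, hui.norm_eq_one]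
        _ ≤ ‖ui x + c * m‖ + ‖c * m‖ := norm_sub_le _ _
        _ ≤ _ := by linarith
    linarith
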